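/- Let $G$ be a (finite-dimensional, real, smooth) Lie group with Lie algebra $\mathfrak g$ (the bracket being that of left-invariant vector fields), equipped with a nondegenerate symmetric bilinear form $\langle\ ,\ \rangle$ invariant under $\mathrm{Ad}_g$ for all $g\in G$. For $\alpha\in\mathfrak g^*$ let $\underline\alpha\in\mathfrak g$ be defined by $\alpha=\langle\underline\alpha,\cdot\rangle$; superscripts $L$, $R$ denote the left- and right-invariant extensions of elements of $\mathfrak g$ and of $\wedge^\bullet\mathfrak g^*$. Let $G_0$ be the set of all $g\in G$ such that $-1$ is not an eigenvalue of $\mathrm{Ad}_g$. Conventions. For a bivector field $\pi$ on a manifold, $\langle\beta,\pi^\sharp\alpha\rangle=\pi(\alpha,\beta)$ and $i_{X\wedge Y}=i_X\circ i_Y$, so $i_\pi(\alpha\wedge\beta)=-\pi(\alpha,\beta)$. A twisted Poisson manifold $(M,\pi,\psi)$ is a manifold with a smooth bivector field $\pi$ and a smooth closed $3$-form $\psi$ such that $\frac12[\pi,\pi](\alpha,\beta,\gamma)=\psi(\pi^\sharp\alpha,\pi^\sharp\beta,\pi^\sharp\gamma)$ for all covectors $\alpha,\beta,\gamma$, where $[\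 ,\ ]$ is the Schouten bracket, normalized by $\frac12[X\wedge Y,X\wedge Y]=[X,Y]\wedge X\wedge Y$. For a volume form $\lambda$ on $M$, its modular vector field is $Z_{\pi,\psi,\lambda}=X_{\pi,\lambda}+Y_{\pi,\psi}$, where $Y_{\pi,\psi}=\pi^\sharp(i_\pi\psi)$ and $X_{\pi,\lambda}$ is the vector field such that $\langle\alpha,X_{\pi,\lambda}\rangle\lambda=\mathcal L_{\pi^\sharp\alpha}\lambda-(i_\pi d\alpha)\lambda$ for every smooth $1$-form $\alpha$. An orientable twisted Poisson manifold $(M,\pi,\psi)$ is unimodular if the class of $Z_{\pi,\psi,\lambda}$ in the first $d_{\pi,\psi}$-cohomology vanishes, that is, if for every volume form $\lambda$ there is $f\in C^\infty(M)$ with $Z_{\pi,\psi,\lambda}=d_{\pi,\psi}f=[\pi,f]=-\pi^\sharp(df)$. Proposition. The set $G_0$ is open in $G$, and dense if $G$ is connected. The element $(X,Y,Z)\mapsto\frac12\langle X,[Y,Z]\rangle$ of $\wedge^3\mathfrak g^*$ extends to a bi-invariant $3$-form $\psi$ on $G$ (the Cartan $3$-form). There is a unique bivector field $\pi$ on $G_0$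 such that $$\pi^\sharp(\alpha^L+\alpha^R)=2(\underline\alpha^L-\underline\alpha^R)\qquad\text{for all }\alpha\in\mathfrak g^*,$$ and $(G_0,\pi,\psi)$ is a twisted Poisson manifold. There is a volume form on $G_0$ which is both left- and right-invariant (that is, whose value at every $g\in G_0$ is both the left and the right translate of one fixed element of $\wedge^{\dim G}\mathfrak g^*$); for every such volume form $\lambda$ the modular vector field $Z_{\pi,\psi,\lambda}$ vanishes on $G_0$; and the twisted Poisson manifold $(G_0,\pi,\psi)$ is unimodular. -/

import Mathlib

open scoped Manifold ContDiff

noncomputable section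

namespace TwistedPoisson

/-! ### Multilinear algebra on one tangent space -/

section LinearAlgebra

variable {V : Type*} [AddCommGroup V] [Module ℝ V] [TopologicalSpace V]

/-- The interior product `i_v η = η(v, ·, …, ·)`. -/
def interiorProduct {k : ℕ} (v : V) (η : V [⋀^Fin (k + 1)]→L[ℝ] ℝ) : V [⋀^Fin k]→L[ℝ] ℝ :=
  { η.toAlternatingMap.curryLeft v with
    cont := η.cont.comp (Continuous.finCons continuous_const continuous_id) }

theorem interiorProduct_apply {k : ℕ} (v : V) (η : V [⋀^Fin (k + 1)]→L[ℝ] ℝ) (m : Fin k → V) :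
    interiorProduct v η m = η (Matrix.vecCons v m) := rfl

variable [IsTopologicalAddGroup V] [ContinuousSMul ℝ V]

/-- A bivector on the finite-dimensional space `V`, as an alternating bilinear form on `V*`;
`e ∧ f` is the form `(α, β) ↦ α e * β f - α f * β e`. -/
abbrev Bivector (V : Type*) [AddCommGroup V] [Module ℝ V] [TopologicalSpace V]
    [IsTopologicalAddGroup V] [ContinuousSMul ℝ V] : Type _ :=
  (V →L[ℝ] ℝ) [⋀^Fin 2]→L[ℝ] ℝ

/-- A covector seen as an alternating form of degree one. -/
def oneForm (α : V →L[ℝ] ℝ) : V [⋀^Fin 1]→L[ℝ] ℝ :=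
  ContinuousAlternatingMap.ofSubsingleton ℝ V ℝ 0 α

/-- An alternating form of degree one seen as a covector. -/
def toCovector (η : V [⋀^Fin 1]→L[ℝ] ℝ) : V →L[ℝ] ℝ :=
  (ContinuousAlternatingMap.ofSubsingleton ℝ V ℝ 0).symm η

variable [T2Space V] [FiniteDimensional ℝ V]

/-- The map `π♯ : V* → V` of a bivector `π`: the vector `π♯ α` is characterised by
`⟨β, π♯ α⟩ = π(α, β)` for every covector `β` (see `apply_sharp`). -/
def sharp (P : Bivector V) : (V →L[ℝ] ℝ) →ₗ[ℝ] V :=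
  (Module.evalEquiv ℝ V).symm.toLinearMap ∘ₗ
    LinearMap.mk₂ ℝ
      (fun (α : V →L[ℝ] ℝ) (β : Module.Dual ℝ V) => P ![α, LinearMap.toContinuousLinearMap β])
      (fun α α' β => P.toAlternatingMap.map_vecCons_add _ α α')
      (fun c α β => P.toAlternatingMap.map_vecCons_smul _ c α)
      (fun α β β' => by
        rw [map_add]
        exact (interiorProduct α P).toAlternatingMap.map_vecCons_add ![] _ _)
      (fun c α β => by
        rw [map_smul]
        exact (interiorProduct α P).toAlternatingMap.map_vecCons_smul ![] _ _)

theorem apply_sharp (P : Bivector V) (α β : V →L[ℝ] ℝ) : β (sharp P α) = P ![α, β] := by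
  have h : ∀ φ : Module.Dual ℝ (Module.Dual ℝ V),
      (β : V →ₗ[ℝ] ℝ) ((Module.evalEquiv ℝ V).symm φ) = φ (β : V →ₗ[ℝ] ℝ) := by
    intro φ
    obtain ⟨v, rfl⟩ := (Module.evalEquiv ℝ V).surjective φ
    simp
  exact h _

/-- The scalar `i_π η` for a `2`-form `η`, with the convention `i_{X ∧ Y} = i_X ∘ i_Y`, so that
`i_π (α ∧ β) = - π(α, β)` and, in dual bases, `i_π η = - 1/2 ∑ₖ η(eₖ, π♯ εᵏ)`. It is written here
as half the trace of the endomorphism `v ↦ π♯ (i_v η)`. -/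
def contract (P : Bivector V) (η : V [⋀^Fin 2]→L[ℝ] ℝ) : ℝ :=
  (1 / 2) * LinearMap.trace ℝ V
    { toFun := fun v => sharp P (toCovector (interiorProduct v η))
      map_add' := fun v w => by
        rw [← map_add]
        congr 1
        ext u
        exact η.toAlternatingMap.map_vecCons_add _ v w
      map_smul' := fun c v => by
        rw [RingHom.id_apply, ← map_smul]
        congr 1
        ext u
        exact η.toAlternatingMap.map_vecCons_smul _ c v }

/-- The covector `i_π ψ` for a `3`-form `ψ`: `⟨i_π ψ, w⟩ = i_π (i_w ψ)`. -/
def contractThree (P : Bivector V) (ψ : V [⋀^Fin 3]→L[ℝ] ℝ) : V →L[ℝ] ℝ :=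
  LinearMap.toContinuousLinearMap
    { toFun := fun w => contract P (interiorProduct w ψ)
      map_add' := fun w w' => by
        unfold contract
        rw [← mul_add, ← map_add]
        congr 2
        ext v
        change sharp P _ = sharp P _ + sharp P _
        rw [← map_add]
        congr 1
        ext u
        exact ψ.toAlternatingMap.map_vecCons_add _ w w'
      map_smul' := fun c w => by
        unfold contract
        rw [RingHom.id_apply, smul_eq_mul, mul_left_comm, ← smul_eq_mul (a := c), ← map_smul]
        congr 2
        ext v
        change sharp P _ = c • sharp P _
        rw [← map_smul]
        congr 1
        ext u
        exact ψ.toAlternatingMap.map_vecCons_smul _ c w }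

end LinearAlgebra

/-! ### Tensor fields on a manifold without boundary -/

section Manifold

variable {E : Type*} [NormedAddCommGroup E] [NormedSpace ℝ E]
  {M : Type*} [TopologicalSpace M] [ChartedSpace E M]

instance (x : M) : T2Space (TangentSpace 𝓘(ℝ, E) x) := inferInstanceAs (T2Space E)

instance [FiniteDimensional ℝ E] (x : M) : FiniteDimensional ℝ (TangentSpace 𝓘(ℝ, E) x) :=
  inferInstanceAs (FiniteDimensional ℝ E)

variable (E M) in
/-- Vector fields. -/
abbrev VectorField : Type _ := (x : M) → TangentSpace 𝓘(ℝ, E) x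

variable (E M) in
/-- Differential forms of degree `k`. -/
abbrev FormField (k : ℕ) : Type _ := (x : M) → TangentSpace 𝓘(ℝ, E) x [⋀^Fin k]→L[ℝ] ℝ

variable (E M) in
/-- Differential forms of degree one, as fields of covectors. -/
abbrev CovectorField : Type _ := (x : M) → TangentSpace 𝓘(ℝ, E) x →L[ℝ] ℝ

variable (E M) in
/-- Bivector fields. -/
abbrev BivectorField : Type _ := (x : M) → Bivector (TangentSpace 𝓘(ℝ, E) x)

/-- The derivative at `y` of the inverse of the preferred chart at `x₀`. -/
def chartSymmDeriv (x₀ : M) (y : E) :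
    E →L[ℝ] TangentSpace 𝓘(ℝ, E) ((extChartAt 𝓘(ℝ, E) x₀).symm y) :=
  mfderivWithin 𝓘(ℝ, E) 𝓘(ℝ, E) (extChartAt 𝓘(ℝ, E) x₀).symm (Set.range 𝓘(ℝ, E)) y

/-- The derivative at `x` of the preferred chart at `x₀`. -/
def chartDeriv (x₀ x : M) : TangentSpace 𝓘(ℝ, E) x →L[ℝ] E :=
  mfderiv 𝓘(ℝ, E) 𝓘(ℝ, E) (extChartAt 𝓘(ℝ, E) x₀) x

/-- The expression of a differential form in the preferred chart at `x₀`. -/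
def formInChart {k : ℕ} (η : FormField E M k) (x₀ : M) (y : E) : E [⋀^Fin k]→L[ℝ] ℝ :=
  (η ((extChartAt 𝓘(ℝ, E) x₀).symm y)).compContinuousLinearMap (chartSymmDeriv x₀ y)

/-- The expression of a bivector field in the preferred chart at `x₀`. -/
def bivectorInChart (π : BivectorField E M) (x₀ : M) (y : E) : Bivector E :=
  (π ((extChartAt 𝓘(ℝ, E) x₀).symm y)).compContinuousLinearMap
    (ContinuousLinearMap.precomp ℝ (chartDeriv x₀ ((extChartAt 𝓘(ℝ, E) x₀).symm y)))

/-- Smoothness of a differential form on an open set, read in charts. -/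
def SmoothFormOn {k : ℕ} (η : FormField E M k) (U : Set M) : Prop :=
  ∀ x ∈ U, ContDiffAt ℝ ∞ (formInChart η x) (extChartAt 𝓘(ℝ, E) x x)

/-- Smoothness of a bivector field on an open set, read in charts. -/
def SmoothBivectorOn [FiniteDimensional ℝ E] (π : BivectorField E M) (U : Set M) : Prop :=
  ∀ x ∈ U, ContDiffAt ℝ ∞ (bivectorInChart π x) (extChartAt 𝓘(ℝ, E) x x)

/-- Smoothness of a field of covectors on an open set. -/
def SmoothCovectorOn (α : CovectorField E M) (U : Set M) : Prop :=
  SmoothFormOn (fun x => oneForm (α x)) U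

/-- The de Rham differential of a differential form, computed in the preferred chart. -/
def dForm {k : ℕ} (η : FormField E M k) : FormField E M (k + 1) := fun x =>
  (extDeriv (formInChart η x) (extChartAt 𝓘(ℝ, E) x x)).compContinuousLinearMap (chartDeriv x x)

/-- The de Rham differential of a `1`-form given as a field of covectors. -/
def dCovector (α : CovectorField E M) : FormField E M 2 := dForm fun x => oneForm (α x)

/-- The differential of a function, as a field of covectors. -/
def dFun (f : M → ℝ) : CovectorField E M := fun x => mfderiv 𝓘(ℝ, E) 𝓘(ℝ, ℝ) f x

/-- The Lie derivative of a differential form along a vector field,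
`L_X = i_X ∘ d + d ∘ i_X` (the second term being zero in degree zero). -/
def lieDeriv (X : VectorField E M) : {k : ℕ} → FormField E M k → FormField E M k
  | 0, η => fun x => interiorProduct (X x) (dForm η x)
  | _ + 1, η => fun x => interiorProduct (X x) (dForm η x) + dForm (fun y => interiorProduct (X y) (η y)) x

variable [FiniteDimensional ℝ E]

/-- The vector field `π♯ α`. -/
def sharpField (π : BivectorField E M) (α : CovectorField E M) : VectorField E M :=
  fun x => sharp (π x) (α x)

/-- The trivector `(1/2) [π, π]`, half the Schouten (Gerstenhaber) bracket of `π` with itself,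
evaluated on three covectors at `x`. In a chart, for `π = (1/2) ∑ πⁱʲ ∂ᵢ ∧ ∂ⱼ`, its components are
`∑ₗ (πⁱˡ ∂ₗ πʲᵏ + πʲˡ ∂ₗ πᵏⁱ + πᵏˡ ∂ₗ πⁱʲ)`, that is, for constant covectors `a`, `b`, `c`, the cyclic
sum of the derivatives of `π(b, c)` along `π♯ a`. For instance
`(1/2) [X ∧ Y, X ∧ Y] = [X, Y] ∧ X ∧ Y`. -/
def halfSchouten (π : BivectorField E M) (x : M) (α β γ : TangentSpace 𝓘(ℝ, E) x →L[ℝ] ℝ) : ℝ :=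
  let y₀ : E := extChartAt 𝓘(ℝ, E) x x
  let P : E → Bivector E := bivectorInChart π x
  let D : E →L[ℝ] TangentSpace 𝓘(ℝ, E) x :=
    mfderivWithin 𝓘(ℝ, E) 𝓘(ℝ, E) (extChartAt 𝓘(ℝ, E) x).symm (Set.range 𝓘(ℝ, E)) y₀
  let a : E →L[ℝ] ℝ := α.comp D
  let b : E →L[ℝ] ℝ := β.comp D
  let c : E →L[ℝ] ℝ := γ.comp D
  fderiv ℝ P y₀ (sharp (P y₀) a) ![b, c] + fderiv ℝ P y₀ (sharp (P y₀) b) ![c, a]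
    + fderiv ℝ P y₀ (sharp (P y₀) c) ![a, b]

/-- `(U, π, ψ)` is a twisted Poisson manifold: `U` is open, `π` is a smooth bivector field on `U`,
`ψ` is a smooth closed `3`-form on `U`, and `(1/2) [π, π] = (∧³ π♯) ψ`, where
`((∧³ π♯) ψ)(α, β, γ) = ψ(π♯ α, π♯ β, π♯ γ)`. -/
structure IsTwistedPoissonOn (π : BivectorField E M) (ψ : FormField E M 3) (U : Set M) :
    Prop where
  isOpen : IsOpen U
  smooth_bivector : SmoothBivectorOn π U
  smooth_form : SmoothFormOn ψ U
  closed : ∀ x ∈ U, dForm ψ x = 0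
  schouten : ∀ x ∈ U, ∀ α β γ : TangentSpace 𝓘(ℝ, E) x →L[ℝ] ℝ,
    halfSchouten π x α β γ = ψ x ![sharp (π x) α, sharp (π x) β, sharp (π x) γ]

/-- A volume form on `U`: a smooth nowhere-vanishing form of top degree. -/
def IsVolumeFormOn (vol : FormField E M (Module.finrank ℝ E)) (U : Set M) : Prop :=
  SmoothFormOn vol U ∧ ∀ x ∈ U, vol x ≠ 0

/-- `X` is the vector field `X_{π,λ}` on `U`: for every smooth `1`-form `α` on `U`,
`⟨α, X⟩ λ = L_{π♯ α} λ - (i_π dα) λ`. -/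
def IsDivergenceFieldOn (π : BivectorField E M) (vol : FormField E M (Module.finrank ℝ E))
    (U : Set M) (X : VectorField E M) : Prop :=
  ∀ α : CovectorField E M, SmoothCovectorOn α U → ∀ x ∈ U,
    (α x (X x)) • vol x =
      lieDeriv (sharpField π α) vol x - (contract (π x) (dCovector α x)) • vol x

/-- The vector field `Y_{π,ψ} = π♯ (i_π ψ)`. -/
def twistField (π : BivectorField E M) (ψ : FormField E M 3) : VectorField E M :=
  fun x => sharp (π x) (contractThree (π x) (ψ x))

/-- `Z` is the modular vector field `Z_{π,ψ,λ} = X_{π,λ} + Y_{π,ψ}` on `U`. -/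
def IsModularFieldOn (π : BivectorField E M) (ψ : FormField E M 3)
    (vol : FormField E M (Module.finrank ℝ E)) (U : Set M) (Z : VectorField E M) : Prop :=
  ∃ X : VectorField E M, IsDivergenceFieldOn π vol U X ∧ ∀ x ∈ U, Z x = X x + twistField π ψ x

/-- The differential `d_{π,ψ}` on functions, `d_{π,ψ} f = [π, f] = - π♯ (df)`. -/
def dPoisson (π : BivectorField E M) (f : M → ℝ) : VectorField E M :=
  fun x => - sharp (π x) (dFun f x)

/-- The (orientable) twisted Poisson manifold `(U, π, ψ)` is unimodular: the class of the modular
vector field in the first `d_{π,ψ}`-cohomology vanishes, i.e. for every volume form the modular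
vector field is `d_{π,ψ} f` for a smooth function `f` on `U`. -/
def IsUnimodularOn (π : BivectorField E M) (ψ : FormField E M 3) (U : Set M) : Prop :=
  (∃ vol : FormField E M (Module.finrank ℝ E), IsVolumeFormOn vol U) ∧
  ∀ vol : FormField E M (Module.finrank ℝ E), IsVolumeFormOn vol U →
    ∃ f : M → ℝ, ContMDiffOn 𝓘(ℝ, E) 𝓘(ℝ, ℝ) ∞ f U ∧ IsModularFieldOn π ψ vol U (dPoisson π f)

end Manifold

/-! ### Invariant tensors on a Lie group -/

section LieGroup

variable {E : Type*} [NormedAddCommGroup E] [NormedSpace ℝ E]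
  {G : Type*} [TopologicalSpace G] [ChartedSpace E G] [Group G]

/-- The adjoint action `Ad_g`, the derivative at `1` of `h ↦ g h g⁻¹`. -/
def Ad (g : G) : GroupLieAlgebra 𝓘(ℝ, E) G →L[ℝ] GroupLieAlgebra 𝓘(ℝ, E) G :=
  mfderiv 𝓘(ℝ, E) 𝓘(ℝ, E) (fun h : G => g * h * g⁻¹) 1

variable (E G) in
/-- The set `G₀` of the elements `g` such that `-1` is not an eigenvalue of `Ad_g`. -/
def regularSet : Set G :=
  {g | ¬ Module.End.HasEigenvalue
    (Ad (E := E) g : GroupLieAlgebra 𝓘(ℝ, E) G →ₗ[ℝ] GroupLieAlgebra 𝓘(ℝ, E) G) (-1)}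

/-- The left-invariant vector field `X^L`. -/
def leftField (X : GroupLieAlgebra 𝓘(ℝ, E) G) : VectorField E G := mulInvariantVectorField X

/-- The right-invariant vector field `X^R`. -/
def rightField (X : GroupLieAlgebra 𝓘(ℝ, E) G) : VectorField E G := fun g =>
  mfderiv 𝓘(ℝ, E) 𝓘(ℝ, E) (fun h : G => h * g) 1 X

/-- Left translation of tangent vectors to the identity. -/
def leftToOne (g : G) : TangentSpace 𝓘(ℝ, E) g →L[ℝ] GroupLieAlgebra 𝓘(ℝ, E) G :=
  mfderiv 𝓘(ℝ, E) 𝓘(ℝ, E) (fun h : G => g⁻¹ * h) g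

/-- Right translation of tangent vectors to the identity. -/
def rightToOne (g : G) : TangentSpace 𝓘(ℝ, E) g →L[ℝ] GroupLieAlgebra 𝓘(ℝ, E) G :=
  mfderiv 𝓘(ℝ, E) 𝓘(ℝ, E) (fun h : G => h * g⁻¹) g

/-- The left-invariant form `α^L`. -/
def leftForm {k : ℕ} (α : GroupLieAlgebra 𝓘(ℝ, E) G [⋀^Fin k]→L[ℝ] ℝ) : FormField E G k :=
  fun g => α.compContinuousLinearMap (leftToOne g)

/-- The right-invariant form `α^R`. -/
def rightForm {k : ℕ} (α : GroupLieAlgebra 𝓘(ℝ, E) G [⋀^Fin k]→L[ℝ] ℝ) : FormField E G k :=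
  fun g => α.compContinuousLinearMap (rightToOne g)

/-- A form which is both left- and right-invariant on `U`. -/
def IsBiinvariantOn {k : ℕ} (η : FormField E G k) (U : Set G) : Prop :=
  ∃ α : GroupLieAlgebra 𝓘(ℝ, E) G [⋀^Fin k]→L[ℝ] ℝ,
    ∀ g ∈ U, η g = leftForm α g ∧ η g = rightForm α g

variable [FiniteDimensional ℝ E]

/-- The covector `X̄ = ⟨X, ·⟩` on the Lie algebra. -/
def lower (B : LinearMap.BilinForm ℝ (GroupLieAlgebra 𝓘(ℝ, E) G))
    (X : GroupLieAlgebra 𝓘(ℝ, E) G) : GroupLieAlgebra 𝓘(ℝ, E) G →L[ℝ] ℝ :=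
  LinearMap.toContinuousLinearMap (B X)

/-- `ψ` is the Cartan `3`-form of `G`: the form which is left- and right-invariant, with value
`ψ(X, Y, Z) = (1/2) ⟨X, [Y, Z]⟩` at the identity. -/
def IsCartanForm (B : LinearMap.BilinForm ℝ (GroupLieAlgebra 𝓘(ℝ, E) G)) (ψ : FormField E G 3) :
    Prop :=
  ∃ ψ₁ : GroupLieAlgebra 𝓘(ℝ, E) G [⋀^Fin 3]→L[ℝ] ℝ,
    (∀ X Y Z : GroupLieAlgebra 𝓘(ℝ, E) G, ψ₁ ![X, Y, Z] = (1 / 2) * B X ⁅Y, Z⁆) ∧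
    ψ = leftForm ψ₁ ∧ ψ = rightForm ψ₁

/-- `π` is the Ševera–Weinstein bivector on `G₀`: `π♯ (α^L + α^R) = 2 (α̲^L - α̲^R)` for every
`α ∈ 𝔤*`, where `α̲ ∈ 𝔤` is the vector `X` with `α = ⟨X, ·⟩`. -/
def IsSeveraWeinsteinBivector (B : LinearMap.BilinForm ℝ (GroupLieAlgebra 𝓘(ℝ, E) G))
    (π : BivectorField E G) : Prop :=
  ∀ g ∈ regularSet E G, ∀ X : GroupLieAlgebra 𝓘(ℝ, E) G,
    sharp (π g) ((lower B X).comp (leftToOne g) + (lower B X).comp (rightToOne g)) =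
      (2 : ℝ) • (leftField X g - rightField X g)

end LieGroup

end TwistedPoisson

end

open TwistedPoisson

/-! ### Traces and determinants relative to a nondegenerate form. -/

section LinearAlgebra

open LinearMap (BilinForm)

variable {W : Type*} [AddCommGroup W] [Module ℝ W]

/-! Everything is read in the left-invariant trivialisation of the tangent bundle. There α^R becomes
α ∘ Ad_g, and the condition on π says that π♯, once 𝔤* is identified with 𝔤 by the form, is twice
the Cayley transform, K = 2 (A - 1)(A + 1)⁻¹ with A = Ad_g. Since A + 1 is invertible exactly on G₀,
every covector there has the form α^L + α^R (`exists_covector_eq`), which gives uniqueness. Since A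
is an isometry, K is skew and does come from a bivector.

Two properties of A carry the rest. First, dA = A ad_θ for the left Maurer-Cartan form θ, whence dK
= (1/4)(2 + K) ad_θ (2 - K). Second, A preserves T(x, y, z) = ⟨x, [y, z]⟩; as A (2 - K) = 2 + K, the
part of T((2 + K)x, (2 + K)y, (2 + K)z) odd in K vanishes (`twoCayley_triple`). Together with the
Maurer-Cartan equation they turn the Schouten bracket into (1/2) T(K·, K·, K·), the twist by ψ
(`halfSchouten_frame`). That ψ is closed is the Jacobi identity (`extDeriv_cartan_eq_zero`).

For the modular field, let s be the 𝔤-valued function representing a 1-form α. Each ad_x is skew,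
hence traceless, so the Lie derivative of a left-invariant volume along π♯ α is the trace of d(K s).
Subtracting i_π dα leaves (1/4) tr(K ad_{K s}) (`trace_fderiv_sharp_sub_contract`), and ⟨α, π♯ i_π
ψ⟩ is its negative (`apply_twistField`). For a volume form of density h the modular field is
therefore -π♯ d log|h|: always Hamiltonian, and zero when h is constant, as for a bi-invariant form.
Such a form exists because det Ad_g = 1 on G₀.

Openness of G₀ is continuity of Ad. For density, a polynomial in the matrix entries of Ad that
vanishes near 1 vanishes on all of a connected G, by a Noetherian argument
(`eval_eq_zero_of_eventually`); a translate of det(Ad + 1) is such a polynomial, and it is not zero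
at the identity.

The differential identities are proved on normed spaces for an abstract `IsMaurerCartanFrame`, which
`isMaurerCartanFrame` then supplies in each chart. -/

theorem trace_eq_of_isAdjointPair [FiniteDimensional ℝ W] {B : BilinForm ℝ W} (hB : B.Nondegenerate) {L L' : W →ₗ[ℝ] W}
    (h : ∀ x y, B (L x) y = B x (L' y)) : LinearMap.trace ℝ W L = LinearMap.trace ℝ W L' := by
  have key : (B.toDual hB).conj L = Module.Dual.transpose (R := ℝ) L' := by
    ext f y
    obtain ⟨x, rfl⟩ := (B.toDual hB).surjective f
    simp [LinearEquiv.conj_apply, Module.Dual.transpose_apply, BilinForm.toDual_def, h]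
  rw [← LinearMap.trace_conj' L (B.toDual hB), key, LinearMap.trace_transpose']

theorem trace_eq_zero_of_skew [FiniteDimensional ℝ W] {B : BilinForm ℝ W} (hB : B.Nondegenerate) {L : W →ₗ[ℝ] W}
    (h : ∀ x y, B (L x) y = - B x (L y)) : LinearMap.trace ℝ W L = 0 := by
  have := trace_eq_of_isAdjointPair hB (L := L) (L' := -L) (by simpa using h)
  rw [map_neg] at this
  linarith

theorem det_eq_of_isAdjointPair [FiniteDimensional ℝ W] {B : BilinForm ℝ W} (hB : B.Nondegenerate) {L L' : W →ₗ[ℝ] W}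
    (h : ∀ x y, B (L x) y = B x (L' y)) : LinearMap.det L = LinearMap.det L' := by
  have key : ((B.toDual hB : W →ₗ[ℝ] Module.Dual ℝ W) ∘ₗ L ∘ₗ
      ((B.toDual hB).symm : Module.Dual ℝ W →ₗ[ℝ] W)) = Module.Dual.transpose (R := ℝ) L' := by
    ext f y
    obtain ⟨x, rfl⟩ := (B.toDual hB).surjective f
    simp [Module.Dual.transpose_apply, BilinForm.toDual_def, h]
  rw [← LinearMap.det_conj L (B.toDual hB), key]
  exact LinearMap.det_dualMap L'

/-- An isometry of a nondegenerate bilinear form without eigenvalue `-1` has determinant one. -/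
theorem det_eq_one_of_isometry [FiniteDimensional ℝ W] {B : BilinForm ℝ W} (hB : B.Nondegenerate) {L : W →ₗ[ℝ] W}
    (h : ∀ x y, B (L x) (L y) = B x y) (h1 : LinearMap.det (L + 1) ≠ 0)
    (hL : IsUnit L) : LinearMap.det L = 1 := by
  obtain ⟨u, rfl⟩ := hL
  have huv : ∀ x, (u : W →ₗ[ℝ] W) ((↑u⁻¹ : W →ₗ[ℝ] W) x) = x := fun x => by
    rw [← Module.End.mul_apply, Units.mul_inv, Module.End.one_apply]
  -- The inverse of an isometry is its adjoint, so u + 1 and u⁻¹ + 1 have equal determinants; the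
  -- factorisation u (u⁻¹ + 1) = u + 1 then forces det u = 1.
  have hd : LinearMap.det ((u : W →ₗ[ℝ] W) + 1) = LinearMap.det ((↑u⁻¹ : W →ₗ[ℝ] W) + 1) := by
    apply det_eq_of_isAdjointPair hB
    intro x y
    simp only [LinearMap.add_apply, map_add, Module.End.one_apply]
    rw [← h x ((↑u⁻¹ : W →ₗ[ℝ] W) y), huv]
  have hm : (u : W →ₗ[ℝ] W) * ((↑u⁻¹ : W →ₗ[ℝ] W) + 1) = u + 1 := by
    rw [mul_add, Units.mul_inv, mul_one, add_comm]
  have := congrArg LinearMap.det hm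
  rw [map_mul, ← hd] at this
  exact mul_right_cancel₀ h1 (by rw [this, one_mul])

/-- Top-degree alternating forms: replacing the vectors of a basis one at a time by their images
under `L` multiplies the value by the trace of `L`. -/
theorem sum_alternating_update_eq_trace {n : ℕ} (e : Module.Basis (Fin n) ℝ W)
    (η : W [⋀^Fin n]→ₗ[ℝ] ℝ) (L : W →ₗ[ℝ] W) :
    ∑ i, η (Function.update e i (L (e i))) = LinearMap.trace ℝ W L * η e := by
  have h : ∀ i, η (Function.update e i (L (e i))) = e.repr (L (e i)) i * η e := by
    intro i
    conv_lhs => rw [← e.sum_repr (L (e i))]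
    rw [AlternatingMap.map_update_sum, Finset.sum_eq_single i]
    · rw [AlternatingMap.map_update_smul, Function.update_eq_self, smul_eq_mul]
    · intro j _ hj
      rw [AlternatingMap.map_update_smul, AlternatingMap.map_update_self _ _ hj.symm, smul_zero]
    · simp
  rw [LinearMap.trace_eq_matrix_trace ℝ e, Matrix.trace, Finset.sum_mul]
  refine Finset.sum_congr rfl fun i _ => ?_
  rw [h, Matrix.diag_apply, LinearMap.toMatrix_apply]

theorem alternating_eq_of_eq_on_basis {n : ℕ} (e : Module.Basis (Fin n) ℝ W)
    {η η' : W [⋀^Fin n]→ₗ[ℝ] ℝ} (h : η e = η' e) : η = η' := by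
  rw [η.eq_smul_basis_det e, η'.eq_smul_basis_det e, h]

end LinearAlgebra

/-! ### The Cayley transform and its derivative. -/

section Cayley

variable {W : Type*} [NormedAddCommGroup W] [NormedSpace ℝ W]

/-- Twice the Cayley transform `(A - 1) (A + 1)⁻¹`. -/
noncomputable def twoCayley (A : W →L[ℝ] W) : W →L[ℝ] W := (2 : ℝ) • ((A - 1) * Ring.inverse (A + 1))

theorem twoCayley_mul {A : W →L[ℝ] W} (h : IsUnit (A + 1)) :
    twoCayley A * (A + 1) = (2 : ℝ) • (A - 1) := by
  rw [twoCayley, smul_mul_assoc, mul_assoc, Ring.inverse_mul_cancel _ h, mul_one]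

theorem twoCayley_apply {A : W →L[ℝ] W} (h : IsUnit (A + 1)) (x : W) :
    twoCayley A (A x + x) = (2 : ℝ) • (A x - x) := by
  simpa using congrArg (fun L : W →L[ℝ] W => L x) (twoCayley_mul h)

theorem surjective_add_one {A : W →L[ℝ] W} (h : IsUnit (A + 1)) (y : W) : ∃ x, A x + x = y := by
  refine ⟨Ring.inverse (A + 1) y, ?_⟩
  simpa using congrArg (fun L : W →L[ℝ] W => L y) (Ring.mul_inverse_cancel _ h)

/-- For y = (A + 1) x the two vectors are 4 x and 4 A x. This is the inverse Cayley transform in a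
form without denominators. -/
theorem apply_two_sub_twoCayley {A : W →L[ℝ] W} (h : IsUnit (A + 1)) (y : W) :
    A ((2 : ℝ) • y - twoCayley A y) = (2 : ℝ) • y + twoCayley A y := by
  obtain ⟨x, rfl⟩ := surjective_add_one h y
  rw [twoCayley_apply h]
  simp only [map_sub, map_smul, map_add]
  module

/-- On vectors (A + 1) x and (A + 1) y, invariance cancels the terms B x y and leaves 2 (B (A x) y -
B x (A y)), antisymmetric under exchange. -/
theorem twoCayley_skew {B : LinearMap.BilinForm ℝ W} {A : W →L[ℝ] W} (h : IsUnit (A + 1))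
    (hA : ∀ x y, B (A x) (A y) = B x y) (x y : W) :
    B (twoCayley A x) y = - B x (twoCayley A y) := by
  obtain ⟨x, rfl⟩ := surjective_add_one h x
  obtain ⟨y, rfl⟩ := surjective_add_one h y
  rw [twoCayley_apply h, twoCayley_apply h]
  simp only [map_sub, map_smul, map_add, LinearMap.sub_apply, LinearMap.add_apply,
    LinearMap.smul_apply, smul_eq_mul, hA]
  ring

theorem contDiffAt_twoCayley [CompleteSpace W] {A : W →L[ℝ] W} (h : IsUnit (A + 1)) :
    ContDiffAt ℝ ∞ (twoCayley (W := W)) A := by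
  obtain ⟨u, hu⟩ := h
  have h1 : ContDiffAt ℝ ∞ (fun A : W →L[ℝ] W => Ring.inverse (A + 1)) A := by
    have := contDiffAt_ringInverse (n := ∞) ℝ u
    rw [hu] at this
    exact this.comp A (contDiffAt_id.add contDiffAt_const)
  have h2 : ContDiffAt ℝ ∞ (fun A : W →L[ℝ] W => A - 1) A := contDiffAt_id.sub contDiffAt_const
  exact (h2.mul h1).const_smul (2 : ℝ)

/-- The derivative of `K = twoCayley A` along `A' = A ∘ D` is `(1/4) (2 + K) D (2 - K)`. -/
theorem fderiv_twoCayley_apply [CompleteSpace W] {V : Type*} [NormedAddCommGroup V] [NormedSpace ℝ V]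
    {A : V → W →L[ℝ] W} {y : V} (hA : DifferentiableAt ℝ A y) (h : IsUnit (A y + 1))
    (u : V) (D : W →L[ℝ] W) (hD : fderiv ℝ A y u = A y * D) (x : W) :
    fderiv ℝ (fun z => twoCayley (A z)) y u x =
      (1 / 4 : ℝ) • ((2 : ℝ) • D ((2 : ℝ) • x - twoCayley (A y) x) +
        twoCayley (A y) (D ((2 : ℝ) • x - twoCayley (A y) x))) := by
  have hK : DifferentiableAt ℝ (fun z => twoCayley (A z)) y :=
    ((contDiffAt_twoCayley h).differentiableAt (by simp)).comp y hA
  -- Differentiating the relation K (A + 1) = 2 (A - 1) avoids the derivative of an inverse.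
  have hev : (fun z => twoCayley (A z) * (A z + 1)) =ᶠ[nhds y] fun z => (2 : ℝ) • (A z - 1) := by
    have : ∀ᶠ z in nhds y, IsUnit (A z + 1) :=
      (hA.continuousAt.add continuousAt_const).eventually (Units.isOpen.mem_nhds h)
    filter_upwards [this] with z hz using twoCayley_mul hz
  have hd1 : HasFDerivAt (fun z => A z + 1) (fderiv ℝ A y) y := hA.hasFDerivAt.add_const _
  have hd2 : HasFDerivAt (fun z => A z - 1) (fderiv ℝ A y) y := hA.hasFDerivAt.sub_const _
  have h1 := ((hK.hasFDerivAt.mul' hd1).congr_of_eventuallyEq hev.symm).unique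
    (hd2.const_smul (2 : ℝ))
  obtain ⟨w, rfl⟩ := surjective_add_one h x
  have h2 := congrArg (fun L : V →L[ℝ] W →L[ℝ] W => L u w) h1
  simp only [add_apply, smul_apply, hD,
    mul_apply_eq_comp, smul_eq_mul, op_smul_eq_mul, map_add] at h2
  -- The factor 1/4 comes from here: for x = (A + 1) w the vector 2 x - K x is 4 w.
  have h3 : (2 : ℝ) • (A y w + w) - twoCayley (A y) (A y w + w) = (4 : ℝ) • w := by
    rw [twoCayley_apply h]; module
  have h4 := apply_two_sub_twoCayley h (D w)
  have h5 := twoCayley_apply h (D w)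
  rw [h3]
  simp only [map_smul, map_add, map_sub, one_apply_eq_self] at h2 h4 h5 ⊢
  rw [eq_sub_of_add_eq' h2, eq_sub_of_add_eq h5]
  module

/-- Invariance of the form `B x (br y z)` under `A` in terms of `K = twoCayley A`. -/
theorem twoCayley_triple {A : W →L[ℝ] W} (h : IsUnit (A + 1)) {B : LinearMap.BilinForm ℝ W}
    {br : W →L[ℝ] W →L[ℝ] W} (hT : ∀ x y z, B (A x) (br (A y) (A z)) = B x (br y z)) (x y z : W) :
    B (twoCayley A x) (br y z) + B x (br (twoCayley A y) z) + B x (br y (twoCayley A z)) =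
      - (1 / 4) * B (twoCayley A x) (br (twoCayley A y) (twoCayley A z)) := by
  -- A maps 2 - K to 2 + K, so invariance equates the trilinear form at 2 + K and at 2 - K. Terms
  -- even in K cancel; the odd ones give the identity.
  have := hT ((2 : ℝ) • x - twoCayley A x) ((2 : ℝ) • y - twoCayley A y)
    ((2 : ℝ) • z - twoCayley A z)
  simp only [apply_two_sub_twoCayley h] at this
  simp only [map_sub, map_smul, map_add, LinearMap.sub_apply, LinearMap.add_apply,
    LinearMap.smul_apply, sub_apply, add_apply, smul_apply, smul_eq_mul] at this
  linarith

end Cayley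

/-! ### Calculus of alternating forms on normed spaces. -/

section AlternatingCalculus

variable {V W : Type*} [NormedAddCommGroup V] [NormedSpace ℝ V] [NormedAddCommGroup W]
  [NormedSpace ℝ W]

/-- Smoothness of a family of alternating forms is tested on fixed vectors. -/
theorem contDiffAt_alternating [FiniteDimensional ℝ W] {k : ℕ} {n : ℕ∞ω}
    {f : V → W [⋀^Fin k]→L[ℝ] ℝ} {y : V} (h : ∀ v, ContDiffAt ℝ n (fun z => f z v) y) :
    ContDiffAt ℝ n f y := by
  let b := Module.finBasis ℝ W
  let Φ : (W [⋀^Fin k]→L[ℝ] ℝ) →ₗ[ℝ] ((Fin k → Fin (Module.finrank ℝ W)) → ℝ) :=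
    { toFun := fun η s => η fun i => b (s i)
      map_add' := fun _ _ => rfl
      map_smul' := fun _ _ => rfl }
  have hΦ : LinearMap.ker Φ = ⊥ := by
    refine LinearMap.ker_eq_bot.2 fun η η' hη => ?_
    apply ContinuousAlternatingMap.toAlternatingMap_injective
    apply AlternatingMap.coe_multilinearMap_injective
    exact Module.Basis.ext_multilinear (fun _ => b) fun s => congrFun hη s
  -- A form is recovered linearly from its values on tuples of basis vectors, and these are smooth
  -- by hypothesis.
  obtain ⟨Ψ, hΨ⟩ := Φ.exists_leftInverse_of_injective hΦ
  have : f = fun z => LinearMap.toContinuousLinearMap Ψ (Φ (f z)) := by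
    funext z
    exact (LinearMap.congr_fun hΨ (f z)).symm
  rw [this]
  refine (LinearMap.toContinuousLinearMap Ψ).contDiff.contDiffAt.comp y ?_
  exact contDiffAt_pi.2 fun s => h _

theorem contDiffAt_compContinuousLinearMap [FiniteDimensional ℝ W] {k : ℕ} {n : ℕ∞ω}
    {X : Type*} [NormedAddCommGroup X] [NormedSpace ℝ X]
    (η : X [⋀^Fin k]→L[ℝ] ℝ) {θ : V → W →L[ℝ] X} {y : V} (h : ContDiffAt ℝ n θ y) :
    ContDiffAt ℝ n (fun z => η.compContinuousLinearMap (θ z)) y := by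
  refine contDiffAt_alternating fun v => ?_
  have h1 : ContDiffAt ℝ n (fun z => fun i => θ z (v i)) y :=
    contDiffAt_pi.2 fun i => h.clm_apply contDiffAt_const
  exact (η.toContinuousMultilinearMap.contDiff.contDiffAt).comp y h1

theorem hasFDerivAt_interiorProduct {k : ℕ} {X : V → V} {η : V → V [⋀^Fin (k + 1)]→L[ℝ] ℝ} {y : V}
    (hX : DifferentiableAt ℝ X y) (hη : DifferentiableAt ℝ η y) :
    DifferentiableAt ℝ (fun z => interiorProduct (X z) (η z)) y ∧
    ∀ u v, fderiv ℝ (fun z => interiorProduct (X z) (η z)) y u v =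
      fderiv ℝ η y u (Matrix.vecCons (X y) v) + η y (Matrix.vecCons (fderiv ℝ X y u) v) := by
  have h0 := HasFDerivAt.comp (𝕜 := ℝ) (G := V →L[ℝ] V [⋀^Fin k]→L[ℝ] ℝ) y
    (ContinuousLinearMap.hasFDerivAt (ContinuousAlternatingMap.curryLeftLI (𝕜 := ℝ) (E := V)
      (F := ℝ) (n := k)).toContinuousLinearMap (x := η y)) hη.hasFDerivAt
  have h1 := h0.clm_apply hX.hasFDerivAt
  refine ⟨h1.differentiableAt, fun u v => ?_⟩
  have h2 := h1.fderiv
  have h3 := congrArg (fun L : V →L[ℝ] V [⋀^Fin k]→L[ℝ] ℝ => L u v) h2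
  refine h3.trans ?_
  exact add_comm _ _

theorem removeNth_succ_vecCons {X : Type*} {k : ℕ} (i : Fin (k + 1)) (x : X) (v : Fin (k + 1) → X) :
    i.succ.removeNth (Matrix.vecCons x v) = Matrix.vecCons x (i.removeNth v) := by
  funext j
  refine Fin.cases ?_ (fun j => ?_) j
  · simp [Fin.removeNth]
  · simp [Fin.removeNth]

/-- Cartan's formula for the Lie derivative of a form, with the second term developed. -/
theorem interior_extDeriv_add_extDeriv_interior {k : ℕ} {X : V → V}
    {η : V → V [⋀^Fin (k + 1)]→L[ℝ] ℝ} {y : V}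
    (hX : DifferentiableAt ℝ X y) (hη : DifferentiableAt ℝ η y) (v : Fin (k + 1) → V) :
    interiorProduct (X y) (extDeriv η y) v + extDeriv (fun z => interiorProduct (X z) (η z)) y v =
      fderiv ℝ η y (X y) v + ∑ i, η y (Function.update v i (fderiv ℝ X y (v i))) := by
  obtain ⟨h1, h2⟩ := hasFDerivAt_interiorProduct hX hη
  rw [interiorProduct_apply, extDeriv, extDeriv,
    ContinuousAlternatingMap.alternatizeUncurryFin_apply,
    ContinuousAlternatingMap.alternatizeUncurryFin_apply, Fin.sum_univ_succ]
  have h3 : ∀ i : Fin (k + 1), η y (Function.update v i (fderiv ℝ X y (v i))) =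
      (-1) ^ (i : ℕ) • η y (Matrix.vecCons (fderiv ℝ X y (v i)) (i.removeNth v)) := by
    intro i
    rw [← ContinuousAlternatingMap.map_insertNth, Fin.insertNth_removeNth]
  -- The zeroth term of i_X d is the derivative of the form along X. Its other terms cancel against
  -- the part of d i_X in which the form is differentiated, leaving the part in which X is.
  simp only [h2, h3, removeNth_succ_vecCons, Fin.val_zero, pow_zero, one_smul, Fin.val_succ,
    pow_succ, smul_add, Finset.sum_add_distrib, Matrix.cons_val_zero, Matrix.cons_val_succ,
    mul_neg, mul_one, neg_smul, Finset.sum_neg_distrib, Fin.removeNth_zero]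
  have h4 : Fin.tail (Matrix.vecCons (X y) v) = v := rfl
  rw [h4]
  abel

end AlternatingCalculus

/-! ### Bivectors built from skew maps. -/

section Bivector

variable {W : Type*} [NormedAddCommGroup W] [NormedSpace ℝ W]

/-- The bivector `(α, β) ↦ (1/2) (β (N α) - α (N β))`, with `π♯ = N` for skew `N`. -/
noncomputable def bivectorOf : ((W →L[ℝ] ℝ) →L[ℝ] W) →ₗ[ℝ] Bivector W where
  toFun N := (1 / 2 : ℝ) • ContinuousAlternatingMap.alternatizeUncurryFin
    (((ContinuousAlternatingMap.ofSubsingletonLIE (𝕜 := ℝ) (E := W →L[ℝ] ℝ) (F := ℝ)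
      (0 : Fin 1)).toContinuousLinearEquiv.toContinuousLinearMap).comp
        ((ContinuousLinearMap.apply ℝ ℝ).comp N))
  map_add' N N' := by
    rw [ContinuousLinearMap.comp_add, ContinuousLinearMap.comp_add,
      ContinuousAlternatingMap.alternatizeUncurryFin_add, smul_add]
  map_smul' c N := by
    rw [ContinuousLinearMap.comp_smul, ContinuousLinearMap.comp_smul,
      ContinuousAlternatingMap.alternatizeUncurryFin_smul, RingHom.id_apply, smul_comm]

theorem bivectorOf_apply (N : (W →L[ℝ] ℝ) →L[ℝ] W) (α β : W →L[ℝ] ℝ) :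
    bivectorOf N ![α, β] = (1 / 2) * (β (N α) - α (N β)) := by
  simp [bivectorOf, ContinuousAlternatingMap.alternatizeUncurryFin_apply,
    ContinuousAlternatingMap.ofSubsingletonLIE, Fin.sum_univ_two, sub_eq_add_neg,
    Fin.removeNth]

theorem bivectorOf_apply_of_skew {N : (W →L[ℝ] ℝ) →L[ℝ] W} (hN : ∀ α β : W →L[ℝ] ℝ, β (N α) = - α (N β))
    (α β : W →L[ℝ] ℝ) : bivectorOf N ![α, β] = β (N α) := by
  rw [bivectorOf_apply, ← neg_eq_iff_eq_neg.2 (hN α β)]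
  ring

theorem bivector_ext {P Q : Bivector W} (h : ∀ α β, P ![α, β] = Q ![α, β]) : P = Q := by
  ext m
  have : m = ![m 0, m 1] := by ext i; fin_cases i <;> rfl
  rw [this]
  exact h _ _

variable [FiniteDimensional ℝ W]

theorem eq_of_forall_covector {v w : W} (h : ∀ β : W →L[ℝ] ℝ, β v = β w) : v = w := by
  apply (Module.evalEquiv ℝ W).injective
  ext f
  exact h (LinearMap.toContinuousLinearMap f)

theorem sharp_bivectorOf {N : (W →L[ℝ] ℝ) →L[ℝ] W} (hN : ∀ α β : W →L[ℝ] ℝ, β (N α) = - α (N β))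
    (α : W →L[ℝ] ℝ) : sharp (bivectorOf N) α = N α :=
  eq_of_forall_covector fun β => by rw [apply_sharp, bivectorOf_apply_of_skew hN]

theorem bivector_eq_of_sharp_eq {P Q : Bivector W} (h : ∀ α, sharp P α = sharp Q α) : P = Q :=
  bivector_ext fun α β => by rw [← apply_sharp, ← apply_sharp, h]

omit [FiniteDimensional ℝ W] in
-- Shows that the chart expression of such a bivector field has the same shape, with the frame
-- pushed forward by the chart.
theorem bivectorOf_compContinuousLinearMap {V : Type*} [NormedAddCommGroup V] [NormedSpace ℝ V]
    [FiniteDimensional ℝ V] (N : (W →L[ℝ] ℝ) →L[ℝ] W) (D : W →L[ℝ] V) :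
    (bivectorOf N).compContinuousLinearMap (ContinuousLinearMap.precomp ℝ D) =
      bivectorOf (D.comp (N.comp (ContinuousLinearMap.precomp ℝ D))) := by
  refine bivector_ext fun α β => ?_
  have : ((bivectorOf N).compContinuousLinearMap (ContinuousLinearMap.precomp ℝ D)) ![α, β] =
      bivectorOf N ![α.comp D, β.comp D] := by
    rw [ContinuousAlternatingMap.compContinuousLinearMap_apply]
    congr 1
    ext i
    fin_cases i <;> rfl
  rw [this, bivectorOf_apply, bivectorOf_apply]
  rfl

theorem contDiffAt_bivectorOf {V : Type*} [NormedAddCommGroup V] [NormedSpace ℝ V]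
    {N : V → (W →L[ℝ] ℝ) →L[ℝ] W} {y : V} {n : ℕ∞ω} (h : ContDiffAt ℝ n N y) :
    ContDiffAt ℝ n (fun z => bivectorOf (N z)) y := by
  refine contDiffAt_alternating fun v => ?_
  have hv : v = ![v 0, v 1] := by ext i; fin_cases i <;> rfl
  have h1 : ∀ α β : W →L[ℝ] ℝ, ContDiffAt ℝ n (fun z => β (N z α)) y := fun α β =>
    β.contDiff.contDiffAt.comp y (h.clm_apply contDiffAt_const)
  rw [hv]
  simp only [bivectorOf_apply]
  exact contDiffAt_const.mul ((h1 _ _).sub (h1 _ _))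

end Bivector

/-! ### Quadratic Lie algebras and Maurer-Cartan frames. -/

section LocalFrame

open Filter Topology

variable {V W : Type*} [NormedAddCommGroup V] [NormedSpace ℝ V] [NormedAddCommGroup W]
  [NormedSpace ℝ W]

/-- `br` is a Lie bracket and `B` a nondegenerate symmetric form invariant under it. -/
structure IsQuadraticLie (B : LinearMap.BilinForm ℝ W) (br : W →L[ℝ] W →L[ℝ] W) : Prop where
  symm : ∀ x y, B x y = B y x
  nondegenerate : B.Nondegenerate
  skew : ∀ x y, br x y = - br y x
  jacobi : ∀ x y z, br x (br y z) = br (br x y) z + br y (br x z)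
  invariant : ∀ x y z, B (br x y) z = - B y (br x z)

/-- A smooth coframe `θ` near `y` with inverse frame `e`, satisfying the Maurer-Cartan equation at
`y`, and a field of endomorphisms `A` with `dA = A ad_θ` at `y`. -/
structure IsMaurerCartanFrame (br : W →L[ℝ] W →L[ℝ] W) (θ : V → V →L[ℝ] W) (e : V → W →L[ℝ] V)
    (A : V → W →L[ℝ] W) (y : V) : Prop where
  smooth_coframe : ContDiffAt ℝ ∞ θ y
  smooth_frame : ContDiffAt ℝ ∞ e y
  smooth_adjoint : ContDiffAt ℝ ∞ A y
  frame_coframe : ∀ᶠ z in 𝓝 y, ∀ v, e z (θ z v) = v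
  coframe_frame : ∀ᶠ z in 𝓝 y, ∀ x, θ z (e z x) = x
  maurerCartan : ∀ u v, fderiv ℝ θ y u v - fderiv ℝ θ y v u = - br (θ y u) (θ y v)
  fderiv_adjoint : ∀ u, fderiv ℝ A y u = A y * br (θ y u)

namespace IsQuadraticLie

variable {B : LinearMap.BilinForm ℝ W} {br : W →L[ℝ] W →L[ℝ] W} (hq : IsQuadraticLie B br)
include hq

theorem cyclic (x y z : W) : B x (br y z) = B y (br z x) := by
  have := hq.invariant z y x
  rw [hq.symm x, hq.skew y z, map_neg, LinearMap.neg_apply, this, neg_neg]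

theorem antisymm (x y z : W) : B x (br y z) = - B x (br z y) := by
  rw [hq.skew y z, map_neg]

end IsQuadraticLie

section

variable [FiniteDimensional ℝ W] {B : LinearMap.BilinForm ℝ W}

/-- The vector `x` with `α = B x`. -/
noncomputable def raise (hB : B.Nondegenerate) : (W →L[ℝ] ℝ) →L[ℝ] W :=
  haveI : FiniteDimensional ℝ (W →L[ℝ] ℝ) := inferInstance
  ⟨(B.toDual hB).symm.toLinearMap ∘ₗ (LinearMap.toContinuousLinearMap (𝕜 := ℝ) (E := W)
    (F' := ℝ)).symm.toLinearMap, LinearMap.continuous_of_finiteDimensional _⟩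

theorem apply_raise (hB : B.Nondegenerate) (α : W →L[ℝ] ℝ) (x : W) : B (raise hB α) x = α x := by
  have h := (B.toDual hB).apply_symm_apply (α : W →ₗ[ℝ] ℝ)
  have h2 := LinearMap.congr_fun h x
  rw [LinearMap.BilinForm.toDual_def] at h2
  exact h2

theorem eq_of_forall_apply (hB : B.Nondegenerate) {x x' : W} (h : ∀ y, B x y = B x' y) : x = x' :=
  (B.toDual hB).injective (LinearMap.ext h)

theorem raise_eq (hB : B.Nondegenerate) {α : W →L[ℝ] ℝ} {x : W} (h : ∀ y, α y = B x y) :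
    raise hB α = x := eq_of_forall_apply hB fun y => by rw [apply_raise, h]

/-- The map `α ↦ e (K (α ∘ e)♯)` from covectors to vectors, in the frame `e`. -/
noncomputable def frameSharp (hB : B.Nondegenerate) (e : W →L[ℝ] V) (K : W →L[ℝ] W) :
    (V →L[ℝ] ℝ) →L[ℝ] V :=
  e.comp (K.comp ((raise hB).comp (ContinuousLinearMap.precomp ℝ e)))

theorem frameSharp_apply (hB : B.Nondegenerate) (e : W →L[ℝ] V) (K : W →L[ℝ] W) (α : V →L[ℝ] ℝ) :
    frameSharp hB e K α = e (K (raise hB (α.comp e))) := rfl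

/-- Pairing β with e K (α ∘ e)♯ gives B (β ∘ e)♯ (K (α ∘ e)♯), so skewness of K and symmetry of B
suffice. -/
theorem frameSharp_skew (hB : B.Nondegenerate) (hs : ∀ x y, B x y = B y x) (e : W →L[ℝ] V)
    {K : W →L[ℝ] W} (hK : ∀ x y, B (K x) y = - B x (K y)) (α β : V →L[ℝ] ℝ) :
    β (frameSharp hB e K α) = - α (frameSharp hB e K β) := by
  have h1 := apply_raise hB (β.comp e) (K (raise hB (α.comp e)))
  have h2 := apply_raise hB (α.comp e) (K (raise hB (β.comp e)))
  rw [frameSharp_apply, frameSharp_apply]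
  rw [ContinuousLinearMap.comp_apply] at h1 h2
  rw [← h1, ← h2, hs, hK]

theorem contDiffAt_frameSharp (hB : B.Nondegenerate) {e : V → W →L[ℝ] V} {K : V → W →L[ℝ] W} {y : V}
    {n : ℕ∞ω} (he : ContDiffAt ℝ n e y) (hK : ContDiffAt ℝ n K y) :
    ContDiffAt ℝ n (fun z => frameSharp hB (e z) (K z)) y := by
  have h : ContDiffAt ℝ n (fun z => (ContinuousLinearMap.compL ℝ W V ℝ).flip (e z)) y :=
    (ContinuousLinearMap.contDiff _).contDiffAt.comp y he
  exact he.clm_comp (hK.clm_comp (contDiffAt_const.clm_comp h))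

end

variable {br : W →L[ℝ] W →L[ℝ] W} {θ : V → V →L[ℝ] W} {e : V → W →L[ℝ] V}
  {A : V → W →L[ℝ] W} {y : V}

namespace IsMaurerCartanFrame

variable (hF : IsMaurerCartanFrame br θ e A y)
include hF

theorem hasFDerivAt_coframe : HasFDerivAt θ (fderiv ℝ θ y) y :=
  (hF.smooth_coframe.differentiableAt (by simp)).hasFDerivAt

theorem hasFDerivAt_frame : HasFDerivAt e (fderiv ℝ e y) y :=
  (hF.smooth_frame.differentiableAt (by simp)).hasFDerivAt

/-- Differentiate θ (e x) = x and apply e. -/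
theorem fderiv_frame (u : V) (x : W) :
    fderiv ℝ e y u x = - e y (fderiv ℝ θ y u (e y x)) := by
  have h1 : HasFDerivAt (fun z => θ z (e z x)) _ y :=
    hF.hasFDerivAt_coframe.clm_apply (hF.hasFDerivAt_frame.clm_apply (hasFDerivAt_const x y))
  have h2 : HasFDerivAt (fun z => θ z (e z x)) (0 : V →L[ℝ] W) y :=
    (hasFDerivAt_const x y).congr_of_eventuallyEq (hF.coframe_frame.mono fun z hz => hz x)
  have h3 := congrArg (fun L : V →L[ℝ] W => e y (L u)) (h1.unique h2)
  simp [hF.frame_coframe.self_of_nhds] at h3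
  exact eq_neg_of_add_eq_zero_left h3

end IsMaurerCartanFrame

end LocalFrame

/-! ### The Schouten bracket in a Maurer-Cartan frame. -/

section LocalIdentities

open Filter Topology

variable {V W : Type*} [NormedAddCommGroup V] [NormedSpace ℝ V] [NormedAddCommGroup W]
  [NormedSpace ℝ W] [FiniteDimensional ℝ V] [FiniteDimensional ℝ W]
  {B : LinearMap.BilinForm ℝ W} {br : W →L[ℝ] W →L[ℝ] W} {θ : V → V →L[ℝ] W} {e : V → W →L[ℝ] V}
  {A : V → W →L[ℝ] W} {y : V}

/-- The product rule for c (e K (b ∘ e)♯): the first term differentiates K, the other two the outer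
and the inner frame. Skewness of K moves it off the inner frame, and `fderiv_frame` trades
derivatives of the frame for those of the coframe. -/
theorem fderiv_bivectorOf_frameSharp (hF : IsMaurerCartanFrame br θ e A y)
    (hq : IsQuadraticLie B br) {K : V → W →L[ℝ] W} (hK : ContDiffAt ℝ ∞ K y)
    (hskew : ∀ᶠ z in 𝓝 y, ∀ p q, B (K z p) q = - B p (K z q)) (u : V) (b c : V →L[ℝ] ℝ) :
    fderiv ℝ (fun z => bivectorOf (frameSharp hq.nondegenerate (e z) (K z))) y u ![b, c] =
      B (raise hq.nondegenerate (c.comp (e y)))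
          (fderiv ℝ K y u (raise hq.nondegenerate (b.comp (e y))))
        - B (raise hq.nondegenerate (c.comp (e y)))
          (fderiv ℝ θ y u (e y (K y (raise hq.nondegenerate (b.comp (e y))))))
        + B (raise hq.nondegenerate (b.comp (e y)))
          (fderiv ℝ θ y u (e y (K y (raise hq.nondegenerate (c.comp (e y)))))) := by
  have hB := hq.nondegenerate
  have hP : DifferentiableAt ℝ (fun z => bivectorOf (frameSharp hB (e z) (K z))) y :=
    (contDiffAt_bivectorOf (contDiffAt_frameSharp hB hF.smooth_frame hK)).differentiableAt (by simp)
  rw [← fderiv_continuousAlternatingMap_apply_const_apply hP]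
  have hK' : HasFDerivAt K (fderiv ℝ K y) y := (hK.differentiableAt (by simp)).hasFDerivAt
  have h1 : HasFDerivAt (fun z => b.comp (e z)) _ y :=
    (hasFDerivAt_const b y).clm_comp hF.hasFDerivAt_frame
  have h2 := (hasFDerivAt_const c y).clm_apply (hF.hasFDerivAt_frame.clm_apply
    (hK'.clm_apply ((hasFDerivAt_const (raise hB) y).clm_apply h1)))
  -- Skewness on a neighbourhood, not only at the point, is what allows the antisymmetrisation in
  -- `bivectorOf` to be dropped before differentiating.
  have h3 := h2.congr_of_eventuallyEq (f₁ := fun z =>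
      bivectorOf (frameSharp hB (e z) (K z)) ![b, c]) (by
    filter_upwards [hskew] with z hz
    rw [bivectorOf_apply_of_skew (frameSharp_skew hB hq.symm (e z) hz), frameSharp_apply])
  rw [h3.fderiv]
  simp only [ContinuousLinearMap.comp_apply, add_apply, zero_apply,
    ContinuousLinearMap.flip_apply, ContinuousLinearMap.compL_apply, hF.fderiv_frame,
    ContinuousLinearMap.comp_zero, add_zero, map_add, map_neg]
  have hr : ∀ (β : V →L[ℝ] ℝ) (x : W), β (e y x) = B (raise hB (β.comp (e y))) x := fun β x => by
    rw [apply_raise]; rfl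
  have h4 : c (e y (K y (raise hB (b.comp (fderiv ℝ e y u))))) =
      B (raise hB (b.comp (e y))) (fderiv ℝ θ y u (e y (K y (raise hB (c.comp (e y)))))) := by
    rw [hr, ← neg_eq_iff_eq_neg.2 (hskew.self_of_nhds _ _), hq.symm, apply_raise,
      ContinuousLinearMap.comp_apply, hF.fderiv_frame, map_neg, neg_neg, hr]
  rw [h4, hr, hr]
  ring

/-- Half the Schouten bracket of the bivector given by `K = twoCayley A` in the frame `e`. -/
theorem halfSchouten_frame (hF : IsMaurerCartanFrame br θ e A y) (hq : IsQuadraticLie B br)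
    (hunit : IsUnit (A y + 1)) (hiso : ∀ᶠ z in 𝓝 y, ∀ p q, B (A z p) (A z q) = B p q)
    (hbr : ∀ p q, A y (br p q) = br (A y p) (A y q)) {P : V → Bivector V}
    (hP : P = fun z => bivectorOf (frameSharp hq.nondegenerate (e z) (twoCayley (A z))))
    (a b c : V →L[ℝ] ℝ) :
    fderiv ℝ P y (sharp (P y) a) ![b, c] + fderiv ℝ P y (sharp (P y) b) ![c, a]
      + fderiv ℝ P y (sharp (P y) c) ![a, b] =
    (1 / 2) * B (θ y (sharp (P y) a)) (br (θ y (sharp (P y) b)) (θ y (sharp (P y) c))) := by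
  have hB := hq.nondegenerate
  have hA : DifferentiableAt ℝ A y := hF.smooth_adjoint.differentiableAt (by simp)
  have hU : ∀ᶠ z in 𝓝 y, IsUnit (A z + 1) :=
    (hA.continuousAt.add continuousAt_const).eventually (Units.isOpen.mem_nhds hunit)
  have hskew : ∀ᶠ z in 𝓝 y, ∀ p q, B (twoCayley (A z) p) q = - B p (twoCayley (A z) q) := by
    filter_upwards [hiso, hU] with z h1 h2 using twoCayley_skew h2 h1
  have hK : ContDiffAt ℝ ∞ (fun z => twoCayley (A z)) y :=
    (contDiffAt_twoCayley hunit).comp y hF.smooth_adjoint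
  have hs := hskew.self_of_nhds
  have hsharp : ∀ α, sharp (P y) α = e y (twoCayley (A y) (raise hB (α.comp (e y)))) := fun α => by
    rw [hP]
    exact sharp_bivectorOf (frameSharp_skew hB hq.symm (e y) hs) α
  have hd := fun u b c => hP ▸ fderiv_bivectorOf_frameSharp hF hq hK hskew u b c
  have hθe := hF.coframe_frame.self_of_nhds
  have hdK := fun u => fderiv_twoCayley_apply hA hunit u _ (hF.fderiv_adjoint u)
  have hs' : ∀ p q, B p (twoCayley (A y) q) = - B (twoCayley (A y) p) q := fun p q => by
    rw [hs, neg_neg]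
  have hmc := fun p q v => congrArg (B v) (hF.maurerCartan (e y p) (e y q))
  have htri := twoCayley_triple hunit (B := B) (br := br) (fun p q r => by rw [← hbr, hiso.self_of_nhds])
    (raise hB (a.comp (e y))) (raise hB (b.comp (e y))) (raise hB (c.comp (e y)))
  simp only [hd, hsharp, hdK, hθe]
  generalize raise hB (a.comp (e y)) = X at *
  generalize raise hB (b.comp (e y)) = Y at *
  generalize raise hB (c.comp (e y)) = Z at *
  simp only [map_sub, map_smul, map_add, hs', smul_eq_mul]
  -- In the cyclic sum the derivatives of θ occur only antisymmetrised, so three instances of the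
  -- Maurer-Cartan equation remove them.
  have m1 := hmc (twoCayley (A y) X) (twoCayley (A y) Y) Z
  have m2 := hmc (twoCayley (A y) Y) (twoCayley (A y) Z) X
  have m3 := hmc (twoCayley (A y) Z) (twoCayley (A y) X) Y
  simp only [map_sub, map_neg, hθe] at m1 m2 m3
  generalize twoCayley (A y) X = x at *
  generalize twoCayley (A y) Y = y' at *
  generalize twoCayley (A y) Z = z at *
  -- With T(p, q, r) = B p [q, r], let S₁, S₂, S₃ be the sums of the terms T in which one, two or
  -- three of the arguments X, Y, Z are replaced by their images under K. The derivative of K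
  -- contributes S₁ - S₂ + (3/4) S₃, the Maurer-Cartan terms contribute S₂, and `htri` is S₁ =
  -- -(1/4) S₃; the total is (1/2) S₃. The identities below only bring the terms T to a common
  -- order.
  have c1 := hq.cyclic Z x Y
  have c2 := hq.cyclic Y z X
  have c3 := hq.antisymm X z Y
  have c4 := hq.cyclic z x Y
  have c5 := hq.cyclic x y' Z
  have c6 := hq.cyclic y' z X
  have c7 := hq.cyclic x y' z
  have c8 := hq.cyclic y' z x
  have c9 := hq.cyclic z X y'
  have c10 := hq.cyclic Y z x
  have c11 := hq.cyclic Z x y'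
  have c12 := hq.cyclic X y' z
  have c13 := hq.cyclic z X Y
  linarith

end LocalIdentities

/-! ### Closedness of the Cartan form. -/

section LocalForms

open Filter Topology

variable {V W : Type*} [NormedAddCommGroup V] [NormedSpace ℝ V] [NormedAddCommGroup W]
  [NormedSpace ℝ W] {B : LinearMap.BilinForm ℝ W} {br : W →L[ℝ] W →L[ℝ] W} {θ : V → V →L[ℝ] W}
  {e : V → W →L[ℝ] V} {A : V → W →L[ℝ] W} {y : V}

theorem fderiv_compContinuousLinearMap_apply {k : ℕ} (η : W [⋀^Fin k]→L[ℝ] ℝ)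
    (hθ : DifferentiableAt ℝ θ y) (u : V) (v : Fin k → V) :
    fderiv ℝ (fun z => η.compContinuousLinearMap (θ z)) y u v =
      ∑ i, η (Function.update (fun j => θ y (v j)) i (fderiv ℝ θ y u (v i))) := by
  rw [fderiv_continuousAlternatingMapCompContinuousLinearMap (differentiableAt_const η) hθ]
  have h0 : fderiv ℝ (fun _ : V => η) y = 0 := (hasFDerivAt_const η y).fderiv
  rw [h0]
  simp only [ContinuousLinearMap.comp_zero, zero_add, ContinuousLinearMap.comp_apply,
    ContinuousAlternatingMap.fderivCompContinuousLinearMap_apply]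
  refine Finset.sum_congr rfl fun i _ => congrArg η (funext fun j => ?_)
  rcases eq_or_ne j i with rfl | h
  · simp
  · simp [h]

/-- The product rule leaves antisymmetrised derivatives of θ, which the Maurer-Cartan equation turns
into brackets; the resulting sum of terms B a [b, [c, d]] vanishes by the Jacobi identity. -/
theorem extDeriv_cartan_eq_zero (hF : IsMaurerCartanFrame br θ e A y) (hq : IsQuadraticLie B br)
    {η : W [⋀^Fin 3]→L[ℝ] ℝ} (hη : ∀ p q r, η ![p, q, r] = (1 / 2) * B p (br q r)) :
    extDeriv (fun z => η.compContinuousLinearMap (θ z)) y = 0 := by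
  have hη' : ∀ f : Fin 3 → W, η f = (1 / 2) * B (f 0) (br (f 1) (f 2)) := fun f => by
    rw [← hη]
    congr 1
    ext i
    fin_cases i <;> rfl
  ext v
  rw [extDeriv, ContinuousAlternatingMap.alternatizeUncurryFin_apply]
  simp only [fderiv_compContinuousLinearMap_apply η hF.hasFDerivAt_coframe.differentiableAt, hη']
  -- Used for i < j only: each derivative of θ is brought to increasing order, at the cost of a
  -- bracket, after which the derivatives cancel.
  have hT : ∀ i j, fderiv ℝ θ y (v j) (v i) =
      fderiv ℝ θ y (v i) (v j) + br (θ y (v i)) (θ y (v j)) := fun i j => by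
    have := hF.maurerCartan (v i) (v j)
    rw [sub_eq_iff_eq_add] at this
    rw [this]
    abel
  have r0 : (0 : Fin 4).removeNth v = ![v 1, v 2, v 3] := by ext i; fin_cases i <;> rfl
  have r1 : (1 : Fin 4).removeNth v = ![v 0, v 2, v 3] := by ext i; fin_cases i <;> rfl
  have r2 : (2 : Fin 4).removeNth v = ![v 0, v 1, v 3] := by ext i; fin_cases i <;> rfl
  have r3 : (3 : Fin 4).removeNth v = ![v 0, v 1, v 2] := by ext i; fin_cases i <;> rfl
  refine (Fin.sum_univ_four _).trans ?_
  simp only [Fin.sum_univ_three, r0, r1, r2, r3, Function.update_apply]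
  simp [hT 0 1, hT 0 2, hT 0 3, hT 1 2, hT 1 3, hT 2 3]
  have hj := congrArg (B (θ y (v 0))) (hq.jacobi (θ y (v 1)) (θ y (v 2)) (θ y (v 3)))
  generalize θ y (v 0) = a at *
  generalize θ y (v 1) = b at *
  generalize θ y (v 2) = c at *
  generalize θ y (v 3) = d at *
  rw [map_add] at hj
  have h1 : ∀ p q, B (br a p) q = B a (br p q) := fun p q => by
    rw [hq.symm, hq.cyclic]
  have h2 := hq.cyclic b (fderiv ℝ θ y (v 0) (v 2)) d
  have h3 := hq.antisymm (fderiv ℝ θ y (v 0) (v 2)) d b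
  have h4 := hq.cyclic b c (fderiv ℝ θ y (v 0) (v 3))
  have h5 := hq.cyclic c (fderiv ℝ θ y (v 0) (v 3)) b
  have h6 := hq.antisymm a c (fderiv ℝ θ y (v 1) (v 3))
  have h7 := hq.antisymm a (br b c) d
  have h8 := hq.antisymm a (br b d) c
  simp only [h1]
  linarith

end LocalForms

/-! ### Lie derivatives of volume forms in a frame. -/

section Divergence

open Filter Topology

variable {V W : Type*} [NormedAddCommGroup V] [NormedSpace ℝ V] [NormedAddCommGroup W]
  [NormedSpace ℝ W] [FiniteDimensional ℝ V] [FiniteDimensional ℝ W]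
  {B : LinearMap.BilinForm ℝ W} {br : W →L[ℝ] W →L[ℝ] W} {θ : V → V →L[ℝ] W}
  {e : V → W →L[ℝ] V} {A : V → W →L[ℝ] W} {y : V}

theorem trace_frame_conj (hF : IsMaurerCartanFrame br θ e A y) (M : W →ₗ[ℝ] W) :
    LinearMap.trace ℝ V ((e y : W →ₗ[ℝ] V) ∘ₗ M ∘ₗ (θ y : V →ₗ[ℝ] W)) = LinearMap.trace ℝ W M := by
  rw [LinearMap.trace_comp_comm', LinearMap.comp_assoc]
  congr 1
  ext x
  simp [hF.coframe_frame.self_of_nhds]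

/-- A skew endomorphism is traceless, so a quadratic Lie algebra is unimodular; this is why no
modular character of the group enters the divergence. -/
theorem IsQuadraticLie.trace_br (hq : IsQuadraticLie B br) (x : W) :
    LinearMap.trace ℝ W (br x : W →ₗ[ℝ] W) = 0 :=
  trace_eq_zero_of_skew hq.nondegenerate fun p q => hq.invariant x p q

/-- The Lie derivative of `h η^L` along the vector field with components `w` in the frame `e`. -/
theorem lieDeriv_frame_volume (hF : IsMaurerCartanFrame br θ e A y) (hq : IsQuadraticLie B br)
    {k : ℕ} (hk : Module.finrank ℝ V = k + 1) (η : W [⋀^Fin (k + 1)]→L[ℝ] ℝ) {h : V → ℝ}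
    (hh : DifferentiableAt ℝ h y) {w : V → W} (hw : DifferentiableAt ℝ w y)
    {X : V → V} (hX : X =ᶠ[𝓝 y] fun z => e z (w z)) {vol : V → V [⋀^Fin (k + 1)]→L[ℝ] ℝ}
    (hvol : vol =ᶠ[𝓝 y] fun z => h z • η.compContinuousLinearMap (θ z)) :
    interiorProduct (X y) (extDeriv vol y) + extDeriv (fun z => interiorProduct (X z) (vol z)) y =
      fderiv ℝ h y (X y) • η.compContinuousLinearMap (θ y) +
        LinearMap.trace ℝ W ((fderiv ℝ w y).comp (e y) : W →ₗ[ℝ] W) • vol y := by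
  have hθ := hF.hasFDerivAt_coframe.differentiableAt
  have hμ : DifferentiableAt ℝ (fun z => η.compContinuousLinearMap (θ z)) y :=
    (contDiffAt_compContinuousLinearMap η hF.smooth_coframe).differentiableAt (by simp)
  have hvol' := (hh.hasFDerivAt.smul hμ.hasFDerivAt).congr_of_eventuallyEq hvol
  have hX' := (hF.hasFDerivAt_frame.clm_apply hw.hasFDerivAt).congr_of_eventuallyEq hX
  have hθe := hF.coframe_frame.self_of_nhds
  have heθ := hF.frame_coframe.self_of_nhds
  let b := Module.finBasisOfFinrankEq ℝ V hk
  apply ContinuousAlternatingMap.toAlternatingMap_injective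
  -- Both sides have top degree, so one basis is enough, and sums over replaced basis vectors become
  -- traces.
  apply alternating_eq_of_eq_on_basis b
  have key := interior_extDeriv_add_extDeriv_interior hX'.differentiableAt hvol'.differentiableAt b
  refine key.trans ?_
  have h1 : ∀ L : V →ₗ[ℝ] V, ∑ i, η.compContinuousLinearMap (θ y) (Function.update b i (L (b i))) =
      LinearMap.trace ℝ V L * η.compContinuousLinearMap (θ y) b := fun L =>
    sum_alternating_update_eq_trace b (η.compContinuousLinearMap (θ y)).toAlternatingMap L
  have h2 : ∀ i, Function.update (fun j => θ y (b j)) i (fderiv ℝ θ y (X y) (b i)) =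
      θ y ∘ Function.update b i (e y (fderiv ℝ θ y (X y) (b i))) := by
    intro i
    rw [Function.comp_update, hθe]
    rfl
  have h3 : fderiv ℝ (fun z => η.compContinuousLinearMap (θ z)) y (X y) b =
      LinearMap.trace ℝ V ((e y).comp (fderiv ℝ θ y (X y)) : V →ₗ[ℝ] V) *
        η.compContinuousLinearMap (θ y) b := by
    rw [fderiv_compContinuousLinearMap_apply η hθ, ← h1]
    simp only [h2]
    rfl
  have h4 := h1 (fderiv ℝ X y : V →ₗ[ℝ] V)
  have h5 : LinearMap.trace ℝ V ((e y).comp (fderiv ℝ θ y (X y)) : V →ₗ[ℝ] V) +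
      LinearMap.trace ℝ V (fderiv ℝ X y : V →ₗ[ℝ] V) =
        LinearMap.trace ℝ W ((fderiv ℝ w y).comp (e y) : W →ₗ[ℝ] W) := by
    -- The derivatives of the coframe occur here as Dθ(X) u - Dθ(u) X, which Maurer-Cartan equates
    -- to a bracket. The sum is thus conjugate to Dw ∘ e - ad w, and ad w is traceless.
    have h6 : ((e y).comp (fderiv ℝ θ y (X y)) : V →ₗ[ℝ] V) + (fderiv ℝ X y : V →ₗ[ℝ] V) =
        (e y : W →ₗ[ℝ] V) ∘ₗ (((fderiv ℝ w y).comp (e y) : W →ₗ[ℝ] W) - (br (w y) : W →ₗ[ℝ] W)) ∘ₗ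
          (θ y : V →ₗ[ℝ] W) := by
      ext u
      have hm := hF.maurerCartan (X y) u
      rw [hX.self_of_nhds, hθe, sub_eq_iff_eq_add] at hm
      simp [hX'.fderiv, hX.self_of_nhds, hF.fderiv_frame, heθ, hm]
      abel
    rw [← map_add, h6, trace_frame_conj hF, map_sub, hq.trace_br, sub_zero]
  have h7 : vol y = h y • η.compContinuousLinearMap (θ y) := hvol.self_of_nhds
  have h8 : ∀ i, vol y (Function.update b i (fderiv ℝ X y (b i))) =
      h y * η.compContinuousLinearMap (θ y) (Function.update b i (fderiv ℝ X y (b i))) := fun i => by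
    rw [h7]; rfl
  simp only [h8, ← Finset.mul_sum]
  have h9 : fderiv ℝ vol y (X y) b = h y * fderiv ℝ (fun z => η.compContinuousLinearMap (θ z)) y (X y) b
      + fderiv ℝ h y (X y) * η.compContinuousLinearMap (θ y) b := by
    rw [hvol'.fderiv]; rfl
  rw [h9, h3, h7]
  refine (congrArg (fun r => _ + h y * r) h4).trans ?_
  rw [← h5]
  change _ = fderiv ℝ h y (X y) * η.compContinuousLinearMap (θ y) b + _ * (h y * η.compContinuousLinearMap (θ y) b)
  ring

end Divergence

/-! ### Contractions as traces, and the divergence identity. -/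

section Contraction

open Filter Topology

variable {V W : Type*} [NormedAddCommGroup V] [NormedSpace ℝ V] [NormedAddCommGroup W]
  [NormedSpace ℝ W] [FiniteDimensional ℝ V] [FiniteDimensional ℝ W]
  {B : LinearMap.BilinForm ℝ W} {br : W →L[ℝ] W →L[ℝ] W} {θ : V → V →L[ℝ] W}
  {e : V → W →L[ℝ] V} {A : V → W →L[ℝ] W} {y : V}

/-- Raising i_v η in the frame gives M (θ v), so the endomorphism v ↦ π♯ (i_v η) is K M conjugated
by the frame. -/
theorem contract_of_frame (hF : IsMaurerCartanFrame br θ e A y) (hB : B.Nondegenerate)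
    {P : Bivector V} {K : W →L[ℝ] W} (hP : ∀ α, sharp P α = frameSharp hB (e y) K α)
    {η : V [⋀^Fin 2]→L[ℝ] ℝ} {M : W →ₗ[ℝ] W} (hη : ∀ v u, η ![v, u] = B (M (θ y v)) (θ y u)) :
    contract P η = (1 / 2) * LinearMap.trace ℝ W ((K : W →ₗ[ℝ] W) ∘ₗ M) := by
  rw [contract, ← trace_frame_conj hF]
  congr 2
  ext v
  change sharp P (toCovector (interiorProduct v η)) = e y (K (M (θ y v)))
  rw [hP, frameSharp_apply]
  congr 2
  apply raise_eq
  intro x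
  change η (Matrix.vecCons v fun _ => e y x) = _
  have : (Matrix.vecCons v fun _ => e y x : Fin 2 → V) = ![v, e y x] := by
    ext i; fin_cases i <;> rfl
  rw [this, hη, hF.coframe_frame.self_of_nhds]

omit [FiniteDimensional ℝ V] in
theorem extDeriv_oneForm_apply {α : V → V →L[ℝ] ℝ} (hα : DifferentiableAt ℝ α y) (v u : V) :
    extDeriv (fun z => oneForm (α z)) y ![v, u] = fderiv ℝ α y v u - fderiv ℝ α y u v := by
  have h : HasFDerivAt (fun z => oneForm (α z)) _ y :=
    (ContinuousLinearMap.hasFDerivAt (ContinuousAlternatingMap.ofSubsingletonLIE (𝕜 := ℝ) (E := V)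
      (F := ℝ) (0 : Fin 1)).toContinuousLinearEquiv.toContinuousLinearMap).comp y hα.hasFDerivAt
  rw [extDeriv, ContinuousAlternatingMap.alternatizeUncurryFin_apply, h.fderiv]
  simp [ContinuousAlternatingMap.ofSubsingletonLIE, Fin.sum_univ_two, Fin.removeNth, sub_eq_add_neg]

/-- With α = B s (θ ·), the form dα is represented by S - S' + [·, s], where S is the derivative of
s in the frame, S' its adjoint, and the bracket comes from Maurer-Cartan. Skewness of K gives tr(K
S') = -tr(K S), so half the trace is tr(K S) - (1/2) tr(K ad s). -/
theorem contract_extDeriv_oneForm (hF : IsMaurerCartanFrame br θ e A y) (hq : IsQuadraticLie B br)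
    {P : Bivector V} {K : W →L[ℝ] W} (hP : ∀ α, sharp P α = frameSharp hq.nondegenerate (e y) K α)
    (hK : ∀ p q, B (K p) q = - B p (K q)) {α : V → V →L[ℝ] ℝ} (hα : DifferentiableAt ℝ α y)
    {s : V → W} (hs : s = fun z => raise hq.nondegenerate ((α z).comp (e z))) :
    contract P (extDeriv (fun z => oneForm (α z)) y) =
      LinearMap.trace ℝ W (K.comp ((fderiv ℝ s y).comp (e y)) : W →ₗ[ℝ] W)
        - (1 / 2) * LinearMap.trace ℝ W (K.comp (br (s y)) : W →ₗ[ℝ] W) := by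
  have hB := hq.nondegenerate
  have heθ := hF.frame_coframe.self_of_nhds
  have hαe : HasFDerivAt (fun z => (α z).comp (e z)) _ y :=
    hα.hasFDerivAt.clm_comp hF.hasFDerivAt_frame
  have hs' := (raise hB).hasFDerivAt.comp y hαe
  have hsd : ∀ v u, fderiv ℝ α y v u = B (fderiv ℝ s y v) (θ y u) + B (s y) (fderiv ℝ θ y v u) := by
    intro v u
    have h1 := (congrArg (fun f => fderiv ℝ f y) hs).trans hs'.fderiv
    rw [h1, hs]
    simp only [ContinuousLinearMap.comp_apply, apply_raise]
    simp [hF.fderiv_frame, heθ]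
  set S : W →ₗ[ℝ] W := ((fderiv ℝ s y).comp (e y)).toLinearMap with hS
  have hS' : ∀ v, S (θ y v) = fderiv ℝ s y v := fun v => by simp [hS, heθ]
  let S' := B.leftAdjointOfNondegenerate hB S
  have hadj : ∀ p q, B (S' p) q = B p (S q) := fun p q =>
    LinearMap.BilinForm.isAdjointPairLeftAdjointOfNondegenerate B hB S p q
  have hη : ∀ v u, extDeriv (fun z => oneForm (α z)) y ![v, u] =
      B ((S - S' + (br.flip (s y) : W →ₗ[ℝ] W)) (θ y v)) (θ y u) := by
    intro v u
    have hm := congrArg (B (s y)) (hF.maurerCartan v u)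
    simp only [map_sub, map_neg] at hm
    have hi := hq.invariant (θ y v) (s y) (θ y u)
    rw [extDeriv_oneForm_apply hα, hsd, hsd]
    simp only [LinearMap.add_apply, LinearMap.sub_apply, map_add, map_sub, hadj, hS',
      ContinuousLinearMap.coe_coe, ContinuousLinearMap.flip_apply, hi]
    rw [hq.symm (θ y v)]
    linarith
  rw [contract_of_frame hF hB hP hη, LinearMap.comp_add, LinearMap.comp_sub, map_add, map_sub]
  have h2 : LinearMap.trace ℝ W ((K : W →ₗ[ℝ] W) ∘ₗ S') = - LinearMap.trace ℝ W ((K : W →ₗ[ℝ] W) ∘ₗ S) := by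
    rw [LinearMap.trace_comp_comm' S (K : W →ₗ[ℝ] W), ← map_neg]
    refine trace_eq_of_isAdjointPair hB fun p q => ?_
    simp [hK, hadj]
  have h3 : (K : W →ₗ[ℝ] W) ∘ₗ (br.flip (s y) : W →ₗ[ℝ] W) = - (K.comp (br (s y)) : W →ₗ[ℝ] W) := by
    ext p
    simp [hq.skew p (s y)]
  rw [h2, h3, map_neg]
  change _ = LinearMap.trace ℝ W ((K : W →ₗ[ℝ] W) ∘ₗ S) - _
  ring

/-- The divergence of π♯ α and the contraction of dα share the terms tr(K Ds) and -(1/2) tr(K ad s),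
which cancel. Of the derivative of K there remain a traceless ad term and the term quadratic in K,
which the twist will compensate. -/
theorem trace_fderiv_sharp_sub_contract (hF : IsMaurerCartanFrame br θ e A y)
    (hq : IsQuadraticLie B br) (hunit : IsUnit (A y + 1))
    (hiso : ∀ p q, B (A y p) (A y q) = B p q) {P : Bivector V}
    (hP : ∀ α, sharp P α = frameSharp hq.nondegenerate (e y) (twoCayley (A y)) α)
    {α : V → V →L[ℝ] ℝ} (hα : DifferentiableAt ℝ α y) {s : V → W}
    (hs : s = fun z => raise hq.nondegenerate ((α z).comp (e z))) :
    LinearMap.trace ℝ W ((fderiv ℝ (fun z => twoCayley (A z) (s z)) y).comp (e y) : W →ₗ[ℝ] W) -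
        contract P (extDeriv (fun z => oneForm (α z)) y) =
      (1 / 4) * LinearMap.trace ℝ W
        ((twoCayley (A y)).comp (br (twoCayley (A y) (s y))) : W →ₗ[ℝ] W) := by
  have hB := hq.nondegenerate
  have hA : DifferentiableAt ℝ A y := hF.smooth_adjoint.differentiableAt (by simp)
  have hsd : DifferentiableAt ℝ s y := by
    rw [hs]
    exact ((raise hB).hasFDerivAt.comp y
      (hα.hasFDerivAt.clm_comp hF.hasFDerivAt_frame)).differentiableAt
  have hKd : DifferentiableAt ℝ (fun z => twoCayley (A z)) y :=
    ((contDiffAt_twoCayley hunit).differentiableAt (by simp)).comp y hA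
  have hd := (hKd.hasFDerivAt.clm_apply hsd.hasFDerivAt).fderiv
  have hdK := fun u => fderiv_twoCayley_apply hA hunit u _ (hF.fderiv_adjoint u)
  rw [contract_extDeriv_oneForm hF hq hP (twoCayley_skew hunit hiso) hα hs]
  set K := twoCayley (A y) with hKdef
  -- The product rule, with the formula (1/4)(2 + K) ad (2 - K) for the derivative of K expanded and
  -- the bracket reversed so that ad acts on x.
  have h1 : ((fderiv ℝ (fun z => twoCayley (A z) (s z)) y).comp (e y) : W →ₗ[ℝ] W) =
      (K.comp ((fderiv ℝ s y).comp (e y)) : W →ₗ[ℝ] W)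
        - (1 / 2 : ℝ) • (br ((2 : ℝ) • s y - K (s y)) : W →ₗ[ℝ] W)
        - (1 / 2 : ℝ) • (K.comp (br (s y)) : W →ₗ[ℝ] W)
        + (1 / 4 : ℝ) • (K.comp (br (K (s y))) : W →ₗ[ℝ] W) := by
    ext x
    simp only [hd, ContinuousLinearMap.coe_coe,
      add_apply, ContinuousLinearMap.comp_apply, ContinuousLinearMap.flip_apply, hdK,
      hF.coframe_frame.self_of_nhds, LinearMap.add_apply, LinearMap.sub_apply,
      LinearMap.smul_apply, hq.skew x, map_sub, map_smul, map_neg, sub_apply, smul_apply]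
    module
  rw [h1, map_add, map_sub, map_sub, map_smul, map_smul, map_smul, hq.trace_br]
  simp only [smul_eq_mul]
  ring

/-- By cyclicity i_v ψ is represented by (1/2) ad; the other 1/2 is the one in `contract`. -/
theorem contractThree_frame (hF : IsMaurerCartanFrame br θ e A y) (hq : IsQuadraticLie B br)
    {P : Bivector V} {K : W →L[ℝ] W} (hP : ∀ α, sharp P α = frameSharp hq.nondegenerate (e y) K α)
    {η : W [⋀^Fin 3]→L[ℝ] ℝ} (hη : ∀ p q r, η ![p, q, r] = (1 / 2) * B p (br q r)) (v : V) :
    contractThree P (η.compContinuousLinearMap (θ y)) v =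
      (1 / 4) * LinearMap.trace ℝ W (K.comp (br (θ y v)) : W →ₗ[ℝ] W) := by
  change contract P (interiorProduct v (η.compContinuousLinearMap (θ y))) = _
  rw [contract_of_frame hF hq.nondegenerate hP (M := (1 / 2 : ℝ) • (br (θ y v) : W →ₗ[ℝ] W)),
    LinearMap.comp_smul, map_smul, smul_eq_mul]
  · change _ = 1 / 4 * LinearMap.trace ℝ W ((K : W →ₗ[ℝ] W) ∘ₗ (br (θ y v) : W →ₗ[ℝ] W))
    ring
  · intro u t
    have : (θ y ∘ Matrix.vecCons v ![u, t]) = ![θ y v, θ y u, θ y t] := by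
      ext i; fin_cases i <;> rfl
    rw [interiorProduct_apply, ContinuousAlternatingMap.compContinuousLinearMap_apply, this, hη,
      hq.cyclic, hq.cyclic, hq.symm]
    simp

end Contraction

/-! ### Density of the elements without eigenvalue -1. -/

section Density

open Filter Topology

/-- A polynomial in the entries of a matrix representation of a connected topological group which
vanishes near the identity vanishes everywhere. -/
theorem eval_eq_zero_of_eventually {G : Type*} [TopologicalSpace G] [Group G] [IsTopologicalGroup G]
    [ConnectedSpace G] {n : Type*} [Fintype n] (ρ : G → Matrix n n ℝ)
    (hρ : ∀ g h, ρ (g * h) = ρ g * ρ h) (p : MvPolynomial (n × n) ℝ)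
    (hp : ∀ᶠ g in 𝓝 (1 : G), MvPolynomial.eval (fun ij => ρ g ij.1 ij.2) p = 0) (g : G) :
    MvPolynomial.eval (fun ij => ρ g ij.1 ij.2) p = 0 := by
  let ev : G → MvPolynomial (n × n) ℝ →+* ℝ := fun g => MvPolynomial.eval fun ij => ρ g ij.1 ij.2
  let I : Set G → Ideal (MvPolynomial (n × n) ℝ) := fun N => ⨅ g ∈ N, RingHom.ker (ev g)
  have hI : ∀ N q, q ∈ I N ↔ ∀ g ∈ N, ev g q = 0 := fun N q => by
    simp only [I, Submodule.mem_iInf, RingHom.mem_ker]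
  -- The ideal of polynomials vanishing on N grows as N shrinks to 1. By Noetherianity there is a
  -- maximal one, and `hle` shows that it contains all the others.
  obtain ⟨J, ⟨N₀, hN₀, rfl⟩, hmax⟩ := set_has_maximal_iff_noetherian.mpr
    (inferInstance : IsNoetherian (MvPolynomial (n × n) ℝ) (MvPolynomial (n × n) ℝ))
    {J | ∃ N ∈ 𝓝 (1 : G), I N = J} ⟨_, Set.univ, univ_mem, rfl⟩
  have hle : ∀ N ∈ 𝓝 (1 : G), I N ≤ I N₀ := by
    intro N hN
    have hsub : ∀ N', N' ⊆ N₀ → I N₀ ≤ I N' := fun N' h q hq =>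
      (hI _ _).2 fun g hg => (hI _ _).1 hq g (h hg)
    have h1 : I N₀ = I (N ∩ N₀) := by
      by_contra hne
      exact hmax _ ⟨_, inter_mem hN hN₀, rfl⟩
        (lt_of_le_of_ne (hsub _ Set.inter_subset_right) hne)
    rw [h1]
    exact fun q hq => (hI _ _).2 fun g hg => (hI _ _).1 hq g hg.1
  -- Left translation by h, as a substitution in the matrix entries.
  let σ : G → MvPolynomial (n × n) ℝ →+* MvPolynomial (n × n) ℝ := fun h =>
    (MvPolynomial.bind₁ fun ij : n × n =>
      ∑ l, MvPolynomial.C (ρ h ij.1 l) * MvPolynomial.X (l, ij.2)).toRingHom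
  have hσ : ∀ h k q, ev k (σ h q) = ev (h * k) q := by
    intro h k q
    have : (ev k).comp (σ h) = ev (h * k) := by
      apply MvPolynomial.ringHom_ext
      · intro r; simp [ev, σ]
      · rintro ⟨i, j⟩; simp [ev, σ, hρ, Matrix.mul_apply]
    exact congrArg (fun f : MvPolynomial (n × n) ℝ →+* ℝ => f q) this
  let S : Subgroup G :=
    { carrier := {h | ∀ q, q ∈ I N₀ ↔ σ h q ∈ I N₀}
      one_mem' := fun q => by simp only [hI, hσ, one_mul]
      mul_mem' := fun {a b} ha hb q => by
        have : ∀ q, σ b (σ a q) ∈ I N₀ ↔ σ (a * b) q ∈ I N₀ := fun q => by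
          simp only [hI, hσ, mul_assoc]
        rw [ha, hb, this]
      inv_mem' := fun {a} ha q => by
        rw [ha (σ a⁻¹ q)]
        simp only [hI, hσ, inv_mul_cancel_left] }
  -- If h and k are close to 1 then h k stays in N₀, so the translate by h vanishes on a smaller
  -- neighbourhood and lies in the maximal ideal again.
  have hS : ∀ᶠ h in 𝓝 (1 : G), ∀ q ∈ I N₀, σ h q ∈ I N₀ := by
    have hc : Tendsto (fun x : G × G => x.1 * x.2) (𝓝 1 ×ˢ 𝓝 1) (𝓝 1) := by
      have := (continuous_mul (M := G)).tendsto (1, 1)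
      rwa [nhds_prod_eq, mul_one] at this
    obtain ⟨M, hM, N', hN', hMN⟩ := mem_prod_iff.1 (hc hN₀)
    filter_upwards [hM] with h hh q hq
    refine hle N' hN' ((hI _ _).2 fun k hk => ?_)
    rw [hσ]
    exact (hI _ _).1 hq _ (hMN (Set.mk_mem_prod hh hk))
  have hS' : (S : Set G) ∈ 𝓝 (1 : G) := by
    have hinv : Tendsto (fun x : G => x⁻¹) (𝓝 1) (𝓝 1) := by
      simpa using (continuous_inv (G := G)).tendsto 1
    filter_upwards [hS, hinv.eventually hS] with h h1 h2 q
    refine ⟨h1 q, fun hq => ?_⟩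
    have := h2 _ hq
    simpa only [hI, hσ, mul_inv_cancel_left, inv_mul_cancel_left] using this
  -- An open subgroup is closed, so connectedness makes the stabiliser of the ideal the whole group.
  have htop : S = ⊤ := by
    have ho : IsOpen (S : Set G) := S.isOpen_of_mem_nhds hS'
    have := IsClopen.eq_univ (s := (S : Set G)) ⟨S.isClosed_of_isOpen ho, ho⟩ ⟨1, S.one_mem⟩
    exact SetLike.coe_injective this
  have hp' : p ∈ I N₀ := hle _ hp ((hI _ _).2 fun g hg => hg)
  have hg : g ∈ S := htop ▸ Subgroup.mem_top g
  -- The translate of p by g is in the ideal, and its value at 1 is the value of p at g.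
  have := (hI _ _).1 ((hg p).1 hp') 1 (mem_of_mem_nhds hN₀)
  rwa [hσ, mul_one] at this

open Matrix in
/-- In a connected topological group, the elements without eigenvalue `-1` in a given
finite-dimensional representation form a dense set. -/
theorem dense_det_one_add_ne_zero {G : Type*} [TopologicalSpace G] [Group G] [IsTopologicalGroup G]
    [ConnectedSpace G] {n : Type*} [Fintype n] [DecidableEq n] (ρ : G → Matrix n n ℝ)
    (hρ : ∀ g h, ρ (g * h) = ρ g * ρ h) (hone : ρ 1 = 1) :
    Dense {g | (ρ g + 1).det ≠ 0} := by
  rw [dense_iff_inter_open]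
  intro U hU ⟨g, hg⟩
  by_contra hne
  have hz : ∀ h ∈ U, (ρ h + 1).det = 0 := fun h hh => by
    by_contra h0
    exact hne ⟨h, hh, h0⟩
  -- The function h ↦ det(ρ(g h) + 1), as a polynomial in the entries of ρ h. It vanishes near 1 if
  -- the determinant vanishes on U.
  let p : MvPolynomial (n × n) ℝ :=
    ((ρ g).map MvPolynomial.C * Matrix.mvPolynomialX n n ℝ + 1).det
  have hev : ∀ h, MvPolynomial.eval (fun ij => ρ h ij.1 ij.2) p = (ρ (g * h) + 1).det := by
    intro h
    rw [RingHom.map_det, hρ]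
    congr 1
    ext i j
    simp [Matrix.mul_apply, Matrix.one_apply, apply_ite]
  have h0 := eval_eq_zero_of_eventually ρ hρ p (by
    have : Tendsto (fun h : G => g * h) (𝓝 1) (𝓝 g) := by
      simpa using (continuous_const_mul g).tendsto 1
    filter_upwards [this.eventually (hU.mem_nhds hg)] with h hh
    rw [hev, hz _ hh]) g⁻¹
  -- At h = g⁻¹ the polynomial takes the value det(1 + 1), a power of 2.
  rw [hev, mul_inv_cancel, hone] at h0
  have : ((1 : Matrix n n ℝ) + 1) = (2 : ℝ) • 1 := by rw [two_smul]
  rw [this, Matrix.det_smul, Matrix.det_one] at h0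
  simp at h0

end Density

/-! ### Derivatives in preferred charts. -/

section ChartCalculus

open Filter Topology

variable {E : Type*} [NormedAddCommGroup E] [NormedSpace ℝ E]
  {M : Type*} [TopologicalSpace M] [ChartedSpace E M] [IsManifold 𝓘(ℝ, E) ∞ M]

theorem chartDeriv_self (x : M) : chartDeriv (E := E) x x = ContinuousLinearMap.id ℝ E :=
  mfderiv_extChartAt_self

/-- For base points equal to the centre only propositionally, such as g⁻¹ * g and 1. -/
theorem chartDeriv_of_eq {x x' : M} (h : x' = x) :
    (chartDeriv (E := E) x x' : E →L[ℝ] E) = ContinuousLinearMap.id ℝ E := by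
  subst h
  exact chartDeriv_self x'

theorem chartSymmDeriv_self (x : M) :
    (chartSymmDeriv (E := E) x (extChartAt 𝓘(ℝ, E) x x) : E →L[ℝ] E) = ContinuousLinearMap.id ℝ E :=
  mfderivWithin_range_extChartAt_symm

omit [IsManifold 𝓘(ℝ, E) ∞ M] in
theorem eventually_mem_target (x : M) :
    ∀ᶠ y in 𝓝 (extChartAt 𝓘(ℝ, E) x x), y ∈ (extChartAt 𝓘(ℝ, E) x).target :=
  extChartAt_target_mem_nhds x

theorem contMDiffAt_extChartAt_symm {x : M} {y : E} (hy : y ∈ (extChartAt 𝓘(ℝ, E) x).target) :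
    ContMDiffAt 𝓘(ℝ, E) 𝓘(ℝ, E) ∞ (extChartAt 𝓘(ℝ, E) x).symm y :=
  (contMDiffOn_extChartAt_symm x).contMDiffAt ((isOpen_extChartAt_target x).mem_nhds hy)

omit [IsManifold 𝓘(ℝ, E) ∞ M] in
theorem chartSymmDeriv_eq {x : M} (y : E) : chartSymmDeriv x y =
    mfderiv 𝓘(ℝ, E) 𝓘(ℝ, E) (extChartAt 𝓘(ℝ, E) x).symm y := by
  rw [chartSymmDeriv, ModelWithCorners.range_eq_univ, mfderivWithin_univ]

theorem chartDeriv_chartSymmDeriv {x : M} {y : E} (hy : y ∈ (extChartAt 𝓘(ℝ, E) x).target) (v : E) :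
    chartDeriv x ((extChartAt 𝓘(ℝ, E) x).symm y) (chartSymmDeriv x y v) = v :=
  congrArg (fun L : E →L[ℝ] E => L v) (mfderiv_extChartAt_comp_mfderivWithin_extChartAt_symm hy)

theorem chartSymmDeriv_chartDeriv {x : M} {y : E} (hy : y ∈ (extChartAt 𝓘(ℝ, E) x).target)
    (v : TangentSpace 𝓘(ℝ, E) ((extChartAt 𝓘(ℝ, E) x).symm y)) :
    chartSymmDeriv x y (chartDeriv x ((extChartAt 𝓘(ℝ, E) x).symm y) v) = v :=
  congrArg (fun L : E →L[ℝ] E => L v) (mfderivWithin_extChartAt_symm_comp_mfderiv_extChartAt hy)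

/-- The derivative of a map read in charts. -/
theorem fderiv_in_charts {f : M → M} {a b : M} {y : E} (hy : y ∈ (extChartAt 𝓘(ℝ, E) a).target)
    (hf : MDifferentiableAt 𝓘(ℝ, E) 𝓘(ℝ, E) f ((extChartAt 𝓘(ℝ, E) a).symm y))
    (hb : f ((extChartAt 𝓘(ℝ, E) a).symm y) ∈ (chartAt E b).source) (v : E) :
    fderiv ℝ (fun z => extChartAt 𝓘(ℝ, E) b (f ((extChartAt 𝓘(ℝ, E) a).symm z))) y v =
      chartDeriv b (f ((extChartAt 𝓘(ℝ, E) a).symm y))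
        (mfderiv 𝓘(ℝ, E) 𝓘(ℝ, E) f ((extChartAt 𝓘(ℝ, E) a).symm y) (chartSymmDeriv a y v)) := by
  have h1 : MDifferentiableAt 𝓘(ℝ, E) 𝓘(ℝ, E) (extChartAt 𝓘(ℝ, E) a).symm y :=
    (contMDiffAt_extChartAt_symm hy).mdifferentiableAt (by simp)
  have h2 : MDifferentiableAt 𝓘(ℝ, E) 𝓘(ℝ, E) (extChartAt 𝓘(ℝ, E) b)
      (f ((extChartAt 𝓘(ℝ, E) a).symm y)) :=
    mdifferentiableAt_extChartAt hb
  rw [← mfderiv_eq_fderiv, chartSymmDeriv_eq]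
  have h3 := mfderiv_comp y h2 (hf.comp y h1)
  have h4 := mfderiv_comp y hf h1
  have h5 := congrArg (fun L : E →L[ℝ] E => L v) h3
  refine h5.trans ?_
  exact congrArg (fun L : E →L[ℝ] E => chartDeriv b (f ((extChartAt 𝓘(ℝ, E) a).symm y)) (L v)) h4

end ChartCalculus

/-! ### Left and right trivialisations and Ad. -/

section LieGroupCharts

open Filter Topology

variable {E : Type*} [NormedAddCommGroup E] [NormedSpace ℝ E]
  {G : Type*} [TopologicalSpace G] [ChartedSpace E G] [Group G]

section

variable (E) in
/-- The left Maurer-Cartan form in the preferred chart at `x`. -/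
noncomputable def coframeInChart (x : G) (y : E) : E →L[ℝ] E :=
  (leftToOne (E := E) ((extChartAt 𝓘(ℝ, E) x).symm y)).comp (chartSymmDeriv x y)

variable (E) in
/-- The left-invariant frame in the preferred chart at `x`. -/
noncomputable def frameInChart (x : G) (y : E) : E →L[ℝ] E :=
  (chartDeriv (E := E) x ((extChartAt 𝓘(ℝ, E) x).symm y)).comp
    (mfderiv 𝓘(ℝ, E) 𝓘(ℝ, E) (fun h : G => (extChartAt 𝓘(ℝ, E) x).symm y * h) 1)

variable (E) in
/-- The adjoint representation as a field of endomorphisms of the model space. -/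
noncomputable def adE (g : G) : E →L[ℝ] E := Ad (E := E) g

end

variable [LieGroup 𝓘(ℝ, E) ∞ G]

theorem mdifferentiable_leftMul (g : G) : MDifferentiable 𝓘(ℝ, E) 𝓘(ℝ, E) (fun h : G => g * h) :=
  (contMDiff_mul_left (I := 𝓘(ℝ, E)) (n := ∞)).mdifferentiable (by simp)

theorem mdifferentiable_rightMul (g : G) : MDifferentiable 𝓘(ℝ, E) 𝓘(ℝ, E) (fun h : G => h * g) :=
  (contMDiff_mul_right (I := 𝓘(ℝ, E)) (n := ∞)).mdifferentiable (by simp)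

theorem mdifferentiable_conj (g : G) :
    MDifferentiable 𝓘(ℝ, E) 𝓘(ℝ, E) (fun h : G => g * h * g⁻¹) :=
  (mdifferentiable_rightMul g⁻¹).comp (mdifferentiable_leftMul g)

omit [Group G] [LieGroup 𝓘(ℝ, E) ∞ G] in
/-- Chain rule, with the tangent spaces read as the model space. -/
theorem mfderiv_comp_apply_model {f₁ f₂ f₃ : G → G} {g h : G}
    (h₁ : MDifferentiableAt 𝓘(ℝ, E) 𝓘(ℝ, E) f₁ g) (hg : f₁ g = h)
    (h₂ : MDifferentiableAt 𝓘(ℝ, E) 𝓘(ℝ, E) f₂ h) (h₃ : ∀ x, f₂ (f₁ x) = f₃ x) (v : E) :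
    (mfderiv 𝓘(ℝ, E) 𝓘(ℝ, E) f₃ g : E →L[ℝ] E) v =
      (mfderiv 𝓘(ℝ, E) 𝓘(ℝ, E) f₂ h : E →L[ℝ] E) ((mfderiv 𝓘(ℝ, E) 𝓘(ℝ, E) f₁ g : E →L[ℝ] E) v) := by
  subst hg
  obtain rfl : f₃ = f₂ ∘ f₁ := funext fun x => (h₃ x).symm
  exact congrArg (fun L : E →L[ℝ] E => L v) (mfderiv_comp g h₂ h₁)

omit [Group G] [LieGroup 𝓘(ℝ, E) ∞ G] in
theorem mfderiv_of_forall_eq {f : G → G} {g : G} (h : ∀ x, f x = x) (v : E) :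
    (mfderiv 𝓘(ℝ, E) 𝓘(ℝ, E) f g : E →L[ℝ] E) v = v := by
  obtain rfl : f = id := funext h
  exact congrArg (fun L : E →L[ℝ] E => L v) (mfderiv_id (I := 𝓘(ℝ, E)) (x := g))

theorem leftField_leftToOne (g : G) (v : E) :
    (mfderiv 𝓘(ℝ, E) 𝓘(ℝ, E) (fun h : G => g * h) 1 : E →L[ℝ] E)
      ((leftToOne (E := E) g : E →L[ℝ] E) v) = v := by
  have := mfderiv_comp_apply_model (f₃ := fun h => h) (mdifferentiable_leftMul (E := E) g⁻¹ g)
    (inv_mul_cancel g) (mdifferentiable_leftMul (E := E) g 1)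
    (fun x => mul_inv_cancel_left g x) v
  rw [mfderiv_of_forall_eq (fun _ => rfl)] at this
  exact this.symm

theorem leftToOne_leftField (g : G) (v : E) :
    (leftToOne (E := E) g : E →L[ℝ] E)
      ((mfderiv 𝓘(ℝ, E) 𝓘(ℝ, E) (fun h : G => g * h) 1 : E →L[ℝ] E) v) = v := by
  have := mfderiv_comp_apply_model (f₃ := fun h => h) (mdifferentiable_leftMul (E := E) g 1)
    (mul_one g) (mdifferentiable_leftMul (E := E) g⁻¹ g)
    (fun x => inv_mul_cancel_left g x) v
  rw [mfderiv_of_forall_eq (fun _ => rfl)] at this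
  exact this.symm

omit [LieGroup 𝓘(ℝ, E) ∞ G] in
theorem adE_one (v : E) : adE E (1 : G) v = v :=
  mfderiv_of_forall_eq (fun x => by simp) v

theorem adE_mul (g h : G) (v : E) : adE E (g * h) v = adE E g (adE E h v) :=
  mfderiv_comp_apply_model (mdifferentiable_conj h 1) (by simp) (mdifferentiable_conj g 1)
    (fun x => by group) v

/-- Right trivialisation is left trivialisation followed by the adjoint action. -/
theorem rightToOne_eq (g : G) (v : E) :
    (rightToOne (E := E) g : E →L[ℝ] E) v = adE E g ((leftToOne (E := E) g : E →L[ℝ] E) v) :=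
  mfderiv_comp_apply_model (mdifferentiable_leftMul g⁻¹ g) (by simp) (mdifferentiable_conj g 1)
    (fun x => by group) v

theorem mul_right_adE (g : G) (v : E) :
    (mfderiv 𝓘(ℝ, E) 𝓘(ℝ, E) (fun h : G => h * g) 1 : E →L[ℝ] E) (adE E g v) =
      (mfderiv 𝓘(ℝ, E) 𝓘(ℝ, E) (fun h : G => g * h) 1 : E →L[ℝ] E) v :=
  (mfderiv_comp_apply_model (mdifferentiable_conj g 1) (by simp) (mdifferentiable_rightMul g 1)
    (fun x => by group) v).symm

theorem frame_coframe {x : G} {y : E} (hy : y ∈ (extChartAt 𝓘(ℝ, E) x).target) (v : E) :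
    frameInChart E x y (coframeInChart E x y v) = v := by
  have h1 := leftField_leftToOne (E := E) ((extChartAt 𝓘(ℝ, E) x).symm y) (chartSymmDeriv x y v)
  have h2 := congrArg (fun w : E => (chartDeriv (E := E) x ((extChartAt 𝓘(ℝ, E) x).symm y) : E →L[ℝ] E) w) h1
  exact h2.trans (chartDeriv_chartSymmDeriv hy v)

theorem coframe_frame {x : G} {y : E} (hy : y ∈ (extChartAt 𝓘(ℝ, E) x).target) (v : E) :
    coframeInChart E x y (frameInChart E x y v) = v := by
  have h1 := chartSymmDeriv_chartDeriv hy
    (mfderiv 𝓘(ℝ, E) 𝓘(ℝ, E) (fun h : G => (extChartAt 𝓘(ℝ, E) x).symm y * h) 1 v)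
  have h2 := congrArg (fun w : E => (leftToOne (E := E) ((extChartAt 𝓘(ℝ, E) x).symm y) : E →L[ℝ] E) w) h1
  exact h2.trans (leftToOne_leftField _ v)

end LieGroupCharts

/-! ### Smoothness of the coframe, the frame and Ad in charts. -/

section

open Filter Topology

variable {E : Type*} [NormedAddCommGroup E] [NormedSpace ℝ E]

theorem fderiv_in_charts_self {M : Type*} [TopologicalSpace M] [ChartedSpace E M]
    [IsManifold 𝓘(ℝ, E) ∞ M] {f : M → M} {a b : M}
    (hf : MDifferentiableAt 𝓘(ℝ, E) 𝓘(ℝ, E) f a) (hb : f a ∈ (chartAt E b).source) (v : E) :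
    fderiv ℝ (fun z => extChartAt 𝓘(ℝ, E) b (f ((extChartAt 𝓘(ℝ, E) a).symm z)))
      (extChartAt 𝓘(ℝ, E) a a) v =
      (chartDeriv b (f a) : E →L[ℝ] E) ((mfderiv 𝓘(ℝ, E) 𝓘(ℝ, E) f a : E →L[ℝ] E) v) := by
  have h0 : (extChartAt 𝓘(ℝ, E) a).symm (extChartAt 𝓘(ℝ, E) a a) = a := extChartAt_to_inv a
  have h1 := fderiv_in_charts (f := f) (b := b) (mem_extChartAt_target a) (by rwa [h0])
    (by rwa [h0]) v
  have h2 : ∀ p, p = a → (chartDeriv b (f p) : E →L[ℝ] E)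
      ((mfderiv 𝓘(ℝ, E) 𝓘(ℝ, E) f p : E →L[ℝ] E) v) =
      (chartDeriv b (f a) : E →L[ℝ] E) ((mfderiv 𝓘(ℝ, E) 𝓘(ℝ, E) f a : E →L[ℝ] E) v) := by
    rintro _ rfl
    rfl
  have h3 := congrArg (fun L : E →L[ℝ] E => L v) (chartSymmDeriv_self a)
  rw [h1, ← h2 _ h0]
  exact congrArg (fun w : E => (chartDeriv b (f ((extChartAt 𝓘(ℝ, E) a).symm (extChartAt 𝓘(ℝ, E) a a)))
    : E →L[ℝ] E) ((mfderiv 𝓘(ℝ, E) 𝓘(ℝ, E) f _ : E →L[ℝ] E) w)) h3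

variable {G : Type*} [TopologicalSpace G] [ChartedSpace E G] [Group G] [LieGroup 𝓘(ℝ, E) ∞ G]

theorem contMDiffAt_symm_comp {N : Type*} [NormedAddCommGroup N] [NormedSpace ℝ N] {x : G} {f : N → E}
    {p : N} (hf : ContDiffAt ℝ ∞ f p) (hp : f p = extChartAt 𝓘(ℝ, E) x x) :
    ContMDiffAt 𝓘(ℝ, N) 𝓘(ℝ, E) ∞ (fun q => (extChartAt 𝓘(ℝ, E) x).symm (f q)) p :=
  ContMDiffAt.comp p (contMDiffAt_extChartAt_symm (hp ▸ mem_extChartAt_target x)) hf.contMDiffAt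

theorem contDiffAt_chart_comp {N : Type*} [NormedAddCommGroup N] [NormedSpace ℝ N] {b : G} {f : N → G}
    {p : N} (hf : ContMDiffAt 𝓘(ℝ, N) 𝓘(ℝ, E) ∞ f p) (hb : f p ∈ (chartAt E b).source) :
    ContDiffAt ℝ ∞ (fun q => extChartAt 𝓘(ℝ, E) b (f q)) p :=
  ((contMDiffAt_extChartAt' hb).comp p hf).contDiffAt

/-- The coframe at y is the derivative in z, at z = y, of the jointly smooth chart expression of y⁻¹
z. The same device, with the products y z and y z y⁻¹ differentiated at z = 1, serves for the frame
and for Ad. -/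
theorem contDiffAt_coframe (x : G) :
    ContDiffAt ℝ ∞ (coframeInChart E x) (extChartAt 𝓘(ℝ, E) x x) := by
  have h1 : ContDiffAt ℝ ∞ (Function.uncurry fun y z : E => extChartAt 𝓘(ℝ, E) (1 : G)
      (((extChartAt 𝓘(ℝ, E) x).symm y)⁻¹ * (extChartAt 𝓘(ℝ, E) x).symm z))
      (extChartAt 𝓘(ℝ, E) x x, extChartAt 𝓘(ℝ, E) x x) := by
    refine contDiffAt_chart_comp (f := fun q : E × E => ((extChartAt 𝓘(ℝ, E) x).symm q.1)⁻¹ *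
      (extChartAt 𝓘(ℝ, E) x).symm q.2) ?_ ?_
    · exact ((contMDiffAt_symm_comp contDiffAt_fst rfl).inv).mul
        (contMDiffAt_symm_comp contDiffAt_snd rfl)
    · simp
  refine (h1.fderiv contDiffAt_id (m := ∞) (by simp)).congr_of_eventuallyEq ?_
  filter_upwards [eventually_mem_target x] with y hy
  ext v
  have hg : ((extChartAt 𝓘(ℝ, E) x).symm y)⁻¹ * (extChartAt 𝓘(ℝ, E) x).symm y = 1 := inv_mul_cancel _
  have := fderiv_in_charts (b := 1) hy (mdifferentiable_leftMul ((extChartAt 𝓘(ℝ, E) x).symm y)⁻¹ _)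
    (by rw [hg]; exact mem_chart_source _ _) v
  refine Eq.trans ?_ this.symm
  rw [chartDeriv_of_eq hg]
  rfl

theorem contDiffAt_frame (x : G) :
    ContDiffAt ℝ ∞ (frameInChart E x) (extChartAt 𝓘(ℝ, E) x x) := by
  have h1 : ContDiffAt ℝ ∞ (Function.uncurry fun y z : E => extChartAt 𝓘(ℝ, E) x
      ((extChartAt 𝓘(ℝ, E) x).symm y * (extChartAt 𝓘(ℝ, E) (1 : G)).symm z))
      (extChartAt 𝓘(ℝ, E) x x, extChartAt 𝓘(ℝ, E) (1 : G) 1) := by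
    refine contDiffAt_chart_comp (f := fun q : E × E => (extChartAt 𝓘(ℝ, E) x).symm q.1 *
      (extChartAt 𝓘(ℝ, E) (1 : G)).symm q.2) ?_ ?_
    · exact (contMDiffAt_symm_comp contDiffAt_fst rfl).mul
        (contMDiffAt_symm_comp contDiffAt_snd rfl)
    · simp
  refine (h1.fderiv (g := fun _ => extChartAt 𝓘(ℝ, E) (1 : G) 1) contDiffAt_const
    (m := ∞) (by simp)).congr_of_eventuallyEq ?_
  filter_upwards [eventually_mem_target x] with y hy
  have hs : (extChartAt 𝓘(ℝ, E) x).symm y * 1 ∈ (chartAt E x).source := by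
    rw [mul_one, ← extChartAt_source 𝓘(ℝ, E)]
    exact (extChartAt 𝓘(ℝ, E) x).map_target hy
  ext v
  refine Eq.trans ?_ (fderiv_in_charts_self (mdifferentiable_leftMul _ _) hs v).symm
  rw [frameInChart]
  have : (extChartAt 𝓘(ℝ, E) x).symm y * 1 = (extChartAt 𝓘(ℝ, E) x).symm y := mul_one _
  have h2 : ∀ g g' : G, g' = g → (chartDeriv (E := E) x g' : E →L[ℝ] E) = chartDeriv x g := by
    rintro _ _ rfl; rfl
  exact (congrArg (fun L : E →L[ℝ] E => L _) (h2 _ _ this)).symm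

theorem contDiffAt_adE (x : G) :
    ContDiffAt ℝ ∞ (fun y => adE E ((extChartAt 𝓘(ℝ, E) x).symm y)) (extChartAt 𝓘(ℝ, E) x x) := by
  have h1 : ContDiffAt ℝ ∞ (Function.uncurry fun y z : E => extChartAt 𝓘(ℝ, E) (1 : G)
      ((extChartAt 𝓘(ℝ, E) x).symm y * (extChartAt 𝓘(ℝ, E) (1 : G)).symm z *
        ((extChartAt 𝓘(ℝ, E) x).symm y)⁻¹))
      (extChartAt 𝓘(ℝ, E) x x, extChartAt 𝓘(ℝ, E) (1 : G) 1) := by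
    refine contDiffAt_chart_comp (f := fun q : E × E => (extChartAt 𝓘(ℝ, E) x).symm q.1 *
      (extChartAt 𝓘(ℝ, E) (1 : G)).symm q.2 * ((extChartAt 𝓘(ℝ, E) x).symm q.1)⁻¹) ?_ ?_
    · exact ((contMDiffAt_symm_comp contDiffAt_fst rfl).mul
        (contMDiffAt_symm_comp contDiffAt_snd rfl)).mul
          (contMDiffAt_symm_comp contDiffAt_fst rfl).inv
    · simp
  refine (h1.fderiv (g := fun _ => extChartAt 𝓘(ℝ, E) (1 : G) 1) contDiffAt_const
    (m := ∞) (by simp)).congr_of_eventuallyEq (Eventually.of_forall fun y => ?_)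
  ext v
  have hg : (extChartAt 𝓘(ℝ, E) x).symm y * 1 * ((extChartAt 𝓘(ℝ, E) x).symm y)⁻¹ = 1 := by simp
  refine Eq.trans ?_ (fderiv_in_charts_self (mdifferentiable_conj _ _)
    (by rw [hg]; exact mem_chart_source _ _) v).symm
  rw [chartDeriv_of_eq hg]
  rfl

end

/-! ### The Lie bracket in charts. -/

section LieBracketCharts

open Filter Topology VectorField

variable {E : Type*} [NormedAddCommGroup E] [NormedSpace ℝ E] [FiniteDimensional ℝ E]
  {G : Type*} [TopologicalSpace G] [ChartedSpace E G] [Group G] [LieGroup 𝓘(ℝ, E) ∞ G]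

omit [FiniteDimensional ℝ E] in
theorem lieGroup_minSmoothness : LieGroup 𝓘(ℝ, E) (minSmoothness ℝ 3) G := by
  rw [minSmoothness_of_isRCLikeNormedField]
  infer_instance

variable (E G) in
/-- The Lie bracket of a Lie group, on the model space. -/
noncomputable def bracketE : E →L[ℝ] E →L[ℝ] E :=
  haveI : LieGroup 𝓘(ℝ, E) (minSmoothness ℝ 3) G := lieGroup_minSmoothness
  haveI : CompleteSpace E := FiniteDimensional.complete ℝ E
  LinearMap.toContinuousBilinearMap (LinearMap.mk₂ ℝ
    (fun X Y : E =>
      (@Bracket.bracket (GroupLieAlgebra 𝓘(ℝ, E) G) (GroupLieAlgebra 𝓘(ℝ, E) G) _ X Y : E))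
    (fun X Y Z => add_lie (L := GroupLieAlgebra 𝓘(ℝ, E) G) (M := GroupLieAlgebra 𝓘(ℝ, E) G) X Y Z)
    (fun c X Y => smul_lie (L := GroupLieAlgebra 𝓘(ℝ, E) G) (M := GroupLieAlgebra 𝓘(ℝ, E) G) c X Y)
    (fun X Y Z => lie_add (L := GroupLieAlgebra 𝓘(ℝ, E) G) (M := GroupLieAlgebra 𝓘(ℝ, E) G) X Y Z)
    (fun c X Y => lie_smul (L := GroupLieAlgebra 𝓘(ℝ, E) G) (M := GroupLieAlgebra 𝓘(ℝ, E) G) c X Y))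

theorem bracketE_skew (X Y : E) : bracketE E G X Y = - bracketE E G Y X :=
  haveI : LieGroup 𝓘(ℝ, E) (minSmoothness ℝ 3) G := lieGroup_minSmoothness
  haveI : CompleteSpace E := FiniteDimensional.complete ℝ E
  (lie_skew (L := GroupLieAlgebra 𝓘(ℝ, E) G) X Y).symm

theorem bracketE_jacobi (X Y Z : E) : bracketE E G X (bracketE E G Y Z) =
    bracketE E G (bracketE E G X Y) Z + bracketE E G Y (bracketE E G X Z) :=
  haveI : LieGroup 𝓘(ℝ, E) (minSmoothness ℝ 3) G := lieGroup_minSmoothness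
  haveI : CompleteSpace E := FiniteDimensional.complete ℝ E
  leibniz_lie (L₁ := GroupLieAlgebra 𝓘(ℝ, E) G) (L₂ := GroupLieAlgebra 𝓘(ℝ, E) G)
    (M := GroupLieAlgebra 𝓘(ℝ, E) G) X Y Z

omit [FiniteDimensional ℝ E] in
theorem frame_self (x : G) (v : E) : frameInChart E x (extChartAt 𝓘(ℝ, E) x x) v =
    (mfderiv 𝓘(ℝ, E) 𝓘(ℝ, E) (fun h : G => x * h) 1 : E →L[ℝ] E) v := by
  have h0 : (extChartAt 𝓘(ℝ, E) x).symm (extChartAt 𝓘(ℝ, E) x x) = x := extChartAt_to_inv x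
  have h : ∀ g : G, g = x → ((chartDeriv (E := E) x g : E →L[ℝ] E)
      ((mfderiv 𝓘(ℝ, E) 𝓘(ℝ, E) (fun h : G => g * h) 1 : E →L[ℝ] E) v)) =
      (mfderiv 𝓘(ℝ, E) 𝓘(ℝ, E) (fun h : G => x * h) 1 : E →L[ℝ] E) v := by
    rintro _ rfl
    exact congrArg (fun L : E →L[ℝ] E => L _) (chartDeriv_self _)
  exact h _ h0

omit [FiniteDimensional ℝ E] in
theorem coframe_self (x : G) (v : E) : coframeInChart E x (extChartAt 𝓘(ℝ, E) x x) v =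
    (leftToOne (E := E) x : E →L[ℝ] E) v := by
  have h := frame_self (E := E) x ((leftToOne (E := E) x : E →L[ℝ] E) v)
  rw [leftField_leftToOne] at h
  have h2 := coframe_frame (E := E) (mem_extChartAt_target x) ((leftToOne (E := E) x : E →L[ℝ] E) v)
  exact (congrArg (fun w : E => coframeInChart E x (extChartAt 𝓘(ℝ, E) x x) w) h).symm.trans h2

omit [FiniteDimensional ℝ E] in
theorem mpullback_leftField {x : G} {y : E} (hy : y ∈ (extChartAt 𝓘(ℝ, E) x).target) (X : E) :
    mpullbackWithin 𝓘(ℝ, E) 𝓘(ℝ, E) (extChartAt 𝓘(ℝ, E) x).symm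
      (mulInvariantVectorField (I := 𝓘(ℝ, E)) (G := G) X) (Set.range 𝓘(ℝ, E)) y =
      frameInChart E x y X := by
  rw [mpullbackWithin_apply]
  have h : (mfderivWithin 𝓘(ℝ, E) 𝓘(ℝ, E) (extChartAt 𝓘(ℝ, E) x).symm (Set.range 𝓘(ℝ, E)) y).inverse =
      chartDeriv x ((extChartAt 𝓘(ℝ, E) x).symm y) :=
    ContinuousLinearMap.inverse_eq
      (ContinuousLinearMap.ext fun v => chartSymmDeriv_chartDeriv hy v)
      (ContinuousLinearMap.ext fun v => chartDeriv_chartSymmDeriv hy v)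
  rw [h]
  rfl

omit [FiniteDimensional ℝ E] in
-- The outer factor in the manifold bracket is the inverse of the chart derivative at the centre of
-- the chart, which is the identity.
theorem mlieBracket_eq_lieBracket {M : Type*} [TopologicalSpace M] [ChartedSpace E M]
    [IsManifold 𝓘(ℝ, E) ∞ M] (V W : (x : M) → TangentSpace 𝓘(ℝ, E) x) (x : M) :
    mlieBracket 𝓘(ℝ, E) V W x =
      lieBracket ℝ (mpullbackWithin 𝓘(ℝ, E) 𝓘(ℝ, E) (extChartAt 𝓘(ℝ, E) x).symm V
        (Set.range 𝓘(ℝ, E)))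
        (mpullbackWithin 𝓘(ℝ, E) 𝓘(ℝ, E) (extChartAt 𝓘(ℝ, E) x).symm W (Set.range 𝓘(ℝ, E)))
        (extChartAt 𝓘(ℝ, E) x x) := by
  rw [mlieBracket, mlieBracketWithin_apply, Set.preimage_univ, Set.univ_inter]
  have h1 : ∀ S : Set E, S = Set.univ → ∀ V W : E → E, ∀ L : E →L[ℝ] E,
      L = ContinuousLinearMap.id ℝ E → ∀ y,
      L.inverse (lieBracketWithin ℝ V W S y) = lieBracket ℝ V W y := by
    rintro _ rfl V W _ rfl y
    rw [lieBracketWithin_univ, ContinuousLinearMap.inverse_id]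
    rfl
  exact h1 _ (ModelWithCorners.range_eq_univ _) _ _ _ (chartDeriv_self x) _

/-- The bracket of left-invariant fields, in a chart. -/
theorem frame_bracket (x : G) (X Y : E) :
    frameInChart E x (extChartAt 𝓘(ℝ, E) x x) (bracketE E G X Y) =
      fderiv ℝ (frameInChart E x) (extChartAt 𝓘(ℝ, E) x x)
        (frameInChart E x (extChartAt 𝓘(ℝ, E) x x) X) Y -
      fderiv ℝ (frameInChart E x) (extChartAt 𝓘(ℝ, E) x x)
        (frameInChart E x (extChartAt 𝓘(ℝ, E) x x) Y) X := by
  have : LieGroup 𝓘(ℝ, E) (minSmoothness ℝ 3) G := lieGroup_minSmoothness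
  have : CompleteSpace E := FiniteDimensional.complete ℝ E
  have h1 := congrFun (mulInvariantVector_mlieBracket (I := 𝓘(ℝ, E)) (G := G) X Y) x
  rw [frame_self]
  refine Eq.trans h1 ?_
  have hdf : DifferentiableAt ℝ (frameInChart E x) (extChartAt 𝓘(ℝ, E) x x) :=
    (contDiffAt_frame x).differentiableAt (by simp)
  have hd : ∀ Z u, fderiv ℝ (fun y => frameInChart E x y Z) (extChartAt 𝓘(ℝ, E) x x) u =
      fderiv ℝ (frameInChart E x) (extChartAt 𝓘(ℝ, E) x x) u Z := fun Z u => by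
    have := hdf.hasFDerivAt.clm_apply (hasFDerivAt_const Z _)
    rw [this.fderiv]
    simp
  have hev : ∀ Z : E, mpullbackWithin 𝓘(ℝ, E) 𝓘(ℝ, E) (extChartAt 𝓘(ℝ, E) x).symm
      (mulInvariantVectorField (I := 𝓘(ℝ, E)) (G := G) Z) (Set.range 𝓘(ℝ, E))
        =ᶠ[𝓝 (extChartAt 𝓘(ℝ, E) x x)] fun y => frameInChart E x y Z := fun Z => by
    filter_upwards [eventually_mem_target x] with y hy using mpullback_leftField hy Z
  refine Eq.trans (mlieBracket_eq_lieBracket _ _ x) ?_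
  refine Eq.trans ((hev X).lieBracket_vectorField_eq (𝕜 := ℝ) (hev Y)) ?_
  rw [lieBracket, hd, hd]

end LieBracketCharts

/-! ### The derivative of Ad from the second derivative of the multiplication. -/

section AdjointDerivative

open Filter Topology

variable {E : Type*} [NormedAddCommGroup E] [NormedSpace ℝ E]

/-- The derivative of the adjoint action, in terms of the frame of left-invariant fields, for a
local multiplication `m`. -/
theorem fderiv_adjoint_of_mul {m : E × E → E} {o : E} (hm : ContDiffAt ℝ ∞ m (o, o))
    {e a : E → E →L[ℝ] E}
    (he : ∀ᶠ y in 𝓝 o, ∀ v, fderiv ℝ (fun z => m (y, z)) o v = e y v)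
    (ha : ∀ᶠ y in 𝓝 o, ∀ v, fderiv ℝ (fun z => m (z, y)) o (a y v) = e y v)
    (hda : DifferentiableAt ℝ a o) (hea : ∀ v, e o v = v) (haa : ∀ v, a o v = v) (u v : E) :
    fderiv ℝ a o u v = fderiv ℝ e o u v - fderiv ℝ e o v u := by
  have htwo : (2 : WithTop ℕ∞) ≤ ∞ := WithTop.coe_le_coe.2 (le_top : (2 : ℕ∞) ≤ ⊤)
  have hdm : ∀ᶠ p in 𝓝 (o, o), DifferentiableAt ℝ m p :=
    ((hm.of_le (m := 1) (by simp)).eventually (by simp)).mono fun p hp =>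
      hp.differentiableAt (by simp)
  have hl : Tendsto (fun y : E => (y, o)) (𝓝 o) (𝓝 (o, o)) :=
    (Continuous.prodMk continuous_id continuous_const).tendsto o
  have hr : Tendsto (fun y : E => (o, y)) (𝓝 o) (𝓝 (o, o)) :=
    (Continuous.prodMk continuous_const continuous_id).tendsto o
  have hfl : ∀ y z, HasFDerivAt (fun z : E => (y, z)) (ContinuousLinearMap.inr ℝ E E) z :=
    fun y z => hasFDerivAt_prodMk_right y z
  have hfr : ∀ y z, HasFDerivAt (fun z : E => (z, y)) (ContinuousLinearMap.inl ℝ E E) z :=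
    fun y z => hasFDerivAt_prodMk_left z y
  have he' : ∀ᶠ y in 𝓝 o, e y = (fderiv ℝ m (y, o)).comp (ContinuousLinearMap.inr ℝ E E) := by
    filter_upwards [he, hl.eventually hdm] with y h1 h2
    ext v
    have h3 : HasFDerivAt (fun z => m (y, z)) _ o := h2.hasFDerivAt.comp o (hfl y o)
    rw [← h1, h3.fderiv]
  have ha' : ∀ᶠ y in 𝓝 o, ((fderiv ℝ m (o, y)).comp (ContinuousLinearMap.inl ℝ E E)).comp (a y)
      = e y := by
    filter_upwards [ha, hr.eventually hdm] with y h1 h2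
    ext v
    have h3 : HasFDerivAt (fun z => m (z, y)) _ o := h2.hasFDerivAt.comp o (hfr y o)
    rw [← h1, h3.fderiv]
    rfl
  have hD : HasFDerivAt (fderiv ℝ m) (fderiv ℝ (fderiv ℝ m) (o, o)) (o, o) :=
    ((hm.fderiv_right (m := 1) (by rw [one_add_one_eq_two]; exact htwo)).differentiableAt (by simp)).hasFDerivAt
  have hDl : HasFDerivAt (fun y => fderiv ℝ m (y, o)) _ o :=
    HasFDerivAt.comp (f := fun y => (y, o)) o hD (hfr o o)
  have hDr : HasFDerivAt (fun y => fderiv ℝ m (o, y)) _ o :=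
    HasFDerivAt.comp (f := fun y => (o, y)) o hD (hfl o o)
  have h1 : ∀ u v, fderiv ℝ e o u v = fderiv ℝ (fderiv ℝ m) (o, o) (u, 0) (0, v) := fun u v => by
    rw [EventuallyEq.fderiv_eq he', (hDl.clm_comp (hasFDerivAt_const _ _)).fderiv]
    simp
  have h2 : ∀ u v, fderiv ℝ e o u v = fderiv ℝ (fderiv ℝ m) (o, o) (0, u) (v, 0) +
      fderiv ℝ m (o, o) (fderiv ℝ a o u v, 0) := fun u v => by
    rw [← EventuallyEq.fderiv_eq ha', ((hDr.clm_comp (hasFDerivAt_const _ _)).clm_comp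
      hda.hasFDerivAt).fderiv]
    simp [haa, add_comm]
  have h3 : ∀ w, fderiv ℝ m (o, o) (w, 0) = w := fun w => by
    have := congrArg (fun L : E →L[ℝ] E => L w) ha'.self_of_nhds
    simpa [haa, hea] using this
  -- `h1` and `h2` express the derivative of the frame by the mixed second derivative of m at (o,
  -- o), with the factors in opposite orders. Symmetry compares them, and the difference is the
  -- derivative of a.
  have hs := hm.isSymmSndFDerivAt (by simpa using htwo)
  have h4 := h2 u v
  rw [h3] at h4
  rw [hs.eq, ← h1] at h4
  rw [h4]
  abel

end AdjointDerivative

/-! ### Ad and ad; the Maurer-Cartan frame of a Lie group. -/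

section AdjointFrame

open Filter Topology

variable {E : Type*} [NormedAddCommGroup E] [NormedSpace ℝ E]
  {G : Type*} [TopologicalSpace G] [ChartedSpace E G] [Group G] [LieGroup 𝓘(ℝ, E) ∞ G]

theorem fderiv_mul_left_chart {x : G} {y : E} (hy : y ∈ (extChartAt 𝓘(ℝ, E) x).target) (v : E) :
    fderiv ℝ (fun z => extChartAt 𝓘(ℝ, E) x ((extChartAt 𝓘(ℝ, E) x).symm y *
      (extChartAt 𝓘(ℝ, E) (1 : G)).symm z)) (extChartAt 𝓘(ℝ, E) (1 : G) 1) v =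
      frameInChart E x y v := by
  have hs : (extChartAt 𝓘(ℝ, E) x).symm y * 1 ∈ (chartAt E x).source := by
    rw [mul_one, ← extChartAt_source 𝓘(ℝ, E)]
    exact (extChartAt 𝓘(ℝ, E) x).map_target hy
  refine (fderiv_in_charts_self (mdifferentiable_leftMul _ _) hs v).trans ?_
  have h2 : ∀ g g' : G, g' = g → (chartDeriv (E := E) x g' : E →L[ℝ] E) = chartDeriv x g := by
    rintro _ _ rfl; rfl
  exact congrArg (fun L : E →L[ℝ] E => L _) (h2 _ _ (mul_one _))

/-- Right translation after Ad_g is left translation; this is the second relation that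
`fderiv_adjoint_of_mul` asks of the local multiplication. -/
theorem fderiv_mul_right_chart {x : G} {y : E} (hy : y ∈ (extChartAt 𝓘(ℝ, E) x).target) (v : E) :
    fderiv ℝ (fun z => extChartAt 𝓘(ℝ, E) x ((extChartAt 𝓘(ℝ, E) (1 : G)).symm z *
      (extChartAt 𝓘(ℝ, E) x).symm y)) (extChartAt 𝓘(ℝ, E) (1 : G) 1)
      (adE E ((extChartAt 𝓘(ℝ, E) x).symm y) v) = frameInChart E x y v := by
  have hs : 1 * (extChartAt 𝓘(ℝ, E) x).symm y ∈ (chartAt E x).source := by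
    rw [one_mul, ← extChartAt_source 𝓘(ℝ, E)]
    exact (extChartAt 𝓘(ℝ, E) x).map_target hy
  refine (fderiv_in_charts_self (mdifferentiable_rightMul _ _) hs _).trans ?_
  rw [mul_right_adE]
  have h2 : ∀ g g' : G, g' = g → (chartDeriv (E := E) x g' : E →L[ℝ] E) = chartDeriv x g := by
    rintro _ _ rfl; rfl
  exact congrArg (fun L : E →L[ℝ] E => L _) (h2 _ _ (one_mul _))

theorem frame_one (v : E) : frameInChart E (1 : G) (extChartAt 𝓘(ℝ, E) (1 : G) 1) v = v :=
  (frame_self (1 : G) v).trans (mfderiv_of_forall_eq (fun x => one_mul x) v)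

variable [FiniteDimensional ℝ E]

/-- `ad` is the derivative of `Ad` at the identity. -/
theorem fderiv_adE_one (u v : E) :
    fderiv ℝ (fun y => adE E ((extChartAt 𝓘(ℝ, E) (1 : G)).symm y))
      (extChartAt 𝓘(ℝ, E) (1 : G) 1) u v = bracketE E G u v := by
  have h1 : ContDiffAt ℝ ∞ (fun q : E × E => extChartAt 𝓘(ℝ, E) (1 : G)
      ((extChartAt 𝓘(ℝ, E) (1 : G)).symm q.1 * (extChartAt 𝓘(ℝ, E) (1 : G)).symm q.2))
      (extChartAt 𝓘(ℝ, E) (1 : G) 1, extChartAt 𝓘(ℝ, E) (1 : G) 1) := by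
    refine contDiffAt_chart_comp (f := fun q : E × E => (extChartAt 𝓘(ℝ, E) (1 : G)).symm q.1 *
      (extChartAt 𝓘(ℝ, E) (1 : G)).symm q.2) ?_ ?_
    · exact (contMDiffAt_symm_comp contDiffAt_fst rfl).mul
        (contMDiffAt_symm_comp contDiffAt_snd rfl)
    · simp
  rw [fderiv_adjoint_of_mul (e := frameInChart E (1 : G)) h1 ?_ ?_
    ((contDiffAt_adE (1 : G)).differentiableAt (by simp)) frame_one ?_]
  · have := frame_bracket (E := E) (1 : G) u v
    rw [frame_one, frame_one, frame_one] at this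
    exact this.symm
  · filter_upwards [eventually_mem_target (1 : G)] with y hy v using fderiv_mul_left_chart hy v
  · filter_upwards [eventually_mem_target (1 : G)] with y hy v using fderiv_mul_right_chart hy v
  · intro v
    rw [extChartAt_to_inv]
    exact adE_one v

/-- The chain rule for `Ad` along a map `f` with values near the identity. -/
theorem fderiv_adE_comp {f : E → G} {p : E} (hf : ContMDiffAt 𝓘(ℝ, E) 𝓘(ℝ, E) ∞ f p)
    (hp : f p = 1) (u v : E) :
    fderiv ℝ (fun y => adE E (f y)) p u v =
      bracketE E G (fderiv ℝ (fun y => extChartAt 𝓘(ℝ, E) (1 : G) (f y)) p u) v := by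
  have hs : ∀ᶠ y in 𝓝 p, f y ∈ (extChartAt 𝓘(ℝ, E) (1 : G)).source :=
    hf.continuousAt.eventually_mem (hp ▸ extChartAt_source_mem_nhds (1 : G))
  have hev : (fun y => adE E (f y)) =ᶠ[𝓝 p] (fun z => adE E ((extChartAt 𝓘(ℝ, E) (1 : G)).symm z)) ∘
      fun y => extChartAt 𝓘(ℝ, E) (1 : G) (f y) := by
    filter_upwards [hs] with y hy
    simp only [Function.comp]
    rw [(extChartAt 𝓘(ℝ, E) (1 : G)).left_inv hy]
  have hc : DifferentiableAt ℝ (fun y => extChartAt 𝓘(ℝ, E) (1 : G) (f y)) p :=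
    (contDiffAt_chart_comp hf (by rw [hp]; exact mem_chart_source _ _)).differentiableAt (by simp)
  have ha : DifferentiableAt ℝ (fun z => adE E ((extChartAt 𝓘(ℝ, E) (1 : G)).symm z))
      (extChartAt 𝓘(ℝ, E) (1 : G) (f p)) := by
    rw [hp]
    exact (contDiffAt_adE (1 : G)).differentiableAt (by simp)
  rw [hev.fderiv_eq, fderiv_comp p ha hc, hp]
  exact fderiv_adE_one _ _

/-- Since Ad_y = Ad_x Ad_{x⁻¹ y}, the derivative at x reduces to the one at the identity, and the
derivative of x⁻¹ y is the left Maurer-Cartan form. -/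
theorem fderiv_adE (x : G) (u v : E) :
    fderiv ℝ (fun y => adE E ((extChartAt 𝓘(ℝ, E) x).symm y)) (extChartAt 𝓘(ℝ, E) x x) u v =
      adE E x (bracketE E G (coframeInChart E x (extChartAt 𝓘(ℝ, E) x x) u) v) := by
  have hx : x⁻¹ * (extChartAt 𝓘(ℝ, E) x).symm (extChartAt 𝓘(ℝ, E) x x) = 1 := by simp
  have hf : ContMDiffAt 𝓘(ℝ, E) 𝓘(ℝ, E) ∞ (fun y => x⁻¹ * (extChartAt 𝓘(ℝ, E) x).symm y)
      (extChartAt 𝓘(ℝ, E) x x) := contMDiffAt_const.mul (contMDiffAt_symm_comp contDiffAt_id rfl)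
  have hev : (fun y => adE E ((extChartAt 𝓘(ℝ, E) x).symm y)) =
      fun y => (adE E x).comp (adE E (x⁻¹ * (extChartAt 𝓘(ℝ, E) x).symm y)) := by
    ext y w
    change _ = adE E x (adE E _ w)
    rw [← adE_mul, mul_inv_cancel_left]
  have hd : DifferentiableAt ℝ (fun y => adE E (x⁻¹ * (extChartAt 𝓘(ℝ, E) x).symm y))
      (extChartAt 𝓘(ℝ, E) x x) := by
    have := (contDiffAt_adE (E := E) x).differentiableAt (by simp)
    have h2 := ((ContinuousLinearMap.compL ℝ E E E (adE E x⁻¹)).differentiableAt).comp _ this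
    refine h2.congr_of_eventuallyEq (Eventually.of_forall fun y => ?_)
    ext w
    exact adE_mul _ _ _
  rw [hev, ((hasFDerivAt_const (adE E x) _).clm_comp hd.hasFDerivAt).fderiv]
  simp only [ContinuousLinearMap.comp_zero, add_apply,
    ContinuousLinearMap.comp_apply, ContinuousLinearMap.compL_apply, zero_apply]
  rw [fderiv_adE_comp hf hx]
  have h3 := fderiv_in_charts_self (mdifferentiable_leftMul (E := E) x⁻¹ x) (b := 1)
    (by rw [inv_mul_cancel]; exact mem_chart_source _ _) u
  rw [h3, coframe_self, chartDeriv_of_eq (inv_mul_cancel x)]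
  simp
  rfl

/-- Differentiate Ad_{g h g⁻¹} = Ad_g Ad_h Ad_g⁻¹ in h at the identity and apply it to Ad_g v. -/
theorem adE_bracket (g : G) (u v : E) :
    adE E g (bracketE E G u v) = bracketE E G (adE E g u) (adE E g v) := by
  have hx : g * (extChartAt 𝓘(ℝ, E) (1 : G)).symm (extChartAt 𝓘(ℝ, E) (1 : G) 1) * g⁻¹ = 1 := by
    simp
  have hf : ContMDiffAt 𝓘(ℝ, E) 𝓘(ℝ, E) ∞ (fun y => g * (extChartAt 𝓘(ℝ, E) (1 : G)).symm y * g⁻¹)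
      (extChartAt 𝓘(ℝ, E) (1 : G) 1) :=
    (contMDiffAt_const.mul (contMDiffAt_symm_comp contDiffAt_id rfl)).mul contMDiffAt_const
  have h1 := fderiv_adE_comp hf hx u (adE E g v)
  have h2 := fderiv_in_charts_self (mdifferentiable_conj (E := E) g 1) (b := 1)
    (by simp) u
  rw [h2, chartDeriv_of_eq (by simp)] at h1
  have hev : (fun y => adE E (g * (extChartAt 𝓘(ℝ, E) (1 : G)).symm y * g⁻¹)) =
      fun y => ((adE E g).comp (adE E ((extChartAt 𝓘(ℝ, E) (1 : G)).symm y))).comp (adE E g⁻¹) := by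
    ext y w
    change _ = adE E g (adE E _ (adE E _ w))
    rw [← adE_mul, ← adE_mul, mul_assoc]
  have hd := ((contDiffAt_adE (E := E) (1 : G)).differentiableAt (by simp)).hasFDerivAt
  rw [hev, (((hasFDerivAt_const (adE E g) _).clm_comp hd).clm_comp
    (hasFDerivAt_const (adE E g⁻¹) _)).fderiv] at h1
  simp only [ContinuousLinearMap.comp_zero, zero_add, add_apply,
    ContinuousLinearMap.comp_apply, ContinuousLinearMap.compL_apply, zero_apply,
    ContinuousLinearMap.flip_apply, fderiv_adE_one] at h1
  rw [← adE_mul, inv_mul_cancel, adE_one, add_zero] at h1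
  exact h1

/-- The left-invariant coframe and frame, together with `Ad`, form a Maurer-Cartan frame. -/
theorem isMaurerCartanFrame (x : G) :
    IsMaurerCartanFrame (bracketE E G) (coframeInChart E x) (frameInChart E x)
      (fun y => adE E ((extChartAt 𝓘(ℝ, E) x).symm y)) (extChartAt 𝓘(ℝ, E) x x) where
  smooth_coframe := contDiffAt_coframe x
  smooth_frame := contDiffAt_frame x
  smooth_adjoint := contDiffAt_adE x
  frame_coframe := (eventually_mem_target x).mono fun _ hy v => frame_coframe hy v
  coframe_frame := (eventually_mem_target x).mono fun _ hy v => coframe_frame hy v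
  maurerCartan := fun u v => by
    set y := extChartAt 𝓘(ℝ, E) x x with hy
    have hθ := ((contDiffAt_coframe (E := E) x).differentiableAt (by simp)).hasFDerivAt
    have he := ((contDiffAt_frame (E := E) x).differentiableAt (by simp)).hasFDerivAt
    have hev : (fun z => (frameInChart E x z).comp (coframeInChart E x z)) =ᶠ[𝓝 y]
        fun _ => ContinuousLinearMap.id ℝ E := by
      filter_upwards [eventually_mem_target x] with z hz
      ext w
      exact frame_coframe hz w
    -- Differentiating e θ = 1 turns the bracket relation for the frame into the structure equation
    -- for the coframe.
    have h1 : ∀ u v, fderiv ℝ (frameInChart E x) y u (coframeInChart E x y v) =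
        - frameInChart E x y (fderiv ℝ (coframeInChart E x) y u v) := fun u v => by
      have h := (he.clm_comp hθ).fderiv.symm.trans (hev.fderiv_eq (𝕜 := ℝ))
      have h' := congrArg (fun L : E →L[ℝ] E →L[ℝ] E => L u v) h
      simp at h'
      exact eq_neg_of_add_eq_zero_right h'
    have hfc : ∀ v, frameInChart E x y (coframeInChart E x y v) = v :=
      fun v => frame_coframe (mem_extChartAt_target x) v
    have h2 := frame_bracket (E := E) x (coframeInChart E x y u) (coframeInChart E x y v)
    rw [← hy, hfc, hfc, h1, h1] at h2
    have h3 := congrArg (coframeInChart E x y) h2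
    simp only [map_sub, map_neg] at h3
    have hcf : ∀ v, coframeInChart E x y (frameInChart E x y v) = v :=
      fun v => coframe_frame (mem_extChartAt_target x) v
    rw [hcf, hcf, hcf] at h3
    rw [h3]
    abel
  fderiv_adjoint := fun u => by
    ext v
    rw [fderiv_adE, extChartAt_to_inv]
    rfl

/-- Invariance under `Ad` implies invariance under `ad`. -/
theorem isQuadraticLie_of_invariant {B : LinearMap.BilinForm ℝ E} (hs : B.IsSymm)
    (hB : B.Nondegenerate) (hinv : ∀ (g : G) (u v : E), B (adE E g u) (adE E g v) = B u v) :
    IsQuadraticLie B (bracketE E G) where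
  symm := fun x y => hs.eq x y
  nondegenerate := hB
  skew := bracketE_skew
  jacobi := bracketE_jacobi
  invariant := fun x u v => by
    let B' : E →L[ℝ] E →L[ℝ] ℝ := LinearMap.toContinuousBilinearMap B
    have hB' : ∀ u v, B' u v = B u v := fun _ _ => rfl
    have hd := ((contDiffAt_adE (E := E) (1 : G)).differentiableAt (by simp)).hasFDerivAt
    have h1 := hd.clm_apply (hasFDerivAt_const u _)
    have h2 := hd.clm_apply (hasFDerivAt_const v _)
    have h3 := B'.hasFDerivAt_of_bilinear h1 h2
    -- B (Ad_h u) (Ad_h v) is constant in h, while its derivative at 1 along x is B [x, u] v + B u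
    -- [x, v].
    have h4 : (fun y => B' (adE E ((extChartAt 𝓘(ℝ, E) (1 : G)).symm y) u)
        (adE E ((extChartAt 𝓘(ℝ, E) (1 : G)).symm y) v)) = fun _ => B u v :=
      funext fun y => hinv _ u v
    have h5 := h3.fderiv
    rw [h4, fderiv_fun_const] at h5
    have h6 := congrArg (fun L : E →L[ℝ] ℝ => L x) h5
    simp only [Pi.zero_apply, zero_apply, add_apply, ContinuousLinearMap.precompR_apply,
      ContinuousLinearMap.compL_apply, ContinuousLinearMap.comp_apply,
      ContinuousLinearMap.precompL_apply, ContinuousLinearMap.comp_zero, zero_add,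
      ContinuousLinearMap.flip_apply, fderiv_adE_one, extChartAt_to_inv, adE_one, hB'] at h6
    linarith

end AdjointFrame

/-! ### The set G₀. -/

section RegularSet

open Filter Topology

variable {E : Type*} [NormedAddCommGroup E] [NormedSpace ℝ E] [FiniteDimensional ℝ E]

theorem not_hasEigenvalue_neg_one_iff (A : E →L[ℝ] E) :
    ¬ Module.End.HasEigenvalue (A : E →ₗ[ℝ] E) (-1) ↔ LinearMap.det ((A : E →ₗ[ℝ] E) + 1) ≠ 0 := by
  have h : (A : E →ₗ[ℝ] E) + 1 = -(algebraMap ℝ (Module.End ℝ E) (-1) - (A : E →ₗ[ℝ] E)) := by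
    rw [map_neg, map_one]
    abel
  rw [Module.End.hasEigenvalue_iff_mem_spectrum, spectrum.mem_iff, not_not, ← isUnit_iff_ne_zero,
    ← LinearMap.isUnit_iff_isUnit_det, h, IsUnit.neg_iff]

theorem isUnit_iff_det_ne_zero (A : E →L[ℝ] E) : IsUnit A ↔ LinearMap.det (A : E →ₗ[ℝ] E) ≠ 0 := by
  have : CompleteSpace E := FiniteDimensional.complete ℝ E
  rw [ContinuousLinearMap.isUnit_iff_bijective, ← isUnit_iff_ne_zero,
    ← LinearMap.isUnit_iff_isUnit_det,
    Module.End.isUnit_iff]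
  rfl

variable {G : Type*} [TopologicalSpace G] [ChartedSpace E G] [Group G]

theorem mem_regularSet_iff_det {g : G} :
    g ∈ regularSet E G ↔ LinearMap.det ((adE E g : E →ₗ[ℝ] E) + 1) ≠ 0 :=
  not_hasEigenvalue_neg_one_iff (adE E g)

theorem mem_regularSet_iff_isUnit {g : G} : g ∈ regularSet E G ↔ IsUnit (adE E g + 1) := by
  rw [mem_regularSet_iff_det, isUnit_iff_det_ne_zero]
  rfl

variable [LieGroup 𝓘(ℝ, E) ∞ G]

omit [FiniteDimensional ℝ E] in
theorem continuous_adE : Continuous (adE E : G → E →L[ℝ] E) := by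
  refine continuous_iff_continuousAt.2 fun x => ?_
  have h1 := (contDiffAt_adE (E := E) x).continuousAt
  have h2 : ContinuousAt (extChartAt 𝓘(ℝ, E) x) x := continuousAt_extChartAt x
  refine (ContinuousAt.comp (f := extChartAt 𝓘(ℝ, E) x) h1 h2).congr ?_
  filter_upwards [extChartAt_source_mem_nhds (I := 𝓘(ℝ, E)) x] with g hg
  simp only [Function.comp]
  rw [(extChartAt 𝓘(ℝ, E) x).left_inv hg]

theorem isOpen_regularSet : IsOpen (regularSet E G) := by
  have : CompleteSpace E := FiniteDimensional.complete ℝ E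
  have h : regularSet E G = (fun g => adE E g + 1) ⁻¹' {A | IsUnit A} :=
    Set.ext fun g => mem_regularSet_iff_isUnit
  rw [h]
  exact Units.isOpen.preimage (continuous_adE.add continuous_const)

theorem dense_regularSet [ConnectedSpace G] : Dense (regularSet E G) := by
  have : IsTopologicalGroup G := topologicalGroup_of_lieGroup 𝓘(ℝ, E) ∞
  let b := Module.finBasis ℝ E
  have h := dense_det_one_add_ne_zero (G := G) (fun g => LinearMap.toMatrix b b (adE E g : E →ₗ[ℝ] E))
    (fun g g' => by
      rw [← LinearMap.toMatrix_mul]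
      congr 1
      ext v
      exact adE_mul g g' v)
    (by
      rw [← LinearMap.toMatrix_one b]
      congr 1
      ext v
      exact adE_one v)
  refine h.mono fun g hg => mem_regularSet_iff_det.2 ?_
  rw [Set.mem_ofPred_eq, ← LinearMap.toMatrix_one b, ← map_add, LinearMap.det_toMatrix] at hg
  exact hg

omit [FiniteDimensional ℝ E] in
theorem isUnit_adE (g : G) : IsUnit (adE E g) := by
  refine ⟨⟨adE E g, adE E g⁻¹, ?_, ?_⟩, rfl⟩ <;> ext v
  · exact (adE_mul _ _ v).symm.trans (by rw [mul_inv_cancel, adE_one]; rfl)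
  · exact (adE_mul _ _ v).symm.trans (by rw [inv_mul_cancel, adE_one]; rfl)

theorem det_adE {B : LinearMap.BilinForm ℝ E} (hB : B.Nondegenerate)
    (hinv : ∀ (g : G) (u v : E), B (adE E g u) (adE E g v) = B u v) {g : G}
    (hg : g ∈ regularSet E G) : LinearMap.det (adE E g : E →ₗ[ℝ] E) = 1 := by
  refine det_eq_one_of_isometry hB (hinv g) (mem_regularSet_iff_det.1 hg) ?_
  rw [LinearMap.isUnit_iff_isUnit_det, isUnit_iff_ne_zero, ← isUnit_iff_det_ne_zero]
  exact isUnit_adE g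

end RegularSet

/-! ### The Cartan form on the Lie algebra. -/

section InvariantTensors

variable {E : Type*} [NormedAddCommGroup E] [NormedSpace ℝ E] [FiniteDimensional ℝ E]
  {B : LinearMap.BilinForm ℝ E} {br : E →L[ℝ] E →L[ℝ] E}

/-- The alternating form `(x, y, z) ↦ (1/2) B x [y, z]`. -/
noncomputable def IsQuadraticLie.cartanForm (hq : IsQuadraticLie B br) : E [⋀^Fin 3]→L[ℝ] ℝ where
  toFun m := (1 / 2) * B (m 0) (br (m 1) (m 2))
  map_update_add' := by
    intro inst m i x y
    obtain rfl : inst = instDecidableEqFin 3 := Subsingleton.elim _ _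
    fin_cases i <;> simp [Function.update] <;> ring
  map_update_smul' := by
    intro inst m i c x
    obtain rfl : inst = instDecidableEqFin 3 := Subsingleton.elim _ _
    fin_cases i <;> simp [Function.update] <;> ring
  map_eq_zero_of_eq' m i j h hij := by
    have h0 : ∀ x, br x x = 0 := fun x => by
      have := hq.skew x x
      rwa [eq_neg_iff_add_eq_zero, ← two_smul ℝ, smul_eq_zero_iff_right two_ne_zero] at this
    have h1 : ∀ x y, B x (br x y) = 0 := fun x y => by rw [hq.cyclic, hq.cyclic, h0, map_zero]
    have h2 : ∀ x y, B x (br y x) = 0 := fun x y => by rw [hq.antisymm, h1, neg_zero]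
    fin_cases i <;> fin_cases j <;> simp at h hij ⊢ <;> simp [h, h0, h1, h2]
  cont := by
    have hB : Continuous fun p : E × E => B p.1 p.2 :=
      (LinearMap.toContinuousBilinearMap B).continuous₂
    have h : Continuous fun m : Fin 3 → E => (m 0, br (m 1) (m 2)) := by fun_prop
    exact continuous_const.mul (hB.comp h)

theorem IsQuadraticLie.cartanForm_apply (hq : IsQuadraticLie B br) (x y z : E) :
    hq.cartanForm ![x, y, z] = (1 / 2) * B x (br y z) := rfl

end InvariantTensors

/-! ### Existence and uniqueness of the bivector; invariance of the Cartan form. -/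

section SeveraWeinstein

open Filter Topology

variable {E : Type*} [NormedAddCommGroup E] [NormedSpace ℝ E] [FiniteDimensional ℝ E]
  {G : Type*} [TopologicalSpace G] [ChartedSpace E G] [Group G]
  {B : LinearMap.BilinForm ℝ E}

variable (E) in
/-- The value at `g` of the left-invariant frame. -/
noncomputable def leftFrame (g : G) : E →L[ℝ] E :=
  mfderiv 𝓘(ℝ, E) 𝓘(ℝ, E) (fun h : G => g * h) 1

variable (E) in
/-- The value at `g` of the right-invariant frame. -/
noncomputable def rightFrame (g : G) : E →L[ℝ] E :=
  mfderiv 𝓘(ℝ, E) 𝓘(ℝ, E) (fun h : G => h * g) 1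

/-- The Ševera-Weinstein bivector: twice the Cayley transform of `Ad`, left-translated. -/
noncomputable def severaWeinstein (hB : B.Nondegenerate) (g : G) : Bivector E :=
  bivectorOf (frameSharp hB (leftFrame E g) (twoCayley (adE E g)))

theorem sharp_severaWeinstein (hB : B.Nondegenerate) (hs : ∀ x y, B x y = B y x)
    (hinv : ∀ (g : G) (u v : E), B (adE E g u) (adE E g v) = B u v) {g : G}
    (hg : g ∈ regularSet E G) (α : E →L[ℝ] ℝ) :
    sharp (severaWeinstein hB g) α =
      leftFrame E g (twoCayley (adE E g) (raise hB (α.comp (leftFrame E g)))) :=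
  sharp_bivectorOf (frameSharp_skew hB hs _ (twoCayley_skew (mem_regularSet_iff_isUnit.1 hg)
    (hinv g))) α

variable [LieGroup 𝓘(ℝ, E) ∞ G]

omit [FiniteDimensional ℝ E] in
theorem adE_adE_inv (g : G) (v : E) : adE E g (adE E g⁻¹ v) = v := by
  rw [← adE_mul, mul_inv_cancel, adE_one]

/-- Write X = Ad_g Y. By invariance α^L + α^R raises to Ad_g Y + Y in the left frame, which K sends
to 2 (Ad_g Y - Y); and X^R is Y^L at g. -/
theorem sharp_severaWeinstein_of_eq (hB : B.Nondegenerate) (hs : ∀ x y, B x y = B y x)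
    (hinv : ∀ (g : G) (u v : E), B (adE E g u) (adE E g v) = B u v) {g : G}
    (hg : g ∈ regularSet E G) (X : E) {α : E →L[ℝ] ℝ}
    (hα : ∀ v, α (leftFrame E g v) = B X v + B X (adE E g v)) :
    sharp (severaWeinstein hB g) α = (2 : ℝ) • (leftFrame E g X -
      rightFrame E g X) := by
  obtain ⟨Y, rfl⟩ : ∃ Y, adE E g Y = X := ⟨_, adE_adE_inv g X⟩
  have h : rightFrame E g (adE E g Y) = leftFrame E g Y := mul_right_adE g Y
  rw [sharp_severaWeinstein hB hs hinv hg, h,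
    raise_eq hB (x := adE E g Y + Y), twoCayley_apply (mem_regularSet_iff_isUnit.1 hg), map_smul,
    map_sub]
  · intro v
    rw [ContinuousLinearMap.comp_apply, hα, hinv, map_add, LinearMap.add_apply]

omit [LieGroup 𝓘(ℝ, E) ∞ G] in
-- On G₀ the map Ad_g + 1 is onto, so the defining relation prescribes π♯ on all covectors; this is
-- the uniqueness of π.
theorem exists_covector_eq (hB : B.Nondegenerate)
    (hinv : ∀ (g : G) (u v : E), B (adE E g u) (adE E g v) = B u v) {g : G}
    (hg : g ∈ regularSet E G) (α : E →L[ℝ] ℝ) :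
    ∃ X, ∀ v, α (leftFrame E g v) = B X v + B X (adE E g v) := by
  obtain ⟨Y, hY⟩ := surjective_add_one (mem_regularSet_iff_isUnit.1 hg)
    (raise hB (α.comp (leftFrame E g)))
  refine ⟨adE E g Y, fun v => ?_⟩
  have := apply_raise hB (α.comp (leftFrame E g)) v
  rw [← hY, map_add, LinearMap.add_apply] at this
  rw [hinv, this]
  rfl

/-- The covector `α^L + α^R`, evaluated on a left-invariant vector. -/
theorem lower_add_apply (B : LinearMap.BilinForm ℝ (GroupLieAlgebra 𝓘(ℝ, E) G)) (g : G) (X : E)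
    (v : E) : ((lower B X).comp (leftToOne g) + (lower B X).comp (rightToOne g) :
      TangentSpace 𝓘(ℝ, E) g →L[ℝ] ℝ) (leftFrame E g v) = B X v + B X (adE E g v) := by
  have h1 : (leftToOne (E := E) g : E →L[ℝ] E) (leftFrame E g v) = v := leftToOne_leftField g v
  have h2 : (rightToOne (E := E) g : E →L[ℝ] E) (leftFrame E g v) = adE E g v := by
    rw [rightToOne_eq, h1]
  exact congrArg₂ (fun a b : E => B X a + B X b) h1 h2

theorem isSeveraWeinsteinBivector_severaWeinstein
    {B : LinearMap.BilinForm ℝ (GroupLieAlgebra 𝓘(ℝ, E) G)} (hB : B.Nondegenerate)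
    (hs : ∀ x y, B x y = B y x)
    (hinv : ∀ (g : G) (X Y : GroupLieAlgebra 𝓘(ℝ, E) G), B (Ad g X) (Ad g Y) = B X Y) :
    IsSeveraWeinsteinBivector B (severaWeinstein (E := E) (G := G) hB) := fun g hg X =>
  sharp_severaWeinstein_of_eq (E := E) hB hs hinv hg X (lower_add_apply B g X)

theorem eq_severaWeinstein
    {B : LinearMap.BilinForm ℝ (GroupLieAlgebra 𝓘(ℝ, E) G)} (hB : B.Nondegenerate)
    (hs : ∀ x y, B x y = B y x)
    (hinv : ∀ (g : G) (X Y : GroupLieAlgebra 𝓘(ℝ, E) G), B (Ad g X) (Ad g Y) = B X Y)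
    {π : BivectorField E G} (hπ : IsSeveraWeinsteinBivector B π) {g : G} (hg : g ∈ regularSet E G) :
    π g = severaWeinstein (E := E) (G := G) hB g := by
  refine bivector_eq_of_sharp_eq (W := E) (P := π g) (Q := severaWeinstein (E := E) (G := G) hB g)
    fun α => ?_
  obtain ⟨X, hX⟩ := exists_covector_eq (E := E) hB hinv hg α
  have hα : α = ((lower B X).comp (leftToOne g) + (lower B X).comp (rightToOne g) :
      TangentSpace 𝓘(ℝ, E) g →L[ℝ] ℝ) := by
    refine ContinuousLinearMap.ext fun w => ?_
    have hw : leftFrame E g ((leftToOne (E := E) g : E →L[ℝ] E) w) = w := leftField_leftToOne g w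
    have h1 := (hX ((leftToOne (E := E) g : E →L[ℝ] E) w)).trans
      (lower_add_apply B g X ((leftToOne (E := E) g : E →L[ℝ] E) w)).symm
    rw [hw] at h1
    exact h1
  have h2 := hπ g hg X
  have h3 := isSeveraWeinsteinBivector_severaWeinstein hB hs hinv g hg X
  rw [hα]
  exact h2.trans h3.symm

/-- The right trivialisation is Ad_g after the left one, and Ad_g preserves both the form and the
bracket. -/
theorem isCartanForm_leftForm
    {B : LinearMap.BilinForm ℝ (GroupLieAlgebra 𝓘(ℝ, E) G)}
    (hq : IsQuadraticLie (W := E) B (bracketE E G))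
    (hinv : ∀ (g : G) (X Y : GroupLieAlgebra 𝓘(ℝ, E) G), B (Ad g X) (Ad g Y) = B X Y) :
    IsCartanForm B (leftForm (E := E) (G := G) hq.cartanForm) := by
  refine ⟨hq.cartanForm, fun X Y Z => rfl, rfl, ?_⟩
  funext g
  refine ContinuousAlternatingMap.ext fun v => ?_
  have h : ∀ a b c : E, B a (bracketE E G b c) =
      B (adE E g a) (bracketE E G (adE E g b) (adE E g c)) := fun a b c => by
    rw [← adE_bracket]
    exact (hinv g _ _).symm
  have h1 : ∀ i, (rightToOne (E := E) g : E →L[ℝ] E) (v i) =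
      adE E g ((leftToOne (E := E) g : E →L[ℝ] E) (v i)) := fun i => rightToOne_eq (E := E) g (v i)
  refine (congrArg ((1 / 2 : ℝ) * ·) (h _ _ _)).trans ?_
  change _ = (1 / 2 : ℝ) * B ((rightToOne (E := E) g : E →L[ℝ] E) (v 0))
    (bracketE E G ((rightToOne (E := E) g : E →L[ℝ] E) (v 1))
      ((rightToOne (E := E) g : E →L[ℝ] E) (v 2)))
  rw [h1, h1, h1]
  rfl

end SeveraWeinstein

/-! ### The twisted Poisson structure. -/

section TwistedPoissonStructure

open Filter Topology

variable {E : Type*} [NormedAddCommGroup E] [NormedSpace ℝ E] [FiniteDimensional ℝ E]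
  {G : Type*} [TopologicalSpace G] [ChartedSpace E G] [Group G] [LieGroup 𝓘(ℝ, E) ∞ G]
  {B : LinearMap.BilinForm ℝ E}

omit [LieGroup 𝓘(ℝ, E) ∞ G] in
theorem severaWeinstein_inChart (hB : B.Nondegenerate) (x : G) :
    bivectorInChart (severaWeinstein (E := E) (G := G) hB) x = fun y =>
      bivectorOf (frameSharp hB (frameInChart E x y)
        (twoCayley (adE E ((extChartAt 𝓘(ℝ, E) x).symm y)))) :=
  funext fun y => bivectorOf_compContinuousLinearMap (W := E) (V := E)
    (frameSharp hB (leftFrame E _) (twoCayley (adE E ((extChartAt 𝓘(ℝ, E) x).symm y))))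
    (chartDeriv x ((extChartAt 𝓘(ℝ, E) x).symm y))

theorem severaWeinstein_inChart_self (hB : B.Nondegenerate) (x : G) :
    bivectorInChart (severaWeinstein (E := E) (G := G) hB) x (extChartAt 𝓘(ℝ, E) x x) =
      severaWeinstein (E := E) (G := G) hB x := by
  have h : frameInChart E x (extChartAt 𝓘(ℝ, E) x x) = leftFrame E x :=
    ContinuousLinearMap.ext fun v => frame_self x v
  rw [severaWeinstein_inChart]
  simp only [h, extChartAt_to_inv]
  rfl

/-- The Schouten bracket in the preferred chart at the point itself. -/
theorem halfSchouten_eq {M : Type*} [TopologicalSpace M] [ChartedSpace E M]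
    [IsManifold 𝓘(ℝ, E) ∞ M] {π : BivectorField E M} {x : M} {P : E → Bivector E}
    (hP : bivectorInChart π x = P) (a b c : E →L[ℝ] ℝ) :
    halfSchouten π x a b c =
      fderiv ℝ P (extChartAt 𝓘(ℝ, E) x x) (sharp (P (extChartAt 𝓘(ℝ, E) x x)) a) ![b, c]
        + fderiv ℝ P (extChartAt 𝓘(ℝ, E) x x) (sharp (P (extChartAt 𝓘(ℝ, E) x x)) b) ![c, a]
        + fderiv ℝ P (extChartAt 𝓘(ℝ, E) x x) (sharp (P (extChartAt 𝓘(ℝ, E) x x)) c) ![a, b] := by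
  subst hP
  have h : ∀ (D : E →L[ℝ] E) (Q : E → Bivector E) (y : E), D = ContinuousLinearMap.id ℝ E →
      fderiv ℝ Q y (sharp (Q y) (a.comp D)) ![b.comp D, c.comp D]
        + fderiv ℝ Q y (sharp (Q y) (b.comp D)) ![c.comp D, a.comp D]
        + fderiv ℝ Q y (sharp (Q y) (c.comp D)) ![a.comp D, b.comp D] =
      fderiv ℝ Q y (sharp (Q y) a) ![b, c] + fderiv ℝ Q y (sharp (Q y) b) ![c, a]
        + fderiv ℝ Q y (sharp (Q y) c) ![a, b] := by
    rintro _ Q y rfl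
    rfl
  exact h _ _ _ (chartSymmDeriv_self x)

theorem isTwistedPoissonOn_severaWeinstein (hq : IsQuadraticLie B (bracketE E G))
    (hinv : ∀ (g : G) (u v : E), B (adE E g u) (adE E g v) = B u v) :
    IsTwistedPoissonOn (severaWeinstein (E := E) (G := G) hq.nondegenerate)
      (leftForm (E := E) (G := G) hq.cartanForm) (regularSet E G) where
  isOpen := isOpen_regularSet
  smooth_bivector := fun x hx => by
    have : CompleteSpace E := FiniteDimensional.complete ℝ E
    rw [severaWeinstein_inChart]
    refine contDiffAt_bivectorOf (contDiffAt_frameSharp _ (contDiffAt_frame x) ?_)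
    refine ContDiffAt.comp (g := twoCayley) _ (contDiffAt_twoCayley ?_) (contDiffAt_adE x)
    rw [extChartAt_to_inv]
    exact mem_regularSet_iff_isUnit.1 hx
  smooth_form := fun x _ => contDiffAt_compContinuousLinearMap (W := E) (X := E) hq.cartanForm
    (contDiffAt_coframe (E := E) x)
  closed := fun x _ => by
    have h := extDeriv_cartan_eq_zero (isMaurerCartanFrame (E := E) x) hq hq.cartanForm_apply
    refine ContinuousAlternatingMap.ext fun v => ?_
    exact congrArg (fun η : E [⋀^Fin 4]→L[ℝ] ℝ => η fun i => (chartDeriv (E := E) x x : E →L[ℝ] E) (v i)) h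
  schouten := fun x hx α β γ => by
    have hu : IsUnit (adE E ((extChartAt 𝓘(ℝ, E) x).symm (extChartAt 𝓘(ℝ, E) x x)) + 1) := by
      rw [extChartAt_to_inv]
      exact mem_regularSet_iff_isUnit.1 hx
    have h := halfSchouten_frame (isMaurerCartanFrame (E := E) x) hq hu
      (Eventually.of_forall fun y => hinv _) (fun p q => adE_bracket _ p q)
      (severaWeinstein_inChart hq.nondegenerate x)
    have h2 : ∀ a b c : E →L[ℝ] ℝ, halfSchouten (severaWeinstein (E := E) (G := G)
        hq.nondegenerate) x a b c = (1 / 2) * B ((leftToOne (E := E) x : E →L[ℝ] E)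
        (sharp (severaWeinstein (E := E) (G := G) hq.nondegenerate x) a)) (bracketE E G
        ((leftToOne (E := E) x : E →L[ℝ] E)
          (sharp (severaWeinstein (E := E) (G := G) hq.nondegenerate x) b))
        ((leftToOne (E := E) x : E →L[ℝ] E)
          (sharp (severaWeinstein (E := E) (G := G) hq.nondegenerate x) c))) := fun a b c => by
      refine ((halfSchouten_eq rfl a b c).trans (h a b c)).trans ?_
      have h3 : ∀ (P Q : Bivector E) (L L' : E →L[ℝ] E), P = Q → L = L' →
          (1 / 2) * B (L (sharp P a)) (bracketE E G (L (sharp P b)) (L (sharp P c))) =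
          (1 / 2) * B (L' (sharp Q a)) (bracketE E G (L' (sharp Q b)) (L' (sharp Q c))) := by
        rintro _ _ _ _ rfl rfl
        rfl
      exact h3 _ _ _ _ (severaWeinstein_inChart_self hq.nondegenerate x)
        (ContinuousLinearMap.ext fun v => coframe_self x v)
    exact h2 α β γ

end TwistedPoissonStructure

/-! ### Tensor fields and Lie derivatives in charts. -/

section FieldsInCharts

open Filter Topology

variable {E : Type*} [NormedAddCommGroup E] [NormedSpace ℝ E]
  {M : Type*} [TopologicalSpace M] [ChartedSpace E M] [IsManifold 𝓘(ℝ, E) ∞ M]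

/-- A field of vectors in the preferred chart at `x`. -/
noncomputable def vectorInChart (X : VectorField E M) (x : M) (y : E) : E :=
  (chartDeriv (E := E) x ((extChartAt 𝓘(ℝ, E) x).symm y) : E →L[ℝ] E)
    (X ((extChartAt 𝓘(ℝ, E) x).symm y))

/-- A field of covectors in the preferred chart at `x`. -/
noncomputable def covectorInChart (α : CovectorField E M) (x : M) (y : E) : E →L[ℝ] ℝ :=
  ContinuousLinearMap.comp (α ((extChartAt 𝓘(ℝ, E) x).symm y) : E →L[ℝ] ℝ)
    (chartSymmDeriv (E := E) x y : E →L[ℝ] E)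

theorem vectorInChart_self (X : VectorField E M) (x : M) :
    vectorInChart X x (extChartAt 𝓘(ℝ, E) x x) = X x := by
  have h : ∀ g : M, g = x → (chartDeriv (E := E) x g : E →L[ℝ] E) (X g) = X x := by
    rintro _ rfl
    exact congrArg (fun L : E →L[ℝ] E => L _) (chartDeriv_self _)
  exact h _ (extChartAt_to_inv x)

theorem covectorInChart_self (α : CovectorField E M) (x : M) :
    covectorInChart α x (extChartAt 𝓘(ℝ, E) x x) = (α x : E →L[ℝ] ℝ) := by
  have h : ∀ (g : M) (D : E →L[ℝ] E), g = x → D = ContinuousLinearMap.id ℝ E →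
      ContinuousLinearMap.comp (α g : E →L[ℝ] ℝ) D = (α x : E →L[ℝ] ℝ) := by
    rintro _ _ rfl rfl
    exact ContinuousLinearMap.comp_id _
  exact h _ _ (extChartAt_to_inv x) (chartSymmDeriv_self x)

theorem formInChart_self {k : ℕ} (η : FormField E M k) (x : M) :
    formInChart η x (extChartAt 𝓘(ℝ, E) x x) = (η x : E [⋀^Fin k]→L[ℝ] ℝ) := by
  have h : ∀ (g : M) (D : E →L[ℝ] E), g = x → D = ContinuousLinearMap.id ℝ E →
      ContinuousAlternatingMap.compContinuousLinearMap (η g : E [⋀^Fin k]→L[ℝ] ℝ) D =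
        (η x : E [⋀^Fin k]→L[ℝ] ℝ) := by
    rintro _ _ rfl rfl
    exact ContinuousAlternatingMap.ext fun _ => rfl
  exact h _ _ (extChartAt_to_inv x) (chartSymmDeriv_self x)

theorem dForm_eq {k : ℕ} (η : FormField E M k) (x : M) :
    (dForm η x : E [⋀^Fin (k + 1)]→L[ℝ] ℝ) =
      extDeriv (formInChart η x) (extChartAt 𝓘(ℝ, E) x x) :=
  ContinuousAlternatingMap.ext fun v =>
    congrArg (extDeriv (formInChart η x) (extChartAt 𝓘(ℝ, E) x x))
      (funext fun i => congrArg (fun L : E →L[ℝ] E => L (v i)) (chartDeriv_self x))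

omit [IsManifold 𝓘(ℝ, E) ∞ M] in
theorem oneForm_inChart (α : CovectorField E M) (x : M) :
    formInChart (fun g => oneForm (α g)) x = fun y => oneForm (covectorInChart α x y) := rfl

theorem interiorProduct_inChart {k : ℕ} (X : VectorField E M) (η : FormField E M (k + 1)) {x : M}
    {y : E} (hy : y ∈ (extChartAt 𝓘(ℝ, E) x).target) :
    formInChart (fun g => interiorProduct (X g) (η g)) x y =
      interiorProduct (vectorInChart X x y) (formInChart η x y) := by
  refine ContinuousAlternatingMap.ext fun v => ?_
  have h := chartSymmDeriv_chartDeriv hy (X ((extChartAt 𝓘(ℝ, E) x).symm y))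
  refine congrArg (η ((extChartAt 𝓘(ℝ, E) x).symm y)) (funext fun i => ?_)
  refine Fin.cases ?_ (fun j => rfl) i
  exact h.symm

theorem lieDeriv_succ_eq {k : ℕ} (X : VectorField E M) (η : FormField E M (k + 1)) (x : M) :
    (lieDeriv X η x : E [⋀^Fin (k + 1)]→L[ℝ] ℝ) =
      interiorProduct (vectorInChart X x (extChartAt 𝓘(ℝ, E) x x))
        (extDeriv (formInChart η x) (extChartAt 𝓘(ℝ, E) x x)) +
      extDeriv (fun z => interiorProduct (vectorInChart X x z) (formInChart η x z))
        (extChartAt 𝓘(ℝ, E) x x) := by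
  have h1 : (dForm (fun g => interiorProduct (X g) (η g)) x : E [⋀^Fin (k + 1)]→L[ℝ] ℝ) =
      extDeriv (fun z => interiorProduct (vectorInChart X x z) (formInChart η x z))
        (extChartAt 𝓘(ℝ, E) x x) := by
    refine (dForm_eq _ x).trans (EventuallyEq.extDeriv_eq ?_)
    filter_upwards [eventually_mem_target x] with y hy using interiorProduct_inChart X η hy
  rw [← h1, ← dForm_eq, vectorInChart_self]
  rfl

omit [IsManifold 𝓘(ℝ, E) ∞ M] in
theorem contDiffAt_covectorInChart {α : CovectorField E M} {x : M}
    (h : ContDiffAt ℝ ∞ (formInChart (fun g => oneForm (α g)) x) (extChartAt 𝓘(ℝ, E) x x)) :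
    ContDiffAt ℝ ∞ (covectorInChart α x) (extChartAt 𝓘(ℝ, E) x x) := by
  have h1 := (ContinuousLinearMap.contDiff (n := ∞) (ContinuousAlternatingMap.ofSubsingletonLIE (𝕜 := ℝ)
    (E := E) (F := ℝ) (0 : Fin 1)).symm.toContinuousLinearEquiv.toContinuousLinearMap).contDiffAt.comp
      (extChartAt 𝓘(ℝ, E) x x) h
  refine h1.congr_of_eventuallyEq (Eventually.of_forall fun y => ?_)
  rw [oneForm_inChart]
  exact ((ContinuousAlternatingMap.ofSubsingletonLIE (𝕜 := ℝ)
    (E := E) (F := ℝ) (0 : Fin 1)).symm_apply_apply (covectorInChart α x y)).symm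

omit [IsManifold 𝓘(ℝ, E) ∞ M] in
theorem eventuallyEq_comp_chart {F : Type*} (f : M → F) (x : M) :
    f =ᶠ[𝓝 x] (fun y => f ((extChartAt 𝓘(ℝ, E) x).symm y)) ∘ extChartAt 𝓘(ℝ, E) x := by
  filter_upwards [extChartAt_source_mem_nhds (I := 𝓘(ℝ, E)) x] with g hg
  simp only [Function.comp]
  rw [(extChartAt 𝓘(ℝ, E) x).left_inv hg]

omit [IsManifold 𝓘(ℝ, E) ∞ M] in
theorem contMDiffAt_of_chart {F : Type*} [NormedAddCommGroup F] [NormedSpace ℝ F] {f : M → F} {x : M}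
    (h : ContDiffAt ℝ ∞ (fun y => f ((extChartAt 𝓘(ℝ, E) x).symm y)) (extChartAt 𝓘(ℝ, E) x x)) :
    ContMDiffAt 𝓘(ℝ, E) 𝓘(ℝ, F) ∞ f x :=
  (h.contMDiffAt.comp x contMDiffAt_extChartAt).congr_of_eventuallyEq (eventuallyEq_comp_chart f x)

theorem dFun_eq {f : M → ℝ} {x : M}
    (h : DifferentiableAt ℝ (fun y => f ((extChartAt 𝓘(ℝ, E) x).symm y)) (extChartAt 𝓘(ℝ, E) x x)) :
    (dFun (E := E) f x : E →L[ℝ] ℝ) =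
      fderiv ℝ (fun y => f ((extChartAt 𝓘(ℝ, E) x).symm y)) (extChartAt 𝓘(ℝ, E) x x) := by
  have h1 := (eventuallyEq_comp_chart (E := E) f x).mfderiv_eq (I := 𝓘(ℝ, E)) (I' := 𝓘(ℝ, ℝ))
  have h2 := mfderiv_comp x h.mdifferentiableAt
    (mdifferentiableAt_extChartAt (I := 𝓘(ℝ, E)) (mem_chart_source E x))
  refine h1.trans (h2.trans ?_)
  rw [mfderiv_eq_fderiv]
  have h3 : ∀ (L : E →L[ℝ] ℝ) (D : E →L[ℝ] E), D = ContinuousLinearMap.id ℝ E → L.comp D = L := by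
    rintro L _ rfl
    exact L.comp_id
  exact h3 _ _ (chartDeriv_self x)

end FieldsInCharts

/-! ### Volume forms and their densities. -/

section TopForms

open Filter Topology

variable {E : Type*} [NormedAddCommGroup E] [NormedSpace ℝ E] [FiniteDimensional ℝ E]

/-- The volume form of a basis. -/
noncomputable def basisVolume {k : ℕ} (b : Module.Basis (Fin k) ℝ E) : E [⋀^Fin k]→L[ℝ] ℝ :=
  { b.det with
    cont := by
      have h : Continuous fun v : Fin k → E => (b.toMatrix v).det := by
        refine Continuous.matrix_det (continuous_matrix fun i j => ?_)
        exact (LinearMap.continuous_of_finiteDimensional (b.coord i)).comp (continuous_apply j)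
      exact h }

theorem basisVolume_self {k : ℕ} (b : Module.Basis (Fin k) ℝ E) : basisVolume b b = 1 :=
  b.det_self

theorem eq_smul_basisVolume {k : ℕ} (b : Module.Basis (Fin k) ℝ E) (η : E [⋀^Fin k]→L[ℝ] ℝ) :
    η = η b • basisVolume b :=
  ContinuousAlternatingMap.ext fun v =>
    congrArg (fun f : E [⋀^Fin k]→ₗ[ℝ] ℝ => f v) (η.toAlternatingMap.eq_smul_basis_det b)

theorem basisVolume_comp {k : ℕ} (b : Module.Basis (Fin k) ℝ E) (A : E →L[ℝ] E) :
    (basisVolume b).compContinuousLinearMap A = LinearMap.det (A : E →ₗ[ℝ] E) • basisVolume b :=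
  ContinuousAlternatingMap.ext fun v => b.det_comp (A : E →ₗ[ℝ] E) v

variable {G : Type*} [TopologicalSpace G] [ChartedSpace E G] [Group G]

/-- The density of a top form with respect to the left-invariant volume form of a basis. -/
noncomputable def volumeDensity {k : ℕ} (b : Module.Basis (Fin k) ℝ E) (vol : FormField E G k) (g : G) :
    ℝ :=
  (vol g : E [⋀^Fin k]→L[ℝ] ℝ) fun i => leftFrame E g (b i)

variable [LieGroup 𝓘(ℝ, E) ∞ G]

theorem eq_volumeDensity_smul {k : ℕ} (b : Module.Basis (Fin k) ℝ E) (vol : FormField E G k) (g : G) :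
    (vol g : E [⋀^Fin k]→L[ℝ] ℝ) = volumeDensity b vol g •
      (basisVolume b).compContinuousLinearMap (leftToOne (E := E) g : E →L[ℝ] E) := by
  have h := eq_smul_basisVolume b (ContinuousAlternatingMap.compContinuousLinearMap
    (vol g : E [⋀^Fin k]→L[ℝ] ℝ) (leftFrame E g))
  refine ContinuousAlternatingMap.ext fun v => ?_
  have h1 : ∀ w, leftFrame E g ((leftToOne (E := E) g : E →L[ℝ] E) w) = w :=
    fun w => leftField_leftToOne (E := E) g w
  have h2 := congrArg (fun f : E [⋀^Fin k]→L[ℝ] ℝ =>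
    f fun i => (leftToOne (E := E) g : E →L[ℝ] E) (v i)) h
  refine Eq.trans ?_ h2
  exact congrArg (vol g : E [⋀^Fin k]→L[ℝ] ℝ) (funext fun i => (h1 (v i)).symm)

theorem topForm_inChart {k : ℕ} (b : Module.Basis (Fin k) ℝ E) (vol : FormField E G k) (x : G) :
    formInChart vol x = fun y => volumeDensity b vol ((extChartAt 𝓘(ℝ, E) x).symm y) •
      (basisVolume b).compContinuousLinearMap (coframeInChart E x y) :=
  funext fun y => congrArg (fun f : E [⋀^Fin k]→L[ℝ] ℝ => f.compContinuousLinearMap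
    (chartSymmDeriv (E := E) x y : E →L[ℝ] E))
      (eq_volumeDensity_smul b vol ((extChartAt 𝓘(ℝ, E) x).symm y))

theorem volumeDensity_ne_zero {k : ℕ} (b : Module.Basis (Fin k) ℝ E) {vol : FormField E G k} {g : G}
    (h : vol g ≠ 0) : volumeDensity b vol g ≠ 0 := fun h0 => by
  refine h ((eq_volumeDensity_smul (E := E) b vol g).trans ?_)
  rw [h0]
  exact zero_smul ℝ _

/-- Evaluating the form and the left-invariant volume on one fixed tuple, the frame at the centre,
exhibits the density near the centre as a quotient of smooth functions. -/
theorem contDiffAt_volumeDensity {k : ℕ} (b : Module.Basis (Fin k) ℝ E) {vol : FormField E G k} {x : G}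
    (h : ContDiffAt ℝ ∞ (formInChart vol x) (extChartAt 𝓘(ℝ, E) x x)) :
    ContDiffAt ℝ ∞ (fun y => volumeDensity b vol ((extChartAt 𝓘(ℝ, E) x).symm y))
      (extChartAt 𝓘(ℝ, E) x x) := by
  set y₀ := extChartAt 𝓘(ℝ, E) x x with hy₀
  let w : Fin k → E := fun i => frameInChart E x y₀ (b i)
  let ev := ContinuousAlternatingMap.apply ℝ E ℝ w
  have h1 : ContDiffAt ℝ ∞ (fun y => formInChart vol x y w) y₀ := ev.contDiff.contDiffAt.comp y₀ h
  have h2 : ContDiffAt ℝ ∞ (fun y => (basisVolume b).compContinuousLinearMap (coframeInChart E x y) w)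
      y₀ :=
    ev.contDiff.contDiffAt.comp y₀
      (contDiffAt_compContinuousLinearMap (basisVolume b) (contDiffAt_coframe (E := E) x))
  have h3 : (basisVolume b).compContinuousLinearMap (coframeInChart E x y₀) w = 1 := by
    rw [← basisVolume_self b]
    exact congrArg (basisVolume b) (funext fun i => coframe_frame (mem_extChartAt_target x) _)
  have h4 : (basisVolume b).compContinuousLinearMap (coframeInChart E x y₀) w ≠ 0 := by
    rw [h3]
    exact one_ne_zero
  refine (h1.div h2 h4).congr_of_eventuallyEq ?_
  filter_upwards [h2.continuousAt.eventually_ne h4] with y hy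
  rw [topForm_inChart b]
  exact (mul_div_cancel_right₀ _ hy).symm

end TopForms

/-! ### The modular field. -/

section Modular

open Filter Topology

variable {E : Type*} [NormedAddCommGroup E] [NormedSpace ℝ E] [FiniteDimensional ℝ E]
  {G : Type*} [TopologicalSpace G] [ChartedSpace E G] [Group G] [LieGroup 𝓘(ℝ, E) ∞ G]
  {B : LinearMap.BilinForm ℝ E}

theorem sharp_severaWeinstein_frame (hB : B.Nondegenerate) (hs : ∀ x y, B x y = B y x)
    (hinv : ∀ (g : G) (u v : E), B (adE E g u) (adE E g v) = B u v) {x : G}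
    (hx : x ∈ regularSet E G) (α : E →L[ℝ] ℝ) :
    sharp (severaWeinstein hB x) α =
      frameSharp hB (frameInChart E x (extChartAt 𝓘(ℝ, E) x x))
        (twoCayley (adE E ((extChartAt 𝓘(ℝ, E) x).symm (extChartAt 𝓘(ℝ, E) x x)))) α := by
  have h : frameInChart E x (extChartAt 𝓘(ℝ, E) x x) = leftFrame E x :=
    ContinuousLinearMap.ext fun v => frame_self x v
  rw [sharp_severaWeinstein hB hs hinv hx, extChartAt_to_inv, h]
  rfl

omit [LieGroup 𝓘(ℝ, E) ∞ G] in
theorem apply_neg_sharp_severaWeinstein (hB : B.Nondegenerate) (hs : ∀ x y, B x y = B y x)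
    (hinv : ∀ (g : G) (u v : E), B (adE E g u) (adE E g v) = B u v) {x : G}
    (hx : x ∈ regularSet E G) (α β : E →L[ℝ] ℝ) :
    α (-sharp (severaWeinstein hB x) β) = β (sharp (severaWeinstein hB x) α) := by
  have h := frameSharp_skew hB hs (leftFrame E x)
    (twoCayley_skew (mem_regularSet_iff_isUnit.1 hx) (hinv x)) β α
  have h1 := sharp_severaWeinstein hB hs hinv hx
  rw [map_neg, h1, h1]
  exact neg_eq_iff_eq_neg.2 h

/-- `⟨α, π♯ (i_π ψ)⟩` for the Cartan form `ψ`. -/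
theorem apply_twistField (hq : IsQuadraticLie B (bracketE E G))
    (hinv : ∀ (g : G) (u v : E), B (adE E g u) (adE E g v) = B u v) {x : G}
    (hx : x ∈ regularSet E G) (α : E →L[ℝ] ℝ) (s : E)
    (hs : s = raise hq.nondegenerate (α.comp (frameInChart E x (extChartAt 𝓘(ℝ, E) x x)))) :
    α (twistField (severaWeinstein (E := E) (G := G) hq.nondegenerate)
      (leftForm (E := E) (G := G) hq.cartanForm) x) =
      - ((1 / 4) * LinearMap.trace ℝ E ((twoCayley (adE E ((extChartAt 𝓘(ℝ, E) x).symm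
        (extChartAt 𝓘(ℝ, E) x x)))).comp (bracketE E G (twoCayley (adE E
          ((extChartAt 𝓘(ℝ, E) x).symm (extChartAt 𝓘(ℝ, E) x x))) s)) : E →ₗ[ℝ] E)) := by
  have hF := isMaurerCartanFrame (E := E) x
  have hP := sharp_severaWeinstein_frame hq.nondegenerate hq.symm hinv hx
  have hη : (hq.cartanForm).compContinuousLinearMap (coframeInChart E x (extChartAt 𝓘(ℝ, E) x x)) =
      (leftForm (E := E) (G := G) hq.cartanForm x : E [⋀^Fin 3]→L[ℝ] ℝ) :=
    formInChart_self (leftForm (E := E) (G := G) hq.cartanForm) x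
  have h1 := contractThree_frame hF hq hP hq.cartanForm_apply
    (sharp (severaWeinstein hq.nondegenerate x) α)
  rw [hη] at h1
  have hu : IsUnit (adE E ((extChartAt 𝓘(ℝ, E) x).symm (extChartAt 𝓘(ℝ, E) x x)) + 1) := by
    rw [extChartAt_to_inv]
    exact mem_regularSet_iff_isUnit.1 hx
  have h2 := frameSharp_skew hq.nondegenerate hq.symm (frameInChart E x (extChartAt 𝓘(ℝ, E) x x))
    (twoCayley_skew hu (hinv _)) (contractThree (severaWeinstein hq.nondegenerate x)
      (leftForm (E := E) (G := G) hq.cartanForm x : E [⋀^Fin 3]→L[ℝ] ℝ)) α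
  rw [← hP, ← hP, h1] at h2
  refine h2.trans ?_
  rw [hP, frameSharp_apply, ← hs, hF.coframe_frame.self_of_nhds]

theorem sharpField_inChart (hB : B.Nondegenerate) (hs : ∀ x y, B x y = B y x)
    (hinv : ∀ (g : G) (u v : E), B (adE E g u) (adE E g v) = B u v) (α : CovectorField E G) {x : G}
    (hx : x ∈ regularSet E G) :
    vectorInChart (sharpField (severaWeinstein (E := E) (G := G) hB) α) x
      =ᶠ[𝓝 (extChartAt 𝓘(ℝ, E) x x)] fun y => frameInChart E x y
        (twoCayley (adE E ((extChartAt 𝓘(ℝ, E) x).symm y))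
          (raise hB ((covectorInChart α x y).comp (frameInChart E x y)))) := by
  have h1 : ∀ᶠ y in 𝓝 (extChartAt 𝓘(ℝ, E) x x),
      (extChartAt 𝓘(ℝ, E) x).symm y ∈ regularSet E G :=
    (continuousAt_extChartAt_symm x).eventually_mem
      (isOpen_regularSet.mem_nhds (by rwa [extChartAt_to_inv]))
  filter_upwards [h1, eventually_mem_target x] with y hy hyt
  have h2 := sharp_severaWeinstein (E := E) hB hs hinv hy (α ((extChartAt 𝓘(ℝ, E) x).symm y) : E →L[ℝ] ℝ)
  have h3 : (covectorInChart α x y).comp (frameInChart E x y) = ContinuousLinearMap.comp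
      (α ((extChartAt 𝓘(ℝ, E) x).symm y) : E →L[ℝ] ℝ) (leftFrame E ((extChartAt 𝓘(ℝ, E) x).symm y)) :=
    ContinuousLinearMap.ext fun v =>
      congrArg (α ((extChartAt 𝓘(ℝ, E) x).symm y)) (chartSymmDeriv_chartDeriv hyt _)
  rw [h3]
  exact congrArg (fun v : E => (chartDeriv (E := E) x ((extChartAt 𝓘(ℝ, E) x).symm y) : E →L[ℝ] E) v) h2

/-- The Lie derivative of a top form along `π♯ α`. -/
theorem lieDeriv_sharpField (hq : IsQuadraticLie B (bracketE E G))
    (hinv : ∀ (g : G) (u v : E), B (adE E g u) (adE E g v) = B u v) {k : ℕ}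
    (hk : Module.finrank ℝ E = k + 1) (b : Module.Basis (Fin (k + 1)) ℝ E)
    {vol : FormField E G (k + 1)} {x : G} (hx : x ∈ regularSet E G)
    (hvol : ContDiffAt ℝ ∞ (formInChart vol x) (extChartAt 𝓘(ℝ, E) x x)) (hne : vol x ≠ 0)
    {α : CovectorField E G}
    (hα : ContDiffAt ℝ ∞ (formInChart (fun g => oneForm (α g)) x) (extChartAt 𝓘(ℝ, E) x x)) :
    (lieDeriv (sharpField (severaWeinstein (E := E) (G := G) hq.nondegenerate) α) vol x :
        E [⋀^Fin (k + 1)]→L[ℝ] ℝ) -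
      contract (severaWeinstein hq.nondegenerate x) (dCovector α x : E [⋀^Fin 2]→L[ℝ] ℝ) •
        (vol x : E [⋀^Fin (k + 1)]→L[ℝ] ℝ) =
    ((α x : E →L[ℝ] ℝ) (dPoisson (severaWeinstein (E := E) (G := G) hq.nondegenerate)
        (fun g => Real.log (volumeDensity b vol g)) x) -
      (α x : E →L[ℝ] ℝ) (twistField (severaWeinstein (E := E) (G := G) hq.nondegenerate)
        (leftForm (E := E) (G := G) hq.cartanForm) x)) • (vol x : E [⋀^Fin (k + 1)]→L[ℝ] ℝ) := by
  have : CompleteSpace E := FiniteDimensional.complete ℝ E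
  have hB := hq.nondegenerate
  have hF := isMaurerCartanFrame (E := E) x
  have hP := sharp_severaWeinstein_frame hq.nondegenerate hq.symm hinv hx
  have hx0 : (extChartAt 𝓘(ℝ, E) x).symm (extChartAt 𝓘(ℝ, E) x x) = x := extChartAt_to_inv x
  have hu : IsUnit (adE E ((extChartAt 𝓘(ℝ, E) x).symm (extChartAt 𝓘(ℝ, E) x x)) + 1) := by
    rw [hx0]
    exact mem_regularSet_iff_isUnit.1 hx
  have hαc := contDiffAt_covectorInChart hα
  have hh := contDiffAt_volumeDensity b hvol
  obtain ⟨s, hs⟩ : ∃ s : E → E, s = fun y =>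
    raise hB ((covectorInChart α x y).comp (frameInChart E x y)) := ⟨_, rfl⟩
  obtain ⟨K, hK⟩ : ∃ K : E → E →L[ℝ] E, K = fun y =>
    twoCayley (adE E ((extChartAt 𝓘(ℝ, E) x).symm y)) := ⟨_, rfl⟩
  have hXc : vectorInChart (sharpField (severaWeinstein (E := E) (G := G) hB) α) x
      =ᶠ[𝓝 (extChartAt 𝓘(ℝ, E) x x)] fun y => frameInChart E x y (K y (s y)) := by
    rw [hs, hK]
    exact sharpField_inChart hB hq.symm hinv α hx
  have hsd : ContDiffAt ℝ ∞ s (extChartAt 𝓘(ℝ, E) x x) := by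
    rw [hs]
    exact (raise hB).contDiff.contDiffAt.comp _ (hαc.clm_comp (contDiffAt_frame x))
  have hKd : ContDiffAt ℝ ∞ K (extChartAt 𝓘(ℝ, E) x x) := by
    rw [hK]
    exact ContDiffAt.comp (g := twoCayley) _ (contDiffAt_twoCayley hu) (contDiffAt_adE x)
  have hwd : DifferentiableAt ℝ (fun y => K y (s y)) (extChartAt 𝓘(ℝ, E) x x) :=
    (hKd.clm_apply hsd).differentiableAt (by simp)
  have hLie := lieDeriv_frame_volume hF hq hk (basisVolume b) (hh.differentiableAt (by simp)) hwd hXc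
    (Eventually.of_forall fun y => congrFun (topForm_inChart b vol x) y)
  have hdiv := trace_fderiv_sharp_sub_contract hF hq hu (hinv _) hP (hαc.differentiableAt (by simp)) hs
  have htw := apply_twistField hq hinv hx (α x : E →L[ℝ] ℝ) (s (extChartAt 𝓘(ℝ, E) x x))
    ((congrFun hs _).trans (congrArg (fun c : E →L[ℝ] ℝ => raise hB
      (c.comp (frameInChart E x (extChartAt 𝓘(ℝ, E) x x)))) (covectorInChart_self α x)))
  have hd : (dCovector α x : E [⋀^Fin 2]→L[ℝ] ℝ) =
      extDeriv (fun y => oneForm (covectorInChart α x y)) (extChartAt 𝓘(ℝ, E) x x) := dForm_eq _ x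
  have hne0 : volumeDensity b vol ((extChartAt 𝓘(ℝ, E) x).symm (extChartAt 𝓘(ℝ, E) x x)) ≠ 0 := by
    rw [hx0]
    exact volumeDensity_ne_zero b hne
  -- `Real.log` is the logarithm of the absolute value, so the density need only be nonzero and its
  -- sign may vary between components.
  have hlog := (hh.differentiableAt (by simp)).hasFDerivAt.log hne0
  have hX0 : vectorInChart (sharpField (severaWeinstein (E := E) (G := G) hB) α) x
      (extChartAt 𝓘(ℝ, E) x x) = sharp (severaWeinstein hB x) (α x : E →L[ℝ] ℝ) :=
    vectorInChart_self _ x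
  have hpo : (α x : E →L[ℝ] ℝ) (dPoisson (severaWeinstein (E := E) (G := G) hB)
      (fun g => Real.log (volumeDensity b vol g)) x) =
      (volumeDensity b vol ((extChartAt 𝓘(ℝ, E) x).symm (extChartAt 𝓘(ℝ, E) x x)))⁻¹ *
        fderiv ℝ (fun y => volumeDensity b vol ((extChartAt 𝓘(ℝ, E) x).symm y))
          (extChartAt 𝓘(ℝ, E) x x) (sharp (severaWeinstein hB x) (α x : E →L[ℝ] ℝ)) := by
    have h1 : (dFun (E := E) (fun g => Real.log (volumeDensity b vol g)) x : E →L[ℝ] ℝ) = _ :=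
      (dFun_eq hlog.differentiableAt).trans hlog.fderiv
    exact (apply_neg_sharp_severaWeinstein hB hq.symm hinv hx (α x : E →L[ℝ] ℝ) _).trans
      (congrArg (fun L : E →L[ℝ] ℝ => L (sharp (severaWeinstein hB x) (α x : E →L[ℝ] ℝ))) h1)
  have hvx : (vol x : E [⋀^Fin (k + 1)]→L[ℝ] ℝ) = _ := (formInChart_self vol x).symm
  have hvx' := congrFun (topForm_inChart b vol x) (extChartAt 𝓘(ℝ, E) x x)
  -- The final arithmetic of coefficients: division by the density h turns dh into the logarithmic
  -- derivative p, and tr - c is minus the twist term t. It is stated for forms on E so that tangent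
  -- spaces are identified with E only on application.
  have hfin : ∀ (Lie v v' η : E [⋀^Fin (k + 1)]→L[ℝ] ℝ) (p t c tr T h dh : ℝ), Lie = dh • η + tr • v →
      v' = v → v = h • η → h ≠ 0 → p = h⁻¹ * dh → t = - T → tr - c = T →
      Lie - c • v' = (p - t) • v' := by
    rintro _ _ _ η _ _ c tr _ h dh rfl rfl rfl hh rfl rfl rfl
    have : h⁻¹ * dh * h = dh := by field_simp
    rw [smul_smul, smul_smul, smul_smul, ← add_smul, ← sub_smul, sub_mul, this]
    congr 1
    ring
  refine hfin _ _ _ _ _ _ _ _ _ _ _ ((lieDeriv_succ_eq _ vol x).trans hLie) hvx hvx' hne0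
    (hpo.trans ?_) htw ?_
  · rw [hX0]
  · rw [hd, hK]
    exact hdiv

end Modular

/-! ### Unimodularity. -/

section Unimodular

open Filter Topology

variable {E : Type*} [NormedAddCommGroup E] [NormedSpace ℝ E] [FiniteDimensional ℝ E]
  {G : Type*} [TopologicalSpace G] [ChartedSpace E G] [Group G] [LieGroup 𝓘(ℝ, E) ∞ G]
  {B : LinearMap.BilinForm ℝ E}

theorem contract_eq_zero_of_subsingleton [Subsingleton E] (P : Bivector E)
    (η : E [⋀^Fin 2]→L[ℝ] ℝ) : contract P η = 0 := by
  have h : ∀ f : E →ₗ[ℝ] E, LinearMap.trace ℝ E f = 0 := fun f => by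
    rw [Subsingleton.elim f 0, map_zero]
  exact (congrArg ((1 / 2 : ℝ) * ·) (h _)).trans (mul_zero _)

/-- The divergence identity, in all dimensions. -/
theorem lieDeriv_sharpField_sub_contract (hq : IsQuadraticLie B (bracketE E G))
    (hinv : ∀ (g : G) (u v : E), B (adE E g u) (adE E g v) = B u v) {k : ℕ}
    (hk : Module.finrank ℝ E = k) (b : Module.Basis (Fin k) ℝ E)
    {vol : FormField E G k} {x : G} (hx : x ∈ regularSet E G)
    (hvol : ContDiffAt ℝ ∞ (formInChart vol x) (extChartAt 𝓘(ℝ, E) x x)) (hne : vol x ≠ 0)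
    {α : CovectorField E G}
    (hα : ContDiffAt ℝ ∞ (formInChart (fun g => oneForm (α g)) x) (extChartAt 𝓘(ℝ, E) x x)) :
    (lieDeriv (sharpField (severaWeinstein (E := E) (G := G) hq.nondegenerate) α) vol x :
        E [⋀^Fin k]→L[ℝ] ℝ) -
      contract (severaWeinstein hq.nondegenerate x) (dCovector α x : E [⋀^Fin 2]→L[ℝ] ℝ) •
        (vol x : E [⋀^Fin k]→L[ℝ] ℝ) =
    ((α x : E →L[ℝ] ℝ) (dPoisson (severaWeinstein (E := E) (G := G) hq.nondegenerate)
        (fun g => Real.log (volumeDensity b vol g)) x) -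
      (α x : E →L[ℝ] ℝ) (twistField (severaWeinstein (E := E) (G := G) hq.nondegenerate)
        (leftForm (E := E) (G := G) hq.cartanForm) x)) • (vol x : E [⋀^Fin k]→L[ℝ] ℝ) := by
  cases k with
  | succ k => exact lieDeriv_sharpField hq hinv hk b hx hvol hne hα
  | zero =>
    -- In degree zero `lieDeriv` takes its separate branch; on a trivial model space all four terms
    -- vanish.
    have hE : Subsingleton E := Module.finrank_zero_iff.1 hk
    have hfin : ∀ (L v : E [⋀^Fin 0]→L[ℝ] ℝ) (c p t : ℝ), L = 0 → c = 0 → p = 0 → t = 0 →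
        L - c • v = (p - t) • v := by
      rintro _ v _ _ _ rfl rfl rfl rfl
      simp
    have h0 : ∀ (L : E →L[ℝ] ℝ) (v : E), L v = 0 := fun L v => by
      rw [Subsingleton.elim v 0, map_zero]
    have h1 : ∀ (f : E [⋀^Fin 1]→L[ℝ] ℝ) (v : Fin 1 → E), f v = 0 := fun f v =>
      f.map_coord_zero 0 (Subsingleton.elim _ _)
    refine hfin _ _ _ _ _ (ContinuousAlternatingMap.ext fun m => ?_) ?_ (h0 _ _) (h0 _ _)
    · exact h1 (dForm vol x) _
    · exact contract_eq_zero_of_subsingleton _ _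

/-- The divergence identity gives X_{π,λ} = -π♯ d log|h| - Y_{π,ψ}, so the twist cancels in the sum.
-/
theorem isModularFieldOn_dPoisson (hq : IsQuadraticLie B (bracketE E G))
    (hinv : ∀ (g : G) (u v : E), B (adE E g u) (adE E g v) = B u v)
    (b : Module.Basis (Fin (Module.finrank ℝ E)) ℝ E) {vol : FormField E G (Module.finrank ℝ E)}
    (hvol : IsVolumeFormOn vol (regularSet E G)) :
    IsModularFieldOn (severaWeinstein (E := E) (G := G) hq.nondegenerate)
      (leftForm (E := E) (G := G) hq.cartanForm) vol (regularSet E G)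
      (dPoisson (severaWeinstein (E := E) (G := G) hq.nondegenerate)
        (fun g => Real.log (volumeDensity b vol g))) := by
  refine ⟨fun x => dPoisson (severaWeinstein (E := E) (G := G) hq.nondegenerate)
    (fun g => Real.log (volumeDensity b vol g)) x -
      twistField (severaWeinstein (E := E) (G := G) hq.nondegenerate)
        (leftForm (E := E) (G := G) hq.cartanForm) x, fun α hα x hx => ?_,
    fun x _ => (sub_add_cancel _ _).symm⟩
  exact (congrArg (fun c : ℝ => c • vol x) (map_sub (α x) _ _)).trans
    (lieDeriv_sharpField_sub_contract hq hinv rfl b hx (hvol.1 x hx) (hvol.2 x hx) (hα x hx)).symm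

theorem isVolumeFormOn_leftForm (b : Module.Basis (Fin (Module.finrank ℝ E)) ℝ E) (U : Set G) :
    IsVolumeFormOn (leftForm (E := E) (G := G) (basisVolume (E := E) b)) U := by
  refine ⟨fun x _ => contDiffAt_compContinuousLinearMap (W := E) (X := E) (basisVolume (E := E) b)
    (contDiffAt_coframe (E := E) x), fun x _ h => ?_⟩
  have h1 := congrArg (fun f : E [⋀^Fin (Module.finrank ℝ E)]→L[ℝ] ℝ => f fun i => leftFrame E x (b i)) h
  have h2 : (basisVolume b fun i => (leftToOne (E := E) x : E →L[ℝ] E) (leftFrame E x (b i))) = 1 :=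
    (congrArg (basisVolume b) (funext fun i => leftToOne_leftField (E := E) x (b i))).trans
      (basisVolume_self b)
  exact one_ne_zero (h2.symm.trans h1)

/-- The left and right translates differ by the factor det Ad_g, which is 1 on G₀. -/
theorem isBiinvariantOn_leftForm (hB : B.Nondegenerate)
    (hinv : ∀ (g : G) (u v : E), B (adE E g u) (adE E g v) = B u v) {k : ℕ}
    (b : Module.Basis (Fin k) ℝ E) :
    IsBiinvariantOn (leftForm (E := E) (G := G) (basisVolume (E := E) b)) (regularSet E G) := by
  refine ⟨basisVolume (E := E) b, fun g hg => ⟨rfl, ContinuousAlternatingMap.ext fun v => ?_⟩⟩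
  have h := basisVolume_comp b (adE E g)
  rw [det_adE hB hinv hg, one_smul] at h
  have h1 := congrArg (fun f : E [⋀^Fin k]→L[ℝ] ℝ =>
    f fun i => (leftToOne (E := E) g : E →L[ℝ] E) (v i)) h
  exact h1.symm.trans (congrArg (basisVolume b : E [⋀^Fin k]→L[ℝ] ℝ)
    (funext fun i => (rightToOne_eq (E := E) g (v i)).symm))

omit [FiniteDimensional ℝ E] in
theorem volumeDensity_eq_of_biinvariant {k : ℕ} (b : Module.Basis (Fin k) ℝ E)
    {vol : FormField E G k} {U : Set G} (h : IsBiinvariantOn vol U) :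
    ∃ c : ℝ, ∀ g ∈ U, volumeDensity b vol g = c := by
  obtain ⟨η, hη⟩ := h
  refine ⟨(η : E [⋀^Fin k]→L[ℝ] ℝ) b, fun g hg => ?_⟩
  have h1 := congrArg (fun f : E [⋀^Fin k]→L[ℝ] ℝ => f fun i => leftFrame E g (b i)) (hη g hg).1
  exact h1.trans (congrArg (η : E [⋀^Fin k]→L[ℝ] ℝ) (funext fun i => leftToOne_leftField (E := E) g (b i)))

theorem dPoisson_eq_zero_of_const {M : Type*} [TopologicalSpace M] [ChartedSpace E M]
    (π : BivectorField E M) {f : M → ℝ} {U : Set M} (hU : IsOpen U) {c : ℝ} (hf : ∀ g ∈ U, f g = c)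
    {x : M} (hx : x ∈ U) : dPoisson π f x = 0 := by
  have h1 : f =ᶠ[𝓝 x] fun _ => c := Filter.eventually_of_mem (hU.mem_nhds hx) hf
  have h2 : dFun (E := E) f x = 0 :=
    (h1.mfderiv_eq (I := 𝓘(ℝ, E)) (I' := 𝓘(ℝ, ℝ))).trans (mfderiv_const)
  rw [dPoisson, h2, map_zero, neg_zero]

theorem contMDiffOn_log_volumeDensity {k : ℕ} (b : Module.Basis (Fin k) ℝ E) {vol : FormField E G k}
    {U : Set G} (hs : SmoothFormOn vol U) (hne : ∀ x ∈ U, vol x ≠ 0) :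
    ContMDiffOn 𝓘(ℝ, E) 𝓘(ℝ, ℝ) ∞ (fun g => Real.log (volumeDensity b vol g)) U := fun x hx => by
  refine (contMDiffAt_of_chart ((contDiffAt_volumeDensity b (hs x hx)).log ?_)).contMDiffWithinAt
  rw [extChartAt_to_inv]
  exact volumeDensity_ne_zero b (hne x hx)

end Unimodular

theorem mainTheorem10 {E : Type*} [NormedAddCommGroup E] [NormedSpace ℝ E] [FiniteDimensional ℝ E]
    {G : Type*} [TopologicalSpace G] [ChartedSpace E G] [Group G] [LieGroup 𝓘(ℝ, E) ∞ G]
    (B : LinearMap.BilinForm ℝ (GroupLieAlgebra 𝓘(ℝ, E) G))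
    (hsymm : B.IsSymm) (hnondeg : B.Nondegenerate)
    (hinv : ∀ (g : G) (X Y : GroupLieAlgebra 𝓘(ℝ, E) G), B (Ad g X) (Ad g Y) = B X Y) :
    IsOpen (regularSet E G) ∧ (ConnectedSpace G → Dense (regularSet E G)) ∧
    ∃ (ψ : FormField E G 3) (π : BivectorField E G),
      IsCartanForm B ψ ∧ IsSeveraWeinsteinBivector B π ∧
      (∀ π' : BivectorField E G, IsSeveraWeinsteinBivector B π' →
        ∀ g ∈ regularSet E G, π' g = π g) ∧
      IsTwistedPoissonOn π ψ (regularSet E G) ∧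
      (∃ vol : FormField E G (Module.finrank ℝ E),
        IsVolumeFormOn vol (regularSet E G) ∧ IsBiinvariantOn vol (regularSet E G)) ∧
      (∀ vol : FormField E G (Module.finrank ℝ E),
        IsVolumeFormOn vol (regularSet E G) → IsBiinvariantOn vol (regularSet E G) →
        IsModularFieldOn π ψ vol (regularSet E G) 0) ∧
      IsUnimodularOn π ψ (regularSet E G) := by
  have hq : IsQuadraticLie (W := E) B (bracketE E G) :=
    isQuadraticLie_of_invariant (E := E) hsymm hnondeg hinv
  let b := Module.finBasis ℝ E
  have hmod := fun vol => isModularFieldOn_dPoisson (E := E) (vol := vol) hq hinv b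
  refine ⟨isOpen_regularSet, fun _ => dense_regularSet, leftForm (E := E) (G := G) hq.cartanForm,
    severaWeinstein (E := E) (G := G) hq.nondegenerate, isCartanForm_leftForm hq hinv,
    isSeveraWeinsteinBivector_severaWeinstein hq.nondegenerate hq.symm hinv,
    fun π' hπ' g hg => eq_severaWeinstein hq.nondegenerate hq.symm hinv hπ' hg,
    isTwistedPoissonOn_severaWeinstein hq hinv,
    ⟨_, isVolumeFormOn_leftForm b _, isBiinvariantOn_leftForm (E := E) hq.nondegenerate hinv b⟩,
    fun vol hvol hbi => ?_, ⟨_, isVolumeFormOn_leftForm b _⟩, fun vol hvol =>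
      ⟨_, contMDiffOn_log_volumeDensity b hvol.1 hvol.2, hmod vol hvol⟩⟩
  -- For a bi-invariant volume form the density is constant on the open set G₀, so the Hamiltonian
  -- field of its logarithm vanishes there.
  obtain ⟨c, hc⟩ := volumeDensity_eq_of_biinvariant b hbi
  obtain ⟨X, hX, hZ⟩ := hmod vol hvol
  refine ⟨X, hX, fun x hx => Eq.trans ?_ (hZ x hx)⟩
  exact (dPoisson_eq_zero_of_const _ isOpen_regularSet (c := Real.log c)
    (fun g hg => congrArg Real.log (hc g hg)) hx).symm
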